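/- For a polynomial $f=\sum c_{\alpha,\beta}x^\alpha y^\beta\in\mathbb C[x^{-1},x,y]$ let $\mathrm{Supp} f\subset\mathbb Z^2$ be its support, and let $\chi_c$ denote the Euler characteristic with compact supports, $\chi_c(X)=\sum_n(-1)^n\dim H^n_c(X;\mathbb Q)$, for the classical topology. The one-dimensional faces of the Newton polygon at the origin $\mathcal N(f)$ are the segments joining consecutive vertices of the convex hull of $\mathrm{Supp} f+\mathbb R_{\ge 0}^2$. Those of the global Newton polygon $\overline{\mathcal N}(f)$ are the edges of the convex hull of $\mathrm{Supp} f$ (the segment itself, if this hull is a segment). For $f\in\mathbb C[x,y]$ put $E=\mathrm{Supp} f\cup\{(0,0)\}$ and let $V_{0,\infty}$, $V_{\infty,\infty}$, $V_{\infty,0}$ be the sets of vertices of the convex hulls of $E+(\mathbb R_{\ge0}\times\mathbb R_{\le0})$, $E+(\mathbb R_{\le0}\times\mathbb R_{\le0})$, $E+(\mathbb R_{\le0}\times\mathbb R_{\ge0})$; the one-dimensional faces of the Newton polygon at infinity $\mathcal N_\infty(f)$ are the segments joining two consecutive points of $V_{0,\infty}\cup V_{\infty,\infty}$, ordered by the first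 coordinate, or two consecutive points of $V_{\infty,\infty}\cup V_{\infty,0}$, ordered by the second coordinate. For a segment $\gamma=[v,w]$ with distinct end points in $\mathbb Z^2$ let $\mathcal S_\gamma=|\det(v,w)|/2$, let $s_\gamma$ be the number of integer points of $\gamma$ other than $v,w$, let $f_\gamma$ be the sum of the terms of $f$ with exponent on $\gamma$, and let $r_\gamma$ be the number of its distinct roots, that is, of the $\mu\in\mathbb C^*$ such that $f_\gamma$ vanishes on the curve $x^{e_1}y^{e_2}=\mu$ of $(\mathbb C^*)^2$, where $(e_1,e_2)$ is the primitive integer vector in the direction $w-v$. For a polygon $\mathcal N$ as above the area of $\mathcal N$ with respect to $f$ is $$\mathcal S_{\mathcal N,f}=\sum_{\gamma}\frac{r_\gamma\,\mathcal S_\gamma}{s_\gamma+1},$$ the sum over the one-dimensional faces $\gamma$ of $\mathcal N$. **Proposition (quasi-homogeneous case).** 1. Let $f=x^ay^b$ with $a\in\mathbb Z\setminus\{0\}$ and $b\in\mathbb Z_{>0}$. Then $$\chi_c\bigl(f^{-1}(1)\cap(\mathbb C^*)^2\bigr)=\chi_c\bigl(f^{-1}(1)\bigr)=0,$$ where $f^{-1}(1)$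 is taken in $\mathbb C^*\times\mathbb C$, or in $\mathbb C^2$ if $a>0$. 2. Let $a\in\mathbb Z$, $b\in\mathbb Z_{\ge0}$, let $p,q$ be coprime positive integers, $r\ge1$, $\mu_1,\dots,\mu_r\in\mathbb C^*$ pairwise distinct, $\nu_1,\dots,\nu_r$ positive integers and $n=\sum_{i=1}^r\nu_i$. (a) If $f=x^ay^b\prod_{i=1}^r(x^q-\mu_iy^p)^{\nu_i}$, then $$\chi_c\bigl(f^{-1}(1)\cap(\mathbb C^*)^2\bigr)=-\frac{2r\mathcal S}{n}=-2\,\mathcal S_{\mathcal N(f),f},$$ where $\mathcal S$ is the area of the (possibly degenerate) triangle with vertices $(0,0)$, $(a+qn,b)$, $(a,b+pn)$. (b) If $f=x^ay^b\prod_{i=1}^r(x^qy^p-\mu_i)^{\nu_i}$, then $$\chi_c\bigl(f^{-1}(1)\cap(\mathbb C^*)^2\bigr)=-\frac{2r\mathcal S}{n}=-2\,\mathcal S_{\overline{\mathcal N}(f),f},$$ where $\mathcal S$ is the area of the (possibly degenerate) triangle with vertices $(0,0)$, $(a,b)$, $(a+qn,b+pn)$. In both cases, if moreover $f\in\mathbb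 C[x,y]$, then $\chi_c\bigl(f^{-1}(1)\cap(\mathbb C^*)^2\bigr)=-2\,\mathcal S_{\mathcal N_\infty(f),f}$. -/

import Mathlib

open scoped Topology Pointwise

noncomputable section

/-! ### Alexander–Spanier cohomology with compact supports and the Euler characteristic `χ_c` -/

namespace CompactSupp

variable (X : Type*)

/-- Alexander–Spanier `n`-cochains: arbitrary rational functions on `X ^ (n + 1)`. -/
abbrev Cochain (n : ℕ) : Type _ := (Fin (n + 1) → X) → ℚ

variable {X}

/-- The coboundary `(δ φ)(x₀, …, xₙ₊₁) = ∑ i, (-1) ^ i φ(x₀, …, x̂ᵢ, …, xₙ₊₁)`. -/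
def coboundary (n : ℕ) : Cochain X n →ₗ[ℚ] Cochain X (n + 1) where
  toFun φ p := ∑ i : Fin (n + 2), (-1 : ℚ) ^ (i : ℕ) * φ (fun j => p (i.succAbove j))
  map_add' φ ψ := by
    funext p
    simp [mul_add, Finset.sum_add_distrib]
  map_smul' c φ := by
    funext p
    simp [Finset.mul_sum, mul_left_comm]

variable [TopologicalSpace X]

/-- `φ` vanishes on all tuples of points of some neighbourhood of `x`. -/
def LocallyZeroAt {n : ℕ} (φ : Cochain X n) (x : X) : Prop :=
  ∃ U ∈ 𝓝 x, ∀ p : Fin (n + 1) → X, (∀ i, p i ∈ U) → φ p = 0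

theorem LocallyZeroAt.zero {n : ℕ} (x : X) : LocallyZeroAt (0 : Cochain X n) x :=
  ⟨Set.univ, Filter.univ_mem, fun _ _ => rfl⟩

theorem LocallyZeroAt.add {n : ℕ} {φ ψ : Cochain X n} {x : X}
    (hφ : LocallyZeroAt φ x) (hψ : LocallyZeroAt ψ x) : LocallyZeroAt (φ + ψ) x := by
  obtain ⟨U, hU, h⟩ := hφ
  obtain ⟨V, hV, h'⟩ := hψ
  refine ⟨U ∩ V, Filter.inter_mem hU hV, fun p hp => ?_⟩
  simp [h p fun i => (hp i).1, h' p fun i => (hp i).2]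

theorem LocallyZeroAt.smul {n : ℕ} {φ : Cochain X n} {x : X} (c : ℚ)
    (hφ : LocallyZeroAt φ x) : LocallyZeroAt (c • φ) x := by
  obtain ⟨U, hU, h⟩ := hφ
  exact ⟨U, hU, fun p hp => by simp [h p hp]⟩

variable (X)

/-- The locally zero cochains. -/
def locallyZero (n : ℕ) : Submodule ℚ (Cochain X n) where
  carrier := {φ | ∀ x, LocallyZeroAt φ x}
  add_mem' hφ hψ x := (hφ x).add (hψ x)
  zero_mem' x := LocallyZeroAt.zero x
  smul_mem' c _ hφ x := (hφ x).smul c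

/-- The cochains with compact support: those that are locally zero outside a compact set. -/
def compactlySupported (n : ℕ) : Submodule ℚ (Cochain X n) where
  carrier := {φ | ∃ K : Set X, IsCompact K ∧ ∀ x, x ∉ K → LocallyZeroAt φ x}
  add_mem' := by
    rintro φ ψ ⟨K, hK, h⟩ ⟨L, hL, h'⟩
    refine ⟨K ∪ L, hK.union hL, fun x hx => ?_⟩
    exact (h x fun hxK => hx (Or.inl hxK)).add (h' x fun hxL => hx (Or.inr hxL))
  zero_mem' := ⟨∅, isCompact_empty, fun x _ => LocallyZeroAt.zero x⟩
  smul_mem' := by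
    rintro c φ ⟨K, hK, h⟩
    exact ⟨K, hK, fun x hx => (h x hx).smul c⟩

/-- Representatives of the `n`-cocycles of the complex
`compactlySupported X / locallyZero X`. -/
def cocycles (n : ℕ) : Submodule ℚ (Cochain X n) :=
  compactlySupported X n ⊓ (locallyZero X (n + 1)).comap (coboundary n)

/-- Representatives of the `n`-coboundaries of the complex
`compactlySupported X / locallyZero X`. -/
def coboundaries : (n : ℕ) → Submodule ℚ (Cochain X n)
  | 0 => locallyZero X 0
  | n + 1 => (compactlySupported X n).map (coboundary n) ⊔ locallyZero X (n + 1)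

/-- `H_c^n(X; ℚ)`: the Alexander–Spanier cohomology with compact supports, that is, the cohomology
of the cochain complex `compactlySupported X / locallyZero X`. -/
abbrev Cohomology (n : ℕ) : Type _ :=
  cocycles X n ⧸ (coboundaries X n).submoduleOf (cocycles X n)

/-- The total cohomology `⨁ n, H_c^n(X; ℚ)` has finite dimension, so that `χ_c(X)` is defined. -/
def FiniteCohomology : Prop :=
  (∀ n, Module.Finite ℚ (Cohomology X n)) ∧ ∃ N, ∀ n, N ≤ n → Subsingleton (Cohomology X n)

/-- `χ_c(X) = ∑ n, (-1) ^ n dim H_c^n(X; ℚ)`, meaningful if `FiniteCohomology X`. -/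
def eulerChar : ℤ :=
  ∑ᶠ n : ℕ, (-1 : ℤ) ^ n * (Module.finrank ℚ (Cohomology X n) : ℤ)

/-- `χ_c(X)` is defined and equal to the real number `c`. -/
def HasEulerChar (c : ℝ) : Prop :=
  FiniteCohomology X ∧ (eulerChar X : ℝ) = c

end CompactSupp

/-! ### The ring `ℂ[x⁻¹, x, y]` -/

namespace NewtonPolygon

/-- The ring `ℂ[x⁻¹, x, y]`; the exponent `(α, β)` stands for `x ^ α y ^ β`. -/
abbrev LaurentPoly : Type := AddMonoidAlgebra ℂ (ℤ × ℕ)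

/-- The term `c x ^ a y ^ b`. -/
def term (c : ℂ) (a : ℤ) (b : ℕ) : LaurentPoly := AddMonoidAlgebra.single (a, b) c

/-- The value `f(x, y)`, where `x ≠ 0` or `f` has no negative power of `x`. -/
def eval (f : LaurentPoly) (x y : ℂ) : ℂ :=
  ∑ m ∈ f.coeff.support, f.coeff m * x ^ m.1 * y ^ m.2

/-- `f` belongs to `ℂ[x, y]`. -/
def IsPoly (f : LaurentPoly) : Prop := ∀ m ∈ f.coeff.support, 0 ≤ m.1

/-- `f⁻¹(1) ∩ 𝔾ₘ²`, with the topology induced by `ℂ²`. -/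
def torusFiber (f : LaurentPoly) : Set (ℂ × ℂ) :=
  {z | z.1 ≠ 0 ∧ z.2 ≠ 0 ∧ eval f z.1 z.2 = 1}

/-- `f⁻¹(1)` in `𝔾ₘ × 𝔸¹`, the variety on which `f` in `ℂ[x⁻¹, x, y]` is a function. -/
def fiber (f : LaurentPoly) : Set (ℂ × ℂ) :=
  {z | z.1 ≠ 0 ∧ eval f z.1 z.2 = 1}

/-- `f⁻¹(1)` in `𝔸²`, for `f` in `ℂ[x, y]`. -/
def affineFiber (f : LaurentPoly) : Set (ℂ × ℂ) :=
  {z | eval f z.1 z.2 = 1}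

/-! ### Newton polygons -/

/-- The inclusion of `ℤ²` in `ℝ²`. -/
def toPlane (v : ℤ × ℤ) : ℝ × ℝ := ((v.1 : ℝ), (v.2 : ℝ))

/-- The support of `f` as a subset of `ℤ²`. -/
def supp (f : LaurentPoly) : Set (ℤ × ℤ) :=
  (fun m : ℤ × ℕ => (m.1, (m.2 : ℤ))) '' (f.coeff.support : Set (ℤ × ℕ))

/-- The smallest convex set containing `E + Q`. -/
def diagram (E : Set (ℤ × ℤ)) (Q : Set (ℝ × ℝ)) : Set (ℝ × ℝ) :=
  convexHull ℝ (toPlane '' E + Q)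

/-- The set of vertices of `diagram E Q`. -/
def vertices (E : Set (ℤ × ℤ)) (Q : Set (ℝ × ℝ)) : Set (ℤ × ℤ) :=
  {v | toPlane v ∈ (diagram E Q).extremePoints ℝ}

/-- `v` and `w` are consecutive elements of `V`, ordered by the function `g`. -/
def Consecutive (g : ℤ × ℤ → ℤ) (V : Set (ℤ × ℤ)) (v w : ℤ × ℤ) : Prop :=
  v ∈ V ∧ w ∈ V ∧ g v < g w ∧ ∀ u ∈ V, ¬ (g v < g u ∧ g u < g w)

/-- The lexicographic order, used to list each segment `[v, w]` once. -/
def LexLt (v w : ℤ × ℤ) : Prop := v.1 < w.1 ∨ (v.1 = w.1 ∧ v.2 < w.2)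

/-- The vertices of the Newton diagram of `f` at the origin, that is, of the smallest convex set
containing `Supp f + ℝ₊²`. -/
def originVertices (f : LaurentPoly) : Set (ℤ × ℤ) :=
  vertices (supp f) (Set.Ici 0 ×ˢ Set.Ici 0)

/-- The one-dimensional faces `[v, w]` of the Newton polygon at the origin `𝒩(f)`. -/
def originFaces (f : LaurentPoly) : Set ((ℤ × ℤ) × (ℤ × ℤ)) :=
  {γ | Consecutive Prod.fst (originVertices f) γ.1 γ.2}

/-- The one-dimensional faces `[v, w]` of the global Newton polygon of `f`, that is, of the convex
hull of `Supp f` (which is its own face if it is a segment). -/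
def globalFaces (f : LaurentPoly) : Set ((ℤ × ℤ) × (ℤ × ℤ)) :=
  {γ | LexLt γ.1 γ.2 ∧ IsExtreme ℝ (convexHull ℝ (toPlane '' supp f))
    (segment ℝ (toPlane γ.1) (toPlane γ.2))}

/-- `V_{0,∞}` for the set `Supp f ∪ {(0, 0)}`. -/
def verticesZeroInf (f : LaurentPoly) : Set (ℤ × ℤ) :=
  vertices (insert 0 (supp f)) (Set.Ici 0 ×ˢ Set.Iic 0)

/-- `V_{∞,∞}` for the set `Supp f ∪ {(0, 0)}`. -/
def verticesInfInf (f : LaurentPoly) : Set (ℤ × ℤ) :=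
  vertices (insert 0 (supp f)) (Set.Iic 0 ×ˢ Set.Iic 0)

/-- `V_{∞,0}` for the set `Supp f ∪ {(0, 0)}`. -/
def verticesInfZero (f : LaurentPoly) : Set (ℤ × ℤ) :=
  vertices (insert 0 (supp f)) (Set.Iic 0 ×ˢ Set.Ici 0)

/-- The one-dimensional faces of the Newton polygon at infinity `𝒩_∞(f)` of `f` in `ℂ[x, y]`: the
segments between consecutive vertices at infinity, where `V_{0,∞} ∪ V_{∞,∞}` is ordered by the
first coordinate and `V_{∞,∞} ∪ V_{∞,0}` by the second one. -/
def infinityFaces (f : LaurentPoly) : Set ((ℤ × ℤ) × (ℤ × ℤ)) :=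
  {γ | LexLt γ.1 γ.2 ∧
    (Consecutive Prod.fst (verticesZeroInf f ∪ verticesInfInf f) γ.1 γ.2 ∨
      Consecutive Prod.snd (verticesInfInf f ∪ verticesInfZero f) γ.1 γ.2 ∨
      Consecutive Prod.snd (verticesInfInf f ∪ verticesInfZero f) γ.2 γ.1)}

/-! ### The area of a Newton polygon with respect to `f` -/

/-- The primitive vector with the direction of the segment `[v, w]`. -/
def direction (γ : (ℤ × ℤ) × (ℤ × ℤ)) : ℤ × ℤ :=
  ((γ.2.1 - γ.1.1) / Int.gcd (γ.2.1 - γ.1.1) (γ.2.2 - γ.1.2),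
    (γ.2.2 - γ.1.2) / Int.gcd (γ.2.1 - γ.1.1) (γ.2.2 - γ.1.2))

open Classical in
/-- The face polynomial `f_γ`: the part of `f` supported on the segment `γ = [v, w]`. -/
def facePoly (f : LaurentPoly) (γ : (ℤ × ℤ) × (ℤ × ℤ)) : LaurentPoly :=
  AddMonoidAlgebra.ofCoeff (f.coeff.filter fun m =>
    toPlane (m.1, (m.2 : ℤ)) ∈ segment ℝ (toPlane γ.1) (toPlane γ.2))

/-- The roots of the face polynomial `f_γ`. If `γ` has the primitive direction `(u, v)`, then
`f_γ` is a term times the product of the powers `(x ^ u y ^ v - μ) ^ ν`, for distinct `μ ≠ 0`;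
these `μ` are the ones such that `f_γ` vanishes on the curve `x ^ u y ^ v = μ` of the torus. -/
def faceRoots (f : LaurentPoly) (γ : (ℤ × ℤ) × (ℤ × ℤ)) : Set ℂ :=
  {μ | μ ≠ 0 ∧ ∀ x y : ℂ, x ≠ 0 → y ≠ 0 →
    x ^ (direction γ).1 * y ^ (direction γ).2 = μ → eval (facePoly f γ) x y = 0}

/-- The number of points with integer coordinates on `γ = [v, w]` other than `v` and `w`. -/
def interiorPoints (γ : (ℤ × ℤ) × (ℤ × ℤ)) : ℕ :=
  {u : ℤ × ℤ | toPlane u ∈ openSegment ℝ (toPlane γ.1) (toPlane γ.2)}.ncard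

/-- The area `|det(v, w)| / 2` of the face `γ = [v, w]`. -/
def faceArea (γ : (ℤ × ℤ) × (ℤ × ℤ)) : ℝ :=
  |((γ.1.1 * γ.2.2 - γ.1.2 * γ.2.1 : ℤ) : ℝ)| / 2

/-- The area with respect to `f` of the polygon with the one-dimensional faces `F`:
the sum of the numbers `r_γ S_γ / (s_γ + 1)`, with `r_γ` the number of distinct roots of `f_γ`,
`S_γ` the area of `γ` and `s_γ` the number of its interior integer points. -/
def areaWrt (F : Set ((ℤ × ℤ) × (ℤ × ℤ))) (f : LaurentPoly) : ℝ :=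
  ∑ᶠ γ ∈ F, ((faceRoots f γ).ncard : ℝ) * faceArea γ / ((interiorPoints γ : ℝ) + 1)

/-- The area (Lebesgue measure) of the triangle with the vertices `(0, 0)`, `v` and `w`. -/
def triangleArea (v w : ℤ × ℤ) : ℝ :=
  MeasureTheory.volume.real (convexHull ℝ {0, toPlane v, toPlane w})

/-- `x ^ a y ^ b ∏ (x ^ q - μ_i y ^ p) ^ ν_i` -/
def formDiff (a : ℤ) (b p q : ℕ) {r : ℕ} (μ : Fin r → ℂ) (ν : Fin r → ℕ) : LaurentPoly :=
  term 1 a b * ∏ i, (term 1 (q : ℤ) 0 - term (μ i) 0 p) ^ ν i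

/-- `x ^ a y ^ b ∏ (x ^ q y ^ p - μ_i) ^ ν_i` -/
def formProd (a : ℤ) (b p q : ℕ) {r : ℕ} (μ : Fin r → ℂ) (ν : Fin r → ℕ) : LaurentPoly :=
  term 1 a b * ∏ i, (term 1 (q : ℤ) p - term (μ i) 0 0) ^ ν i

end NewtonPolygon

end

/-! Both families have the form f = x^{v₁} y^{v₂} ∏ (x^{e₁} y^{e₂} - μᵢ)^{νᵢ} on the torus, with
(e₁, e₂) primitive (`IsEdgePoly`). A Bézout relation for (e₁, e₂) gives a monomial automorphism of
the torus that makes t = x^{e₁} y^{e₂} one of the coordinates. The curve f = 1 becomes s^M t^k ∏ (t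
- μᵢ)^{νᵢ} = 1 with M = det(e, v). If M ≠ 0, this is a covering with |M| sheets of the plane without
the r + 1 points 0, μ₁, …, μᵣ, so χ_c = |M| (1 - (r + 1)) = -r |M|. If M = 0, it is a finite union
of copies of ℂ^*, and χ_c = 0. This is `hasChi_torus_curve`.

The combinatorial side also reduces to r |M|. The support of f spans a segment of lattice length n =
∑ νᵢ, with area n |M| / 2 and with the μᵢ as its roots, so it contributes r |M| / 2 to the area with
respect to f, and the triangle has area n |M| / 2. The origin polygon and the global polygon have no
other faces. Any other face of the polygon at infinity has an end point at the origin, hence area 0.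
The segment itself is a face whenever M ≠ 0, as linear functionals with a strict minimum at its end
points show (`areaWrt_eq`, `mem_vertices`).

The topology is derived from the definition of Alexander–Spanier cohomology. Extension by zero
identifies the compactly supported cohomology of an open set with that of a complex of submodules of
cochains on the ambient space, and Mayer–Vietoris becomes modular arithmetic of submodules
(`mayerVietorisRanks_rel`, `mayerVietorisRanks_open`). A compact convex set is acyclic: it can be
shrunk to a point in small steps, each of which is homotopic to the identity through a prism
operator (`exists_zeroNear_sub_coboundary`). It follows that a compact convex set without a nonempty
slice ℓ ≥ a has χ_c = 0 (`hasChi_convex_lt`). Inclusion and exclusion on a triangle gives χ_c = 1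
for the open triangle, hence for ℝ². Inclusion and exclusion with rectangles then gives m (1 - |P|)
for covers of degree m of ℂ without a finite set P (`CellCover.hasChi_univ`). -/

namespace CompactSupp

/-! ### Cochains on tuples of arbitrary length -/

section Tuples

variable {X : Type*}

/-- The coboundary on functions of `m`-tuples, where `m = 0` is allowed; for `m = n + 1` this is
`coboundary n`, and for `m = 0` the augmentation. -/
def tupleCoboundary (m : ℕ) : ((Fin m → X) → ℚ) →ₗ[ℚ] ((Fin (m + 1) → X) → ℚ) where
  toFun φ p := ∑ i : Fin (m + 1), (-1 : ℚ) ^ (i : ℕ) * φ (fun j => p (i.succAbove j))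
  map_add' φ ψ := by
    funext p
    simp [mul_add, Finset.sum_add_distrib]
  map_smul' c φ := by
    funext p
    simp [Finset.mul_sum, mul_left_comm]

theorem tupleCoboundary_succ (n : ℕ) (φ : Cochain X n) :
    tupleCoboundary (n + 1) φ = coboundary n φ := rfl

/-- The contraction of a cochain by a point. -/
def contract {m : ℕ} (x : X) (φ : (Fin (m + 1) → X) → ℚ) : (Fin m → X) → ℚ :=
  fun p => φ (Fin.cons x p)

theorem tupleCoboundary_zero_apply (φ : (Fin 0 → X) → ℚ) (p : Fin 1 → X) :
    tupleCoboundary 0 φ p = φ Fin.elim0 := by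
  change ∑ i : Fin 1, (-1 : ℚ) ^ (i : ℕ) * φ (fun j => p (i.succAbove j)) = _
  rw [Fin.sum_univ_one, Fin.val_zero, pow_zero, one_mul]
  congr 1
  funext i
  exact i.elim0

/-- The face that omits `x` gives `φ p`; every other face keeps `x` in front, and its index is
shifted by one, which changes the sign. Thus contraction by a point is a null homotopy of the
complex of all cochains, and the identities below follow by induction on the length of the tuples.
-/
theorem tupleCoboundary_cons (m : ℕ) (φ : (Fin (m + 1) → X) → ℚ) (x : X) (p : Fin (m + 1) → X) :
    tupleCoboundary (m + 1) φ (Fin.cons x p) = φ p - tupleCoboundary m (contract x φ) p := by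
  simp only [tupleCoboundary, LinearMap.coe_mk, AddHom.coe_mk]
  rw [Fin.sum_univ_succ, sub_eq_add_neg, ← Finset.sum_neg_distrib]
  congr 1
  · simp
  · refine Finset.sum_congr rfl fun i _ => ?_
    rw [Fin.val_succ, pow_succ, mul_neg_one, neg_mul, contract]
    congr 3
    funext j
    refine Fin.cases ?_ (fun k => ?_) j
    · simp
    · simp

theorem contract_sub {m : ℕ} (x : X) (φ ψ : (Fin (m + 1) → X) → ℚ) :
    contract x (φ - ψ) = contract x φ - contract x ψ := rfl

theorem contract_tupleCoboundary {m : ℕ} (x : X) (φ : (Fin (m + 1) → X) → ℚ) :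
    contract x (tupleCoboundary (m + 1) φ) = φ - tupleCoboundary m (contract x φ) :=
  funext fun p => tupleCoboundary_cons m φ x p

/-- With d the coboundary and ι the contraction by the first point, ι d d φ = d φ - d ι d φ = d φ -
d (φ - d ι φ) = d d ι φ, which is zero by induction. -/
theorem tupleCoboundary_comp (m : ℕ) (φ : (Fin m → X) → ℚ) :
    tupleCoboundary (m + 1) (tupleCoboundary m φ) = 0 := by
  induction m with
  | zero =>
    funext p
    rw [← Fin.cons_self_tail p, tupleCoboundary_cons, tupleCoboundary_zero_apply,
      tupleCoboundary_zero_apply]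
    simp [contract, tupleCoboundary_zero_apply]
  | succ m ih =>
    funext p
    rw [← Fin.cons_self_tail p, tupleCoboundary_cons, contract_tupleCoboundary, map_sub, ih]
    simp

theorem coboundary_comp (n : ℕ) (φ : Cochain X n) : coboundary (n + 1) (coboundary n φ) = 0 :=
  tupleCoboundary_comp (n + 1) φ

/-! ### The prism operator -/

/-- The prism operator of a map `f`, a homotopy between the identity and the pullback by `f`. -/
def prism (f : X → X) : (m : ℕ) → ((Fin (m + 1) → X) → ℚ) → ((Fin m → X) → ℚ)
  | 0, _, _ => 0
  | m + 1, φ, p => φ (Fin.cons (p 0) fun i => f (p i)) - prism f m (contract (p 0) φ) (Fin.tail p)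

theorem prism_zero (f : X → X) (φ : (Fin 1 → X) → ℚ) : prism f 0 φ = 0 := rfl

theorem prism_cons (f : X → X) (m : ℕ) (φ : (Fin (m + 2) → X) → ℚ) (x : X) (p : Fin m → X) :
    prism f (m + 1) φ (Fin.cons x p) =
      φ (Fin.cons x (Fin.cons (f x) fun i => f (p i))) - prism f m (contract x φ) p := by
  rw [prism]
  have h : (fun i => f ((Fin.cons x p : Fin (m + 1) → X) i)) =
      (Fin.cons (f x) fun i => f (p i) : Fin (m + 1) → X) := by
    funext i
    refine Fin.cases ?_ (fun k => ?_) i <;> simp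
  rw [h]
  simp

theorem prism_sub (f : X → X) (m : ℕ) (φ ψ : (Fin (m + 1) → X) → ℚ) :
    prism f m (φ - ψ) = prism f m φ - prism f m ψ := by
  induction m with
  | zero => simp [prism_zero]
  | succ m ih =>
    funext p
    simp only [prism, contract_sub, ih, Pi.sub_apply]
    ring

/-- The pullback of a cochain by a map. -/
def pullback {Y : Type*} (f : X → Y) {m : ℕ} (φ : (Fin m → Y) → ℚ) : (Fin m → X) → ℚ :=
  fun p => φ fun i => f (p i)

theorem tupleCoboundary_pullback {Y : Type*} (f : X → Y) {m : ℕ} (φ : (Fin m → Y) → ℚ) :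
    tupleCoboundary m (pullback f φ) = pullback f (tupleCoboundary m φ) := rfl

theorem contract_prism (f : X → X) (m : ℕ) (φ : (Fin (m + 2) → X) → ℚ) (x : X) :
    contract x (prism f (m + 1) φ) =
      pullback f (contract (f x) (contract x φ)) - prism f m (contract x φ) :=
  funext fun p => prism_cons f m φ x p

theorem pullback_cons (f : X → X) {m : ℕ} (φ : (Fin (m + 1) → X) → ℚ) (x : X) (p : Fin m → X) :
    pullback f φ (Fin.cons x p) = pullback f (contract (f x) φ) p := by
  simp only [pullback, contract]
  congr 1
  funext i
  refine Fin.cases ?_ (fun k => ?_) i <;> simp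

/-- Unwinding the recursion, `prism f m φ` is the alternating sum over i of φ(p₀, …, pᵢ, f pᵢ, f
pᵢ₊₁, …), the usual prism. Contraction by the first point `x` reduces the identity for `φ` to the
one for `contract x φ`; the remaining terms cancel by `tupleCoboundary_cons` at the point `f x`. -/
theorem prism_homotopy (f : X → X) (m : ℕ) (φ : (Fin (m + 1) → X) → ℚ) :
    tupleCoboundary m (prism f m φ) + prism f (m + 1) (tupleCoboundary (m + 1) φ) =
      pullback f φ - φ := by
  induction m with
  | zero =>
    funext p
    rw [← Fin.cons_self_tail p]
    simp only [prism_zero, map_zero, zero_add, prism_cons, Pi.sub_apply, tupleCoboundary_cons,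
      tupleCoboundary_zero_apply, contract, pullback_cons]
    simp only [pullback, Pi.zero_apply, sub_zero]
    have h : (Fin.elim0 : Fin 0 → X) = Fin.tail p := funext fun i => i.elim0
    rw [h]
    have h2 : (Fin.tail p) = fun i => f (Fin.tail p i) := funext fun i => i.elim0
    rw [← h2]
    rfl
  | succ m ih =>
    funext p
    rw [← Fin.cons_self_tail p]
    generalize p 0 = x
    generalize Fin.tail p = r
    have e := congrFun (ih (contract x φ)) r
    simp only [Pi.add_apply, Pi.sub_apply] at e ⊢
    rw [tupleCoboundary_cons, prism_cons, tupleCoboundary_cons, contract_prism, map_sub,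
      contract_tupleCoboundary, prism_sub, pullback_cons, tupleCoboundary_pullback]
    have h := tupleCoboundary_cons m (contract x φ) (f x) fun i => f (r i)
    simp only [Pi.sub_apply, pullback] at e h ⊢
    have h' : contract x φ (fun i => f (r i)) = φ (Fin.cons x fun i => f (r i)) := rfl
    have h'' : contract x φ r = φ (Fin.cons x r) := rfl
    have h3 : contract (f x) φ (fun i => f (r i)) = φ (Fin.cons (f x) fun i => f (r i)) := rfl
    linarith

/-- The prism evaluates `φ` only on tuples made of points `p i` and `f (p i)`. This locality makes
it compatible with cochains that vanish on small tuples. -/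
theorem prism_eq_zero (f : X → X) (m : ℕ) (φ : (Fin (m + 1) → X) → ℚ) (S : Set X)
    (hφ : ∀ p, (∀ i, p i ∈ S) → φ p = 0) (p : Fin m → X) (hp : ∀ i, p i ∈ S)
    (hfp : ∀ i, f (p i) ∈ S) : prism f m φ p = 0 := by
  induction m with
  | zero => rfl
  | succ m ih =>
    have h : ∀ r : Fin (m + 1) → X, (∀ i, r i ∈ S) → contract (p 0) φ r = 0 := by
      refine fun r hr => hφ _ fun i => ?_
      refine Fin.cases ?_ (fun k => ?_) i
      · simpa using hp 0
      · simpa using hr k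
    rw [prism, ih _ h (Fin.tail p) (fun i => hp i.succ) (fun i => hfp i.succ), sub_zero]
    refine hφ _ fun i => ?_
    refine Fin.cases ?_ (fun k => ?_) i
    · simpa using hp 0
    · simpa using hfp k

end Tuples

/-! ### Alternating sums of sequences of dimensions -/

/-- The sequence `l` of dimensions is finite, eventually zero and has the alternating sum `c`. -/
def HasAltSum (l : ℕ → ℕ∞) (c : ℤ) : Prop :=
  ∃ (k : ℕ → ℕ) (N : ℕ), (∀ n, l n = k n) ∧ (∀ n, N ≤ n → k n = 0) ∧
    ∑ n ∈ Finset.range N, (-1 : ℤ) ^ n * (k n : ℤ) = c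

theorem sum_range_eq_of_le {k : ℕ → ℕ} {N M : ℕ} (h : ∀ n, N ≤ n → k n = 0) (hNM : N ≤ M) :
    ∑ n ∈ Finset.range M, (-1 : ℤ) ^ n * (k n : ℤ) =
      ∑ n ∈ Finset.range N, (-1 : ℤ) ^ n * (k n : ℤ) := by
  refine (Finset.sum_subset (Finset.range_mono hNM) fun n _ hn => ?_).symm
  rw [h n (by simpa using hn)]
  simp

theorem sum_range_shift (k : ℕ → ℕ) (N : ℕ) :
    ∑ n ∈ Finset.range N, (-1 : ℤ) ^ n * (k (n + 1) : ℤ) =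
      k 0 - (∑ n ∈ Finset.range N, (-1 : ℤ) ^ n * (k n : ℤ)) - (-1) ^ N * k N := by
  induction N with
  | zero => simp
  | succ N ih =>
    rw [Finset.sum_range_succ, ih, Finset.sum_range_succ]
    ring

theorem HasAltSum.unique {l : ℕ → ℕ∞} {c c' : ℤ} (h : HasAltSum l c) (h' : HasAltSum l c') :
    c = c' := by
  obtain ⟨k, N, hk, hN, rfl⟩ := h
  obtain ⟨k', N', hk', hN', rfl⟩ := h'
  obtain rfl : k = k' := funext fun n => by
    have := (hk n).symm.trans (hk' n)
    exact_mod_cast this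
  rw [← sum_range_eq_of_le hN (le_max_left N N'), ← sum_range_eq_of_le hN' (le_max_right N N')]

/-- The dimensions in a Mayer–Vietoris sequence, in terms of the ranks of its maps. -/
structure MayerVietorisRanks (a b b' c : ℕ → ℕ∞) : Prop where
  -- Here `a`, `b`, `b'`, `c` belong to U ∩ V, U, V, U ∪ V. In degree n, `w` is the rank of a → b ⊕
  -- b', `u` that of b ⊕ b' → c, and `k (n + 1)` that of the connecting map from `c n` to `a (n +
  -- 1)`.
  exists_ranks : ∃ k u w : ℕ → ℕ∞, k 0 = 0 ∧ (∀ n, a n = w n + k n) ∧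
    (∀ n, c n = k (n + 1) + u n) ∧ ∀ n, b n + b' n = u n + w n

theorem exists_nat_seq {l : ℕ → ℕ∞} (h : ∀ n, l n ≠ ⊤) : ∃ k : ℕ → ℕ, ∀ n, l n = k n := by
  choose k hk using fun n => ENat.ne_top_iff_exists.mp (h n)
  exact ⟨k, fun n => (hk n).symm⟩

/-- All ranks are bounded by the given dimensions, hence finite and eventually zero. The shift of
the index in `k (n + 1)` only changes the sign of the alternating sum of `k`, since `k` vanishes in
degree 0 and in degree `N`. -/
theorem MayerVietorisRanks.hasAltSum_union {a b b' c : ℕ → ℕ∞} (h : MayerVietorisRanks a b b' c)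
    {α β β' : ℤ} (ha : HasAltSum a α) (hb : HasAltSum b β) (hb' : HasAltSum b' β') :
    HasAltSum c (β + β' - α) := by
  obtain ⟨k, u, w, hk0, hka, hkc, hkb⟩ := h.exists_ranks
  obtain ⟨a, Na, ea, za, rfl⟩ := ha
  obtain ⟨b, Nb, eb, zb, rfl⟩ := hb
  obtain ⟨b', Nb', eb', zb', rfl⟩ := hb'
  simp only [ea] at hka
  simp only [eb, eb'] at hkb
  obtain ⟨k, rfl'⟩ := exists_nat_seq (l := k) fun n hn => by
    have := hka n
    rw [hn] at this
    simp at this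
  obtain ⟨w, hw⟩ := exists_nat_seq (l := w) fun n hn => by
    have := hka n
    rw [hn] at this
    simp at this
  obtain ⟨u, hu⟩ := exists_nat_seq (l := u) fun n hn => by
    have := hkb n
    rw [hn] at this
    norm_cast at this
  simp only [rfl', hw, hu] at hk0 hka hkc hkb
  norm_cast at hk0 hka hkb
  set N := max Na (max Nb Nb') with hN
  have h1 : Na ≤ N := le_max_left _ _
  have h2 : Nb ≤ N := (le_max_left _ _).trans (le_max_right _ _)
  have h3 : Nb' ≤ N := (le_max_right _ _).trans (le_max_right _ _)
  have zk : ∀ n, N ≤ n → k n = 0 := fun n hn => by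
    have := za n (h1.trans hn)
    have := hka n
    omega
  have zu : ∀ n, N ≤ n → u n = 0 := fun n hn => by
    have := zb n (h2.trans hn)
    have := zb' n (h3.trans hn)
    have := hkb n
    omega
  refine ⟨fun n => k (n + 1) + u n, N, fun n => by rw [hkc]; norm_cast, fun n hn => ?_, ?_⟩
  · simp [zk (n + 1) (hn.trans n.le_succ), zu n hn]
  rw [← sum_range_eq_of_le za h1, ← sum_range_eq_of_le zb h2, ← sum_range_eq_of_le zb' h3]
  have e1 : ∑ n ∈ Finset.range N, (-1 : ℤ) ^ n * (a n : ℤ) =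
      (∑ n ∈ Finset.range N, (-1 : ℤ) ^ n * (w n : ℤ)) +
        ∑ n ∈ Finset.range N, (-1 : ℤ) ^ n * (k n : ℤ) := by
    rw [← Finset.sum_add_distrib]
    exact Finset.sum_congr rfl fun n _ => by rw [hka]; push_cast; ring
  have e2 : ∑ n ∈ Finset.range N, (-1 : ℤ) ^ n * (b n : ℤ) +
      ∑ n ∈ Finset.range N, (-1 : ℤ) ^ n * (b' n : ℤ) =
      (∑ n ∈ Finset.range N, (-1 : ℤ) ^ n * (u n : ℤ)) +
        ∑ n ∈ Finset.range N, (-1 : ℤ) ^ n * (w n : ℤ) := by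
    rw [← Finset.sum_add_distrib, ← Finset.sum_add_distrib]
    refine Finset.sum_congr rfl fun n _ => ?_
    rw [← mul_add, ← mul_add]
    congr 1
    exact_mod_cast hkb n
  have e3 := sum_range_shift k N
  rw [hk0, zk N le_rfl] at e3
  push_cast
  simp only [mul_add, Finset.sum_add_distrib]
  push_cast at e3
  linarith

/-- Once the dimensions of the intersection are known to be finite and eventually zero, the value is
forced by the formula for the union. -/
theorem MayerVietorisRanks.hasAltSum_inter {a b b' c : ℕ → ℕ∞} (h : MayerVietorisRanks a b b' c)
    {γ β β' : ℤ} (hc : HasAltSum c γ) (hb : HasAltSum b β) (hb' : HasAltSum b' β') :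
    HasAltSum a (β + β' - γ) := by
  have key : ∃ α, HasAltSum a α := by
    obtain ⟨k, u, w, hk0, hka, hkc, hkb⟩ := h.exists_ranks
    obtain ⟨c, Nc, ec, zc, rfl⟩ := hc
    obtain ⟨b, Nb, eb, zb, rfl⟩ := hb
    obtain ⟨b', Nb', eb', zb', rfl⟩ := hb'
    simp only [ec] at hkc
    simp only [eb, eb'] at hkb
    have hk : ∀ n, k n ≠ ⊤ := fun n hn => by
      cases n with
      | zero => simp [hk0] at hn
      | succ n =>
        have := hkc n
        rw [hn] at this
        simp at this
    obtain ⟨k, hk⟩ := exists_nat_seq hk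
    obtain ⟨w, hw⟩ := exists_nat_seq (l := w) fun n hn => by
      have := hkb n
      rw [hn] at this
      norm_cast at this
      simp at this
    simp only [hk, hw] at hk0 hka hkc hkb
    -- The bound on `k (n + 1)` comes from `c n`, so the vanishing of `k` can start one degree later
    -- than that of `c`.
    have zk : ∀ n, max Nc (max Nb Nb') + 1 ≤ n → k n = 0 := fun n hn => by
      obtain ⟨n, rfl⟩ : ∃ j, n = j + 1 := ⟨n - 1, by omega⟩
      have h0 := zc n (by omega)
      have := hkc n
      rw [h0, Nat.cast_zero, eq_comm, add_eq_zero] at this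
      exact_mod_cast this.1
    have zw : ∀ n, max Nc (max Nb Nb') + 1 ≤ n → w n = 0 := fun n hn => by
      have h0 := zb n (by omega)
      have h1 := zb' n (by omega)
      have := hkb n
      rw [h0, h1, Nat.cast_zero, add_zero, eq_comm, add_eq_zero] at this
      exact_mod_cast this.2
    refine ⟨_, fun n => w n + k n, max Nc (max Nb Nb') + 1, fun n => by rw [hka]; norm_cast,
      fun n hn => ?_, rfl⟩
    simp [zk n hn, zw n hn]
  obtain ⟨α, hα⟩ := key
  have := (h.hasAltSum_union hα hb hb').unique hc
  rwa [show β + β' - γ = α by omega]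

/-! ### Subquotients -/

section Subquotient

variable {V W : Type*} [AddCommGroup V] [Module ℚ V] [AddCommGroup W] [Module ℚ W]

/-- The subquotient `Z / B`, for submodules `B ≤ Z`. -/
abbrev Subquotient (Z B : Submodule ℚ V) : Type _ := Z ⧸ B.submoduleOf Z

/-- The map of subquotients induced by a linear map. -/
def subquotientMap {Z B : Submodule ℚ V} {Z' B' : Submodule ℚ W} (g : V →ₗ[ℚ] W)
    (hZ : ∀ x ∈ Z, g x ∈ Z') (hB : ∀ x ∈ B, g x ∈ B') : Subquotient Z B →ₗ[ℚ] Subquotient Z' B' :=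
  Submodule.mapQ _ _ (g.restrict hZ) fun _ hx => hB _ hx

theorem subquotient_mk_eq_zero {Z B : Submodule ℚ V} (x : Z) :
    (Submodule.Quotient.mk x : Subquotient Z B) = 0 ↔ (x : V) ∈ B := by
  rw [Submodule.Quotient.mk_eq_zero]
  rfl

theorem subquotientMap_mk {Z B : Submodule ℚ V} {Z' B' : Submodule ℚ W} (g : V →ₗ[ℚ] W)
    (hZ : ∀ x ∈ Z, g x ∈ Z') (hB : ∀ x ∈ B, g x ∈ B') (x : Z) :
    subquotientMap g hZ hB (Submodule.Quotient.mk x) =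
      Submodule.Quotient.mk (⟨g x, hZ x x.2⟩ : Z') := rfl

theorem subsingleton_subquotient {Z B : Submodule ℚ V} (h : Z ≤ B) :
    Subsingleton (Subquotient Z B) := by
  refine ⟨fun x y => ?_⟩
  obtain ⟨x, rfl⟩ := Submodule.Quotient.mk_surjective _ x
  obtain ⟨y, rfl⟩ := Submodule.Quotient.mk_surjective _ y
  rw [← sub_eq_zero, ← Submodule.Quotient.mk_sub, subquotient_mk_eq_zero]
  exact h (x - y).2

theorem length_subquotient_add {B Y Z : Submodule ℚ V} (hBY : B ≤ Y) (hYZ : Y ≤ Z) :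
    Module.length ℚ (Subquotient Z B) =
      Module.length ℚ (Subquotient Y B) + Module.length ℚ (Subquotient Z Y) := by
  refine Module.length_eq_add_of_exact
    (subquotientMap LinearMap.id (fun x hx => hYZ hx) fun x hx => hx)
    (subquotientMap LinearMap.id (fun x hx => hx) fun x hx => hBY hx) ?_ ?_ ?_
  · rw [injective_iff_map_eq_zero]
    intro x
    obtain ⟨x, rfl⟩ := Submodule.Quotient.mk_surjective _ x
    intro h
    rw [subquotientMap_mk, subquotient_mk_eq_zero] at h
    exact (subquotient_mk_eq_zero x).2 h
  · intro x
    obtain ⟨x, rfl⟩ := Submodule.Quotient.mk_surjective _ x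
    exact ⟨Submodule.Quotient.mk x, rfl⟩
  · intro x
    obtain ⟨x, rfl⟩ := Submodule.Quotient.mk_surjective _ x
    constructor
    · intro h
      exact ⟨Submodule.Quotient.mk ⟨x, (subquotient_mk_eq_zero _).1 h⟩, rfl⟩
    · rintro ⟨y, hy⟩
      obtain ⟨y, rfl⟩ := Submodule.Quotient.mk_surjective _ y
      rw [← hy]
      exact (subquotient_mk_eq_zero _).2 y.2

/-- The sequence 0 → (Z ∩ Z')/(B ∩ B') → Z/B ⊕ Z'/B' → (Z + Z')/(B + B') → 0 with the difference as
second map is exact. In the middle, x - y = β + β' gives the common representative x - β = y + β',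
which lies in Z ∩ Z' because B ≤ Z and B' ≤ Z'. -/
theorem length_subquotient_modular {Z B Z' B' : Submodule ℚ V} (h : B ≤ Z) (h' : B' ≤ Z') :
    Module.length ℚ (Subquotient Z B) + Module.length ℚ (Subquotient Z' B') =
      Module.length ℚ (Subquotient (Z ⊓ Z') (B ⊓ B')) +
        Module.length ℚ (Subquotient (Z ⊔ Z') (B ⊔ B')) := by
  rw [← Module.length_prod]
  refine Module.length_eq_add_of_exact
    ((subquotientMap (Z := Z ⊓ Z') (B := B ⊓ B') LinearMap.id (fun x hx => (hx : _ ∧ _).1)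
        fun x hx => (hx : _ ∧ _).1).prod
      (subquotientMap LinearMap.id (fun x hx => (hx : _ ∧ _).2) fun x hx => (hx : _ ∧ _).2))
    ((subquotientMap LinearMap.id (fun x hx => Submodule.mem_sup_left hx)
        fun x hx => Submodule.mem_sup_left hx).coprod
      (subquotientMap (-LinearMap.id) (fun x hx => Submodule.mem_sup_right (neg_mem hx))
        fun x hx => Submodule.mem_sup_right (neg_mem hx))) ?_ ?_ ?_
  · rw [injective_iff_map_eq_zero]
    intro x
    obtain ⟨x, rfl⟩ := Submodule.Quotient.mk_surjective _ x
    intro hx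
    have h1 := (subquotient_mk_eq_zero _).1 (congrArg Prod.fst hx)
    have h2 := (subquotient_mk_eq_zero _).1 (congrArg Prod.snd hx)
    exact (subquotient_mk_eq_zero _).2 ⟨h1, h2⟩
  · intro x
    obtain ⟨⟨x, hx⟩, rfl⟩ := Submodule.Quotient.mk_surjective _ x
    obtain ⟨y, hy, z, hz, rfl⟩ := Submodule.mem_sup.1 hx
    refine ⟨(Submodule.Quotient.mk ⟨y, hy⟩, Submodule.Quotient.mk ⟨-z, neg_mem hz⟩), ?_⟩
    rw [LinearMap.coprod_apply]
    change Submodule.Quotient.mk _ + Submodule.Quotient.mk _ = _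
    rw [← Submodule.Quotient.mk_add]
    congr 1
    ext
    simp
  · rintro ⟨x, y⟩
    obtain ⟨⟨x, hx⟩, rfl⟩ := Submodule.Quotient.mk_surjective _ x
    obtain ⟨⟨y, hy⟩, rfl⟩ := Submodule.Quotient.mk_surjective _ y
    constructor
    · intro hxy
      rw [LinearMap.coprod_apply] at hxy
      change Submodule.Quotient.mk _ + Submodule.Quotient.mk _ = _ at hxy
      rw [← Submodule.Quotient.mk_add, subquotient_mk_eq_zero] at hxy
      change x + -y ∈ _ at hxy
      obtain ⟨β, hβ, β', hβ', e⟩ := Submodule.mem_sup.1 hxy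
      have e' : x - β = y + β' := by
        rw [sub_eq_iff_eq_add, add_assoc, add_comm β', e]
        abel
      refine ⟨Submodule.Quotient.mk ⟨x - β, sub_mem hx (h hβ),
        e' ▸ add_mem hy (h' hβ')⟩, ?_⟩
      rw [LinearMap.prod_apply]
      refine Prod.ext ?_ ?_
      · rw [← sub_eq_zero]
        change Submodule.Quotient.mk _ - Submodule.Quotient.mk _ = _
        rw [← Submodule.Quotient.mk_sub, subquotient_mk_eq_zero]
        change x - β - x ∈ B
        simpa using hβ
      · rw [← sub_eq_zero]
        change Submodule.Quotient.mk _ - Submodule.Quotient.mk _ = _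
        rw [← Submodule.Quotient.mk_sub, subquotient_mk_eq_zero]
        change x - β - y ∈ B'
        rw [e']
        simpa using hβ'
    · rintro ⟨z, hz⟩
      obtain ⟨z, rfl⟩ := Submodule.Quotient.mk_surjective _ z
      rw [← hz, LinearMap.prod_apply, LinearMap.coprod_apply]
      change Submodule.Quotient.mk _ + Submodule.Quotient.mk _ = _
      rw [← Submodule.Quotient.mk_add, subquotient_mk_eq_zero]
      change (z : V) + -(z : V) ∈ _
      simp

end Subquotient

/-! ### Cohomology of a complex of submodules relative to a smaller one -/

section Relative

variable {C : ℕ → Type*} [∀ n, AddCommGroup (C n)] [∀ n, Module ℚ (C n)]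
  (d : ∀ n, C n →ₗ[ℚ] C (n + 1))

/-- Representatives of the `n`-cocycles of the complex `A / L`. -/
def relCocycles (A L : ∀ n, Submodule ℚ (C n)) (n : ℕ) : Submodule ℚ (C n) :=
  A n ⊓ (L (n + 1)).comap (d n)

/-- Representatives of the `n`-coboundaries of the complex `A / L`. -/
def relCoboundaries (A L : ∀ n, Submodule ℚ (C n)) : (n : ℕ) → Submodule ℚ (C n)
  | 0 => L 0
  | n + 1 => (A n).map (d n) ⊔ L (n + 1)

/-- The dimensions of the cohomology of the complex `A / L`. -/
noncomputable def relDim (A L : ∀ n, Submodule ℚ (C n)) (n : ℕ) : ℕ∞ :=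
  Module.length ℚ (Subquotient (relCocycles d A L n) (relCoboundaries d A L n))

/-- `L ≤ A` are subcomplexes. -/
structure IsRelComplex (A L : ∀ n, Submodule ℚ (C n)) : Prop where
  le : ∀ n, L n ≤ A n
  map_mem : ∀ n, ∀ x ∈ A n, d n x ∈ A (n + 1)
  map_mem' : ∀ n, ∀ x ∈ L n, d n x ∈ L (n + 1)

variable {d} {A B L : ∀ n, Submodule ℚ (C n)}

theorem relCoboundaries_le (hd : ∀ n x, d (n + 1) (d n x) = 0) (hA : IsRelComplex d A L) (n : ℕ) :
    relCoboundaries d A L n ≤ relCocycles d A L n := by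
  cases n with
  | zero => exact fun x hx => ⟨hA.le _ hx, hA.map_mem' _ _ hx⟩
  | succ n =>
    refine sup_le ?_ fun x hx => ⟨hA.le _ hx, hA.map_mem' _ _ hx⟩
    rintro _ ⟨x, hx, rfl⟩
    refine ⟨hA.map_mem _ _ hx, ?_⟩
    change d (n + 1) (d n x) ∈ L (n + 2)
    rw [hd]
    exact zero_mem _

theorem relCocycles_inf (n : ℕ) :
    relCocycles d (fun n => A n ⊓ B n) L n = relCocycles d A L n ⊓ relCocycles d B L n := by
  simp only [relCocycles]
  rw [inf_inf_distrib_right]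

theorem relCoboundaries_sup (n : ℕ) :
    relCoboundaries d (fun n => A n ⊔ B n) L n =
      relCoboundaries d A L n ⊔ relCoboundaries d B L n := by
  cases n with
  | zero => simp [relCoboundaries]
  | succ n =>
    simp only [relCoboundaries, Submodule.map_sup]
    rw [sup_sup_distrib_right]

theorem relCocycles_mono (h : ∀ n, A n ≤ B n) (n : ℕ) :
    relCocycles d A L n ≤ relCocycles d B L n :=
  inf_le_inf_right _ (h n)

theorem relCoboundaries_mono (h : ∀ n, A n ≤ B n) (n : ℕ) :
    relCoboundaries d A L n ≤ relCoboundaries d B L n := by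
  cases n with
  | zero => exact le_rfl
  | succ n => exact sup_le_sup_right (Submodule.map_mono (h n)) _

/-- The connecting isomorphism of the Mayer–Vietoris sequence. -/
theorem length_connecting (n : ℕ) :
    Module.length ℚ (Subquotient (relCocycles d (fun n => A n ⊔ B n) L n)
        (relCocycles d A L n ⊔ relCocycles d B L n)) =
      Module.length ℚ (Subquotient (relCoboundaries d A L (n + 1) ⊓ relCoboundaries d B L (n + 1))
        (relCoboundaries d (fun n => A n ⊓ B n) L (n + 1))) := by
  -- Both sides are quotients of the space `P` of pairs (a, b) in A × B with d (a + b) in `L`: send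
  -- (a, b) to the class of a + b by `F` and to the class of d a by `G`. Both maps are onto and have
  -- the same kernel, so no connecting map has to be chosen.
  let S : C n × C n →ₗ[ℚ] C n := LinearMap.coprod LinearMap.id LinearMap.id
  have hS : ∀ a b, S (a, b) = a + b := fun a b => by simp [S]
  let P : Submodule ℚ (C n × C n) := (A n).prod (B n) ⊓ (L (n + 1)).comap (d n ∘ₗ S)
  have hP : ∀ x ∈ P, x.1 ∈ A n ∧ x.2 ∈ B n ∧ d n (x.1 + x.2) ∈ L (n + 1) :=
    fun x hx => ⟨hx.1.1, hx.1.2, by rw [← hS]; exact hx.2⟩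
  have h1 : ∀ x ∈ P, S x ∈ relCocycles d (fun n => A n ⊔ B n) L n := fun x hx => by
    obtain ⟨ha, hb, hl⟩ := hP x hx
    rw [hS x.1 x.2]
    exact ⟨add_mem (Submodule.mem_sup_left ha) (Submodule.mem_sup_right hb), hl⟩
  have h2 : ∀ x ∈ P, (d n ∘ₗ LinearMap.fst ℚ _ _) x ∈
      relCoboundaries d A L (n + 1) ⊓ relCoboundaries d B L (n + 1) := fun x hx => by
    obtain ⟨ha, hb, hl⟩ := hP x hx
    refine ⟨Submodule.mem_sup_left ⟨_, ha, rfl⟩, Submodule.mem_sup.2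
      ⟨_, ⟨_, neg_mem hb, rfl⟩, _, hl, ?_⟩⟩
    simp
  let F : P →ₗ[ℚ] Subquotient (relCocycles d (fun n => A n ⊔ B n) L n)
      (relCocycles d A L n ⊔ relCocycles d B L n) :=
    Submodule.mkQ _ ∘ₗ LinearMap.restrict _ h1
  let G : P →ₗ[ℚ] Subquotient (relCoboundaries d A L (n + 1) ⊓ relCoboundaries d B L (n + 1))
      (relCoboundaries d (fun n => A n ⊓ B n) L (n + 1)) :=
    Submodule.mkQ _ ∘ₗ LinearMap.restrict _ h2
  have hF : Function.Surjective F := by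
    intro x
    obtain ⟨⟨x, hx, hl⟩, rfl⟩ := Submodule.Quotient.mk_surjective _ x
    obtain ⟨a, ha, b, hb, rfl⟩ := Submodule.mem_sup.1 hx
    refine ⟨⟨(a, b), ⟨ha, hb⟩, ?_⟩, ?_⟩
    · change d n (S (a, b)) ∈ L (n + 1)
      rw [hS]
      exact hl
    · exact congrArg Submodule.Quotient.mk (Subtype.ext (hS a b))
  have hG : Function.Surjective G := by
    intro x
    obtain ⟨⟨x, hx, hx'⟩, rfl⟩ := Submodule.Quotient.mk_surjective _ x
    obtain ⟨_, ⟨a, ha, rfl⟩, l, hl, e⟩ := Submodule.mem_sup.1 hx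
    obtain ⟨_, ⟨b, hb, rfl⟩, l', hl', e'⟩ := Submodule.mem_sup.1 hx'
    -- If x = d a = d b modulo `L`, then d (a - b) is in `L`; the sign is needed because `P` is
    -- defined by the sum.
    refine ⟨⟨(a, -b), ⟨ha, neg_mem hb⟩, ?_⟩, ?_⟩
    · have : d n (a + -b) = l' - l := by
        rw [map_add, map_neg]
        have : d n a + l = d n b + l' := e.trans e'.symm
        rw [← sub_eq_add_neg, sub_eq_sub_iff_add_eq_add, this]
        abel
      change d n (S (a, -b)) ∈ L (n + 1)
      rw [hS, this]
      exact sub_mem hl' hl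
    · rw [← sub_eq_zero]
      change Submodule.Quotient.mk _ - Submodule.Quotient.mk _ = _
      rw [← Submodule.Quotient.mk_sub, subquotient_mk_eq_zero]
      change d n a - x ∈ _
      rw [← e]
      refine Submodule.mem_sup_right ?_
      simpa using hl
  have hker : F.ker = G.ker := by
    ext ⟨⟨a, b⟩, hx⟩
    obtain ⟨ha, hb, hl⟩ := hP _ hx
    simp only at ha hb hl
    rw [LinearMap.mem_ker, LinearMap.mem_ker]
    change Submodule.Quotient.mk _ = _ ↔ Submodule.Quotient.mk _ = _
    rw [subquotient_mk_eq_zero, subquotient_mk_eq_zero]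
    change S (a, b) ∈ _ ↔ d n a ∈ _
    rw [hS]
    constructor
    · intro h
      obtain ⟨z, ⟨hz, hdz⟩, z', ⟨hz', hdz'⟩, e⟩ := Submodule.mem_sup.1 h
      have e' : a - z = z' - b := by
        rw [sub_eq_sub_iff_add_eq_add, ← e]
        abel
      refine Submodule.mem_sup.2 ⟨d n (a - z), ⟨a - z, ⟨sub_mem ha hz, e' ▸ sub_mem hz' hb⟩, rfl⟩,
        d n z, hdz, ?_⟩
      simp
    · intro h
      obtain ⟨_, ⟨c, hc, rfl⟩, l, hl', e⟩ := Submodule.mem_sup.1 h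
      refine Submodule.mem_sup.2 ⟨a - c, ⟨sub_mem ha hc.1, ?_⟩, b + c, ⟨add_mem hb hc.2, ?_⟩,
        by abel⟩
      · change d n (a - c) ∈ L (n + 1)
        rw [map_sub, ← e]
        simpa using hl'
      · change d n (b + c) ∈ L (n + 1)
        have : d n (b + c) = d n (a + b) - l := by
          rw [map_add, map_add, ← e]
          abel
        rw [this]
        exact sub_mem hl hl'
  exact (((LinearMap.quotKerEquivOfSurjective F hF).symm.trans
    (Submodule.quotEquivOfEq _ _ hker)).trans (LinearMap.quotKerEquivOfSurjective G hG)).length_eq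

/-- With Z and B for cocycles and coboundaries, there are filtrations B(A ⊓ B) ≤ B(A) ⊓ B(B) ≤ Z(A ⊓
B) = Z(A) ⊓ Z(B) and B(A ⊔ B) = B(A) ⊔ B(B) ≤ Z(A) ⊔ Z(B) ≤ Z(A ⊔ B). Their layers are the ranks.
`length_connecting` matches the top layer of the second one in degree n with the bottom layer of the
first one in degree n + 1, and the modular law adds up the other two. -/
theorem mayerVietorisRanks_rel (hd : ∀ n x, d (n + 1) (d n x) = 0) (hA : IsRelComplex d A L)
    (hB : IsRelComplex d B L) :
    MayerVietorisRanks (relDim d (fun n => A n ⊓ B n) L) (relDim d A L) (relDim d B L)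
      (relDim d (fun n => A n ⊔ B n) L) := by
  have hI : ∀ n, relCoboundaries d (fun n => A n ⊓ B n) L n ≤
      relCoboundaries d A L n ⊓ relCoboundaries d B L n := fun n =>
    le_inf (relCoboundaries_mono (fun _ => inf_le_left) n)
      (relCoboundaries_mono (fun _ => inf_le_right) n)
  refine ⟨fun n => Module.length ℚ
      (Subquotient (relCoboundaries d A L n ⊓ relCoboundaries d B L n)
        (relCoboundaries d (fun n => A n ⊓ B n) L n)),
    fun n => Module.length ℚ (Subquotient (relCocycles d A L n ⊔ relCocycles d B L n)
        (relCoboundaries d A L n ⊔ relCoboundaries d B L n)),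
    fun n => Module.length ℚ (Subquotient (relCocycles d A L n ⊓ relCocycles d B L n)
        (relCoboundaries d A L n ⊓ relCoboundaries d B L n)), ?_, fun n => ?_, fun n => ?_,
    fun n => ?_⟩
  -- In degree 0 all the coboundaries are `L 0`, so nothing connects into it.
  · rw [Module.length_eq_zero_iff]
    refine subsingleton_subquotient ?_
    simp [relCoboundaries]
  · have h := length_subquotient_add (hI n) (inf_le_inf (relCoboundaries_le hd hA n)
      (relCoboundaries_le hd hB n))
    rw [relDim, relCocycles_inf, h, add_comm]
  · have h := length_subquotient_add (V := C n)
      (sup_le_sup (relCoboundaries_le hd hA n) (relCoboundaries_le hd hB n))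
      (sup_le (relCocycles_mono (B := fun n => A n ⊔ B n) (L := L) (d := d)
        (fun _ => le_sup_left) n) (relCocycles_mono (fun _ => le_sup_right) n))
    rw [relDim, relCoboundaries_sup, h, length_connecting, add_comm]
  · rw [relDim, relDim, length_subquotient_modular (relCoboundaries_le hd hA n)
      (relCoboundaries_le hd hB n), add_comm]

end Relative

/-! ### Mayer–Vietoris for open sets -/

section Cut

variable {X Y : Type*}

open Classical in
/-- The product of a cochain with the indicator function of a set, in the first variable. -/
noncomputable def cutoff (W : Set X) {n : ℕ} (φ : Cochain X n) : Cochain X n :=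
  fun p => if p 0 ∈ W then φ p else 0

theorem cutoff_of_mem {W : Set X} {n : ℕ} (φ : Cochain X n) {p : Fin (n + 1) → X} (h : p 0 ∈ W) :
    cutoff W φ p = φ p := if_pos h

theorem cutoff_of_notMem {W : Set X} {n : ℕ} (φ : Cochain X n) {p : Fin (n + 1) → X}
    (h : p 0 ∉ W) : cutoff W φ p = 0 := if_neg h

/-- The pullback of cochains as a linear map. -/
def pullbackLinear (f : Y → X) (n : ℕ) : Cochain X n →ₗ[ℚ] Cochain Y n where
  toFun φ := pullback f φ
  map_add' _ _ := rfl
  map_smul' _ _ := rfl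

theorem pullbackLinear_coboundary (f : Y → X) (n : ℕ) (φ : Cochain X n) :
    pullbackLinear f (n + 1) (coboundary n φ) = coboundary n (pullbackLinear f n φ) := rfl

end Cut

section Open

variable {X Y : Type*} [TopologicalSpace X] [TopologicalSpace Y]

theorem LocallyZeroAt.coboundary {n : ℕ} {φ : Cochain X n} {x : X} (h : LocallyZeroAt φ x) :
    LocallyZeroAt (coboundary n φ) x := by
  obtain ⟨U, hU, h⟩ := h
  refine ⟨U, hU, fun p hp => ?_⟩
  change ∑ i : Fin (n + 2), (-1 : ℚ) ^ (i : ℕ) * φ (fun j => p (i.succAbove j)) = 0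
  refine Finset.sum_eq_zero fun i _ => ?_
  rw [h _ fun j => hp _, mul_zero]

theorem coboundary_mem_locallyZero {n : ℕ} {φ : Cochain X n} (h : φ ∈ locallyZero X n) :
    coboundary n φ ∈ locallyZero X (n + 1) := fun x => (h x).coboundary

/-- The cochains with compact support contained in `U`. -/
def supportedIn (U : Set X) (n : ℕ) : Submodule ℚ (Cochain X n) where
  carrier := {φ | ∃ K : Set X, IsCompact K ∧ K ⊆ U ∧ ∀ x, x ∉ K → LocallyZeroAt φ x}
  add_mem' := by
    rintro φ ψ ⟨K, hK, hKU, h⟩ ⟨L, hL, hLU, h'⟩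
    refine ⟨K ∪ L, hK.union hL, Set.union_subset hKU hLU, fun x hx => ?_⟩
    exact (h x fun hxK => hx (Or.inl hxK)).add (h' x fun hxL => hx (Or.inr hxL))
  zero_mem' := ⟨∅, isCompact_empty, Set.empty_subset _, fun x _ => LocallyZeroAt.zero x⟩
  smul_mem' := by
    rintro c φ ⟨K, hK, hKU, h⟩
    exact ⟨K, hK, hKU, fun x hx => (h x hx).smul c⟩

theorem isRelComplex_supportedIn (U : Set X) :
    IsRelComplex (fun n => coboundary (X := X) n) (supportedIn U) (locallyZero X) where
  le _ _ h := ⟨∅, isCompact_empty, Set.empty_subset _, fun x _ => h x⟩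
  map_mem _ _ := fun ⟨K, hK, hKU, h⟩ => ⟨K, hK, hKU, fun x hx => (h x hx).coboundary⟩
  map_mem' _ _ h := coboundary_mem_locallyZero h

theorem supportedIn_inf [T2Space X] (U V : Set X) (n : ℕ) :
    supportedIn U n ⊓ supportedIn V n = supportedIn (U ∩ V) n := by
  ext φ
  constructor
  · rintro ⟨⟨K, hK, hKU, h⟩, L, hL, hLV, h'⟩
    refine ⟨K ∩ L, hK.inter hL, Set.inter_subset_inter hKU hLV, fun x hx => ?_⟩
    by_cases hxK : x ∈ K
    · exact h' x fun hxL => hx ⟨hxK, hxL⟩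
    · exact h x hxK
  · rintro ⟨K, hK, hKU, h⟩
    exact ⟨⟨K, hK, hKU.trans Set.inter_subset_left, h⟩,
      ⟨K, hK, hKU.trans Set.inter_subset_right, h⟩⟩

theorem LocallyZeroAt.cutoff {n : ℕ} {φ : Cochain X n} {x : X} (W : Set X)
    (h : LocallyZeroAt φ x) : LocallyZeroAt (cutoff W φ) x := by
  obtain ⟨U, hU, h⟩ := h
  refine ⟨U, hU, fun p hp => ?_⟩
  by_cases hW : p 0 ∈ W
  · rw [cutoff_of_mem φ hW, h p hp]
  · exact cutoff_of_notMem φ hW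

theorem locallyZeroAt_cutoff_of_notMem_closure {n : ℕ} (φ : Cochain X n) {W : Set X} {x : X}
    (h : x ∉ closure W) : LocallyZeroAt (cutoff W φ) x :=
  ⟨(closure W)ᶜ, isClosed_closure.isOpen_compl.mem_nhds h,
    fun _ hp => cutoff_of_notMem φ fun h0 => hp 0 (subset_closure h0)⟩

theorem LocallyZeroAt.sub_cutoff {n : ℕ} {φ : Cochain X n} {x : X} (W : Set X)
    (h : LocallyZeroAt φ x) : LocallyZeroAt (φ - CompactSupp.cutoff W φ) x := by
  rw [sub_eq_add_neg, ← neg_one_smul ℚ (CompactSupp.cutoff W φ)]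
  exact h.add ((h.cutoff W).smul _)

theorem locallyZeroAt_sub_cutoff_of_mem_nhds {n : ℕ} (φ : Cochain X n) {W : Set X} {x : X}
    (h : W ∈ 𝓝 x) : LocallyZeroAt (φ - cutoff W φ) x :=
  ⟨W, h, fun p hp => by rw [Pi.sub_apply, cutoff_of_mem φ (hp 0), sub_self]⟩

/-- For K the support of `φ`, the compact sets K \ V and K \ U are disjoint, so they have disjoint
open neighbourhoods O₁ and O₂. Cochains need not be continuous, so the indicator function of O₁ in
the first variable takes the place of a partition of unity: the cut off cochain has support in K ∩
closure O₁, which misses O₂ ⊇ K \ U and so lies in U, and the rest has support in K \ O₁ ⊆ V. -/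
theorem supportedIn_sup [T2Space X] {U V : Set X} (hU : IsOpen U) (hV : IsOpen V) (n : ℕ) :
    supportedIn U n ⊔ supportedIn V n = supportedIn (U ∪ V) n := by
  apply le_antisymm
  · refine sup_le ?_ ?_
    · rintro φ ⟨K, hK, hKU, h⟩
      exact ⟨K, hK, hKU.trans Set.subset_union_left, h⟩
    · rintro φ ⟨K, hK, hKU, h⟩
      exact ⟨K, hK, hKU.trans Set.subset_union_right, h⟩
  · rintro φ ⟨K, hK, hKUV, h⟩
    have hdisj : Disjoint (K \ V) (K \ U) := by
      rw [Set.disjoint_left]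
      rintro x ⟨hxK, hxV⟩ ⟨-, hxU⟩
      exact (hKUV hxK).elim hxU hxV
    obtain ⟨O₁, O₂, ho₁, ho₂, h₁, h₂, hO⟩ :=
      SeparatedNhds.of_isCompact_isCompact (hK.diff hV) (hK.diff hU) hdisj
    have hcl : Disjoint (closure O₁) O₂ := hO.closure_left ho₂
    refine Submodule.mem_sup.2 ⟨cutoff O₁ φ, ⟨K ∩ closure O₁, hK.inter_right isClosed_closure,
      fun x hx => ?_, fun x hx => ?_⟩, φ - cutoff O₁ φ, ⟨K \ O₁, hK.diff ho₁,
      fun x hx => ?_, fun x hx => ?_⟩, add_sub_cancel _ _⟩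
    · by_contra hxU
      exact Set.disjoint_left.1 hcl hx.2 (h₂ ⟨hx.1, hxU⟩)
    · by_cases hxK : x ∈ K
      · exact locallyZeroAt_cutoff_of_notMem_closure φ fun hxO => hx ⟨hxK, hxO⟩
      · exact (h x hxK).cutoff _
    · by_contra hxV
      exact hx.2 (h₁ ⟨hx.1, hxV⟩)
    · by_cases hxK : x ∈ K
      · have hxO : x ∈ O₁ := by_contra fun hxO => hx ⟨hxK, hxO⟩
        exact locallyZeroAt_sub_cutoff_of_mem_nhds φ (ho₁.mem_nhds hxO)
      · exact (h x hxK).sub_cutoff _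

variable {j : Y → X}

theorem locallyZeroAt_pullback_iff (hj : Topology.IsOpenEmbedding j) {n : ℕ} (φ : Cochain X n) (y : Y) :
    LocallyZeroAt (pullbackLinear j n φ) y ↔ LocallyZeroAt φ (j y) := by
  constructor
  · rintro ⟨V, hV, h⟩
    refine ⟨j '' V, hj.image_mem_nhds.2 hV, fun p hp => ?_⟩
    choose q hq hqp using hp
    rw [show p = fun i => j (q i) from funext fun i => (hqp i).symm]
    exact h q hq
  · rintro ⟨U, hU, h⟩
    exact ⟨j ⁻¹' U, hj.continuous.continuousAt hU, fun p hp => h _ hp⟩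

theorem pullback_mem_compactlySupported (hj : Topology.IsOpenEmbedding j) {n : ℕ} {φ : Cochain X n}
    (h : φ ∈ supportedIn (Set.range j) n) : pullbackLinear j n φ ∈ compactlySupported Y n := by
  obtain ⟨K, hK, hKj, h⟩ := h
  refine ⟨j ⁻¹' K, (hj.isInducing.isCompact_preimage_iff hKj).2 hK, fun y hy => ?_⟩
  exact (locallyZeroAt_pullback_iff hj φ y).2 (h _ hy)

theorem pullback_mem_locallyZero_iff (hj : Topology.IsOpenEmbedding j) {n : ℕ} {φ : Cochain X n}
    (h : φ ∈ supportedIn (Set.range j) n) :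
    pullbackLinear j n φ ∈ locallyZero Y n ↔ φ ∈ locallyZero X n := by
  constructor
  · intro h0 x
    by_cases hx : x ∈ Set.range j
    · obtain ⟨y, rfl⟩ := hx
      exact (locallyZeroAt_pullback_iff hj φ y).1 (h0 y)
    · obtain ⟨K, hK, hKj, h⟩ := h
      exact h x fun hxK => hx (hKj hxK)
  · exact fun h0 y => (locallyZeroAt_pullback_iff hj φ y).2 (h0 _)

/-- Extension by zero. Cutting `ψ` off by a compact neighbourhood of its support changes it by a
locally zero cochain only, and makes its extension vanish on all tuples near a point outside a
compact subset of the range. -/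
theorem exists_pullback_add [T2Space X] [LocallyCompactSpace Y] (hj : Topology.IsOpenEmbedding j) {n : ℕ}
    {ψ : Cochain Y n} (h : ψ ∈ compactlySupported Y n) :
    ∃ φ ∈ supportedIn (Set.range j) n, ψ - pullbackLinear j n φ ∈ locallyZero Y n := by
  obtain ⟨K, hK, h⟩ := h
  obtain ⟨K', hK', hKK'⟩ := exists_compact_superset hK
  have hinj : Function.Injective fun (p : Fin (n + 1) → Y) i => j (p i) :=
    fun p q hpq => funext fun i => hj.injective (congrFun hpq i)
  set φ : Cochain X n := Function.extend (fun p i => j (p i)) (cutoff K' ψ) 0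
  have hφ : pullbackLinear j n φ = cutoff K' ψ := funext fun p => hinj.extend_apply _ _ p
  refine ⟨φ, ⟨j '' K', hK'.image hj.continuous, Set.image_subset_range _ _, fun x hx => ?_⟩, ?_⟩
  · refine ⟨(j '' K')ᶜ, (hK'.image hj.continuous).isClosed.isOpen_compl.mem_nhds hx,
      fun p hp => ?_⟩
    by_cases hpj : ∃ q : Fin (n + 1) → Y, (fun i => j (q i)) = p
    · obtain ⟨q, rfl⟩ := hpj
      rw [show φ (fun i => j (q i)) = cutoff K' ψ q from congrFun hφ q]
      exact cutoff_of_notMem ψ fun hq => hp 0 ⟨q 0, hq, rfl⟩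
    · exact Function.extend_apply' _ _ _ hpj
  · rw [hφ]
    intro y
    by_cases hy : y ∈ K
    · exact locallyZeroAt_sub_cutoff_of_mem_nhds ψ (mem_interior_iff_mem_nhds.1 (hKK' hy))
    · exact (h y hy).sub_cutoff _

/-- The dimension of `H_c^n(X; ℚ)`. -/
noncomputable def cohomologyDim (X : Type*) [TopologicalSpace X] (n : ℕ) : ℕ∞ :=
  Module.length ℚ (Cohomology X n)

/-- The pullback to `Y` is inverted, up to locally zero cochains, by extension by zero. All open
subsets of `X` are thereby treated by submodules of the cochains of the one space `X`, where
intersections and sums make sense. -/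
theorem cohomologyDim_eq_relDim [T2Space X] [LocallyCompactSpace Y] (hj : Topology.IsOpenEmbedding j)
    (n : ℕ) : cohomologyDim Y n =
      relDim (fun n => coboundary (X := X) n) (supportedIn (Set.range j)) (locallyZero X) n := by
  have hZ : ∀ φ ∈ relCocycles (fun n => coboundary (X := X) n) (supportedIn (Set.range j))
      (locallyZero X) n, pullbackLinear j n φ ∈ cocycles Y n := fun φ hφ =>
    ⟨pullback_mem_compactlySupported hj hφ.1,
      (pullback_mem_locallyZero_iff hj ((isRelComplex_supportedIn _).map_mem _ _ hφ.1)).2 hφ.2⟩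
  have hB : ∀ φ ∈ relCoboundaries (fun n => coboundary (X := X) n) (supportedIn (Set.range j))
      (locallyZero X) n, pullbackLinear j n φ ∈ coboundaries Y n := by
    cases n with
    | zero => exact fun φ hφ y => (locallyZeroAt_pullback_iff hj φ y).2 (hφ _)
    | succ n =>
      intro φ hφ
      obtain ⟨_, ⟨ψ, hψ, rfl⟩, l, hl, rfl⟩ := Submodule.mem_sup.1 hφ
      rw [map_add]
      exact add_mem (Submodule.mem_sup_left ⟨_, pullback_mem_compactlySupported hj hψ, rfl⟩)
        (Submodule.mem_sup_right fun y => (locallyZeroAt_pullback_iff hj l y).2 (hl _))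
  refine (LinearEquiv.ofBijective (subquotientMap (pullbackLinear j n) hZ hB)
    ⟨?_, ?_⟩).length_eq.symm
  · rw [injective_iff_map_eq_zero]
    intro z
    obtain ⟨⟨z, hz⟩, rfl⟩ := Submodule.Quotient.mk_surjective _ z
    intro h
    rw [subquotientMap_mk, subquotient_mk_eq_zero] at h
    rw [subquotient_mk_eq_zero]
    cases n with
    | zero => exact (pullback_mem_locallyZero_iff hj hz.1).1 h
    | succ n =>
      obtain ⟨_, ⟨ψ, hψ, rfl⟩, l, hl, e⟩ := Submodule.mem_sup.1 h
      obtain ⟨φ, hφ, hψφ⟩ := exists_pullback_add hj hψ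
      refine Submodule.mem_sup.2 ⟨coboundary n φ, ⟨φ, hφ, rfl⟩, z - coboundary n φ, ?_,
        add_sub_cancel _ _⟩
      refine (pullback_mem_locallyZero_iff hj
        (sub_mem hz.1 ((isRelComplex_supportedIn _).map_mem _ _ hφ))).1 ?_
      have : pullbackLinear j (n + 1) (z - coboundary n φ) =
          l + coboundary n (ψ - pullbackLinear j n φ) := by
        rw [map_sub, map_sub, pullbackLinear_coboundary]
        change pullbackLinear j (n + 1) z - _ = _
        rw [← show _ = pullbackLinear j (n + 1) z from e]
        abel
      rw [this]
      exact add_mem hl (coboundary_mem_locallyZero hψφ)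
  · intro z
    obtain ⟨⟨ψ, hψ, hψ'⟩, rfl⟩ := Submodule.Quotient.mk_surjective _ z
    obtain ⟨φ, hφ, hψφ⟩ := exists_pullback_add hj hψ
    refine ⟨Submodule.Quotient.mk ⟨φ, hφ, ?_⟩, ?_⟩
    · refine (pullback_mem_locallyZero_iff hj
        ((isRelComplex_supportedIn _).map_mem _ _ hφ)).1 ?_
      have : pullbackLinear j (n + 1) (coboundary n φ) =
          coboundary n ψ - coboundary n (ψ - pullbackLinear j n φ) := by
        rw [map_sub, pullbackLinear_coboundary]
        abel
      rw [this]
      exact sub_mem hψ' (coboundary_mem_locallyZero hψφ)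
    · rw [subquotientMap_mk, ← sub_eq_zero, ← Submodule.Quotient.mk_sub, subquotient_mk_eq_zero]
      change pullbackLinear j n φ - ψ ∈ _
      rw [← neg_sub]
      refine neg_mem ?_
      cases n with
      | zero => exact hψφ
      | succ n => exact Submodule.mem_sup_right hψφ

/-- `χ_c(X)` is defined and equal to the integer `c`. -/
def HasChi (X : Type*) [TopologicalSpace X] (c : ℤ) : Prop := HasAltSum (cohomologyDim X) c

theorem mayerVietorisRanks_open [T2Space X] [LocallyCompactSpace X] {U V : Set X} (hU : IsOpen U)
    (hV : IsOpen V) : MayerVietorisRanks (cohomologyDim ↥(U ∩ V)) (cohomologyDim U)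
      (cohomologyDim V) (cohomologyDim ↥(U ∪ V)) := by
  have key : ∀ W : Set X, IsOpen W → cohomologyDim W =
      relDim (fun n => coboundary (X := X) n) (supportedIn W) (locallyZero X) := fun W hW => by
    funext n
    have := hW.isOpenEmbedding_subtypeVal.locallyCompactSpace
    rw [cohomologyDim_eq_relDim hW.isOpenEmbedding_subtypeVal, Subtype.range_val]
  rw [key U hU, key V hV, key _ (hU.inter hV), key _ (hU.union hV)]
  have h := mayerVietorisRanks_rel coboundary_comp (isRelComplex_supportedIn U)
    (isRelComplex_supportedIn V)
  simp only [supportedIn_inf, supportedIn_sup hU hV] at h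
  exact h

theorem HasChi.union [T2Space X] [LocallyCompactSpace X] {U V : Set X} (hU : IsOpen U)
    (hV : IsOpen V) {α β γ : ℤ} (h : HasChi U α) (h' : HasChi V β) (h'' : HasChi ↥(U ∩ V) γ) :
    HasChi ↥(U ∪ V) (α + β - γ) :=
  (mayerVietorisRanks_open hU hV).hasAltSum_union h'' h h'

theorem HasChi.inter [T2Space X] [LocallyCompactSpace X] {U V : Set X} (hU : IsOpen U)
    (hV : IsOpen V) {α β γ : ℤ} (h : HasChi U α) (h' : HasChi V β) (h'' : HasChi ↥(U ∪ V) γ) :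
    HasChi ↥(U ∩ V) (α + β - γ) :=
  (mayerVietorisRanks_open hU hV).hasAltSum_inter h'' h h'

theorem HasChi.homeomorph [T2Space X] [LocallyCompactSpace X] {c : ℤ} (h : HasChi X c)
    (e : Y ≃ₜ X) : HasChi Y c := by
  have := e.isOpenEmbedding.locallyCompactSpace
  have key : cohomologyDim Y = cohomologyDim X := by
    funext n
    rw [cohomologyDim_eq_relDim e.isOpenEmbedding, e.surjective.range_eq,
      cohomologyDim_eq_relDim Topology.IsOpenEmbedding.id, Set.range_id]
  rw [HasChi, key]
  exact h

theorem hasChi_of_subsingleton {X : Type*} [TopologicalSpace X]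
    (h : ∀ n, Subsingleton (Cohomology X n)) : HasChi X 0 :=
  ⟨fun _ => 0, 0, fun n => Module.length_eq_zero_iff.2 (h n),
    fun _ _ => rfl, rfl⟩

theorem hasChi_empty {X : Type*} [TopologicalSpace X] [IsEmpty X] : HasChi X 0 := by
  refine hasChi_of_subsingleton fun n => subsingleton_subquotient fun φ _ => ?_
  have : φ ∈ locallyZero X n := fun x => isEmptyElim x
  cases n with
  | zero => exact this
  | succ n => exact Submodule.mem_sup_right this

theorem HasChi.hasEulerChar {X : Type*} [TopologicalSpace X] {c : ℤ} (h : HasChi X c) :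
    HasEulerChar X c := by
  obtain ⟨k, N, hk, hN, rfl⟩ := h
  have hfin : ∀ n, Module.Finite ℚ (Cohomology X n) := fun n => by
    have h1 : Module.length ℚ (Cohomology X n) ≠ ⊤ := by
      change cohomologyDim X n ≠ ⊤
      rw [hk n]
      exact ENat.natCast_ne_top _
    have := isFiniteLength_iff_isNoetherian_isArtinian.1 (Module.length_ne_top_iff.1 h1)
    have := this.1
    infer_instance
  have hrank : ∀ n, Module.finrank ℚ (Cohomology X n) = k n := fun n => by
    have h1 := Module.length_eq_finrank ℚ (Cohomology X n)
    have h2 : Module.length ℚ (Cohomology X n) = k n := hk n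
    rw [h1] at h2
    exact_mod_cast h2
  refine ⟨⟨hfin, N, fun n hn => ?_⟩, ?_⟩
  · have h2 : Module.length ℚ (Cohomology X n) = k n := hk n
    rw [hN n hn] at h2
    exact Module.length_eq_zero_iff.1 (by simpa using h2)
  · rw [eulerChar, finsum_eq_sum_of_support_subset (s := Finset.range N)]
    · simp [hrank]
    · intro n hn
      by_contra hnN
      refine hn ?_
      change (-1 : ℤ) ^ n * (Module.finrank ℚ (Cohomology X n) : ℤ) = 0
      rw [hrank, hN n (by simpa using hnN)]
      simp

end Open

/-! ### Compact convex sets -/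

/-! ### Cochains that vanish on small tuples of a subset -/

section ZeroNear

variable {X : Type*} [TopologicalSpace X]

/-- The restriction of `φ` to the subspace `C` is locally zero. -/
def ZeroNear (C : Set X) {m : ℕ} (φ : (Fin m → X) → ℚ) : Prop :=
  ∀ x ∈ C, ∃ U ∈ 𝓝 x, ∀ p : Fin m → X, (∀ i, p i ∈ U ∧ p i ∈ C) → φ p = 0

theorem ZeroNear.add {C : Set X} {m : ℕ} {φ ψ : (Fin m → X) → ℚ} (hφ : ZeroNear C φ)
    (hψ : ZeroNear C ψ) : ZeroNear C (φ + ψ) := fun x hx => by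
  obtain ⟨U, hU, h⟩ := hφ x hx
  obtain ⟨V, hV, h'⟩ := hψ x hx
  refine ⟨U ∩ V, Filter.inter_mem hU hV, fun p hp => ?_⟩
  simp [h p fun i => ⟨(hp i).1.1, (hp i).2⟩, h' p fun i => ⟨(hp i).1.2, (hp i).2⟩]

theorem ZeroNear.neg {C : Set X} {m : ℕ} {φ : (Fin m → X) → ℚ} (hφ : ZeroNear C φ) :
    ZeroNear C (-φ) := fun x hx => by
  obtain ⟨U, hU, h⟩ := hφ x hx
  exact ⟨U, hU, fun p hp => by simp [h p hp]⟩

theorem ZeroNear.sub {C : Set X} {m : ℕ} {φ ψ : (Fin m → X) → ℚ} (hφ : ZeroNear C φ)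
    (hψ : ZeroNear C ψ) : ZeroNear C (φ - ψ) := by
  rw [sub_eq_add_neg]
  exact hφ.add hψ.neg

theorem ZeroNear.mono {C D : Set X} (hCD : C ⊆ D) {m : ℕ} {φ : (Fin m → X) → ℚ}
    (h : ZeroNear D φ) : ZeroNear C φ := fun x hx => by
  obtain ⟨U, hU, h⟩ := h x (hCD hx)
  exact ⟨U, hU, fun p hp => h p fun i => ⟨(hp i).1, hCD (hp i).2⟩⟩

theorem zeroNear_of_forall {C : Set X} {m : ℕ} {φ : (Fin m → X) → ℚ}
    (h : ∀ p, (∀ i, p i ∈ C) → φ p = 0) : ZeroNear C φ := fun _ _ =>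
  ⟨Set.univ, Filter.univ_mem, fun p hp => h p fun i => (hp i).2⟩

theorem ZeroNear.apply_const {C : Set X} {m : ℕ} {φ : (Fin m → X) → ℚ} (h : ZeroNear C φ) {x : X}
    (hx : x ∈ C) : φ (fun _ => x) = 0 := by
  obtain ⟨U, hU, h⟩ := h x hx
  exact h _ fun _ => ⟨mem_of_mem_nhds hU, hx⟩

theorem ZeroNear.locallyZeroAt {C : Set X} {n : ℕ} {φ : Cochain X n} (h : ZeroNear C φ) {x : X}
    (hx : C ∈ 𝓝 x) : LocallyZeroAt φ x := by
  obtain ⟨U, hU, h⟩ := h x (mem_of_mem_nhds hx)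
  exact ⟨U ∩ C, Filter.inter_mem hU hx, fun p hp => h p hp⟩

theorem zeroNear_of_locallyZeroAt {C : Set X} {n : ℕ} {φ : Cochain X n}
    (h : ∀ x ∈ C, LocallyZeroAt φ x) : ZeroNear C φ := fun x hx => by
  obtain ⟨U, hU, h⟩ := h x hx
  exact ⟨U, hU, fun p hp => h p fun i => (hp i).1⟩

end ZeroNear

/-- The Lebesgue number of a covering of `C` by sets on which `φ` vanishes gives one scale for all
points. -/
theorem ZeroNear.exists_forall_ball {X : Type*} [PseudoMetricSpace X] {C : Set X}
    (hC : IsCompact C) {m : ℕ} {φ : (Fin m → X) → ℚ} (h : ZeroNear C φ) :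
    ∃ ε > 0, ∀ x ∈ C, ∀ p : Fin m → X, (∀ i, p i ∈ Metric.ball x ε ∩ C) → φ p = 0 := by
  let ι := {U : Set X // IsOpen U ∧ ∀ p : Fin m → X, (∀ i, p i ∈ U ∧ p i ∈ C) → φ p = 0}
  obtain ⟨ε, hε, H⟩ := lebesgue_number_lemma_of_metric (c := fun U : ι => (U : Set X)) hC
    (fun U => U.2.1) fun x hx => by
      obtain ⟨U, hU, h⟩ := h x hx
      obtain ⟨V, hVU, hV, hxV⟩ := mem_nhds_iff.1 hU
      exact Set.mem_iUnion.2 ⟨⟨V, hV, fun p hp => h p fun i => ⟨hVU (hp i).1, (hp i).2⟩⟩, hxV⟩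
  refine ⟨ε, hε, fun x hx p hp => ?_⟩
  obtain ⟨U, hU⟩ := H x hx
  exact U.2.2 p fun i => ⟨hU (hp i).1, (hp i).2⟩

/-- A map which moves the points of `C` by less than `ε / 2`, and does not increase distances,
acts trivially on the classes of the cochains that are cocycles at the scale `ε`. -/
theorem exists_zeroNear_pullback_sub {E : Type*} [PseudoMetricSpace E] {C : Set E} {ε : ℝ}
    (hε : 0 < ε) {f : E → E}
    (hfC : Set.MapsTo f C C) (hf : ∀ x ∈ C, dist (f x) x < ε / 2)
    {m : ℕ} {φ : (Fin (m + 1) → E) → ℚ}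
    (hφ : ∀ x ∈ C, ∀ p : Fin (m + 2) → E, (∀ i, p i ∈ Metric.ball x ε ∩ C) →
      tupleCoboundary (m + 1) φ p = 0) :
    ∃ ψ : (Fin m → E) → ℚ, ZeroNear C (pullback f φ - φ - tupleCoboundary m ψ) := by
  -- By the homotopy formula the difference is the prism of the coboundary of `φ`. On a tuple of
  -- points at distance less than ε / 2 from `x`, this involves only points and their images, all in
  -- the ball of radius ε.
  refine ⟨prism f m φ, ?_⟩
  rw [← prism_homotopy f m φ, add_sub_cancel_left]
  refine fun x hx => ⟨Metric.ball x (ε / 2), Metric.ball_mem_nhds _ (half_pos hε), fun p hp => ?_⟩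
  refine prism_eq_zero f _ _ (Metric.ball x ε ∩ C) (hφ x hx) p (fun i => ⟨?_, (hp i).2⟩)
    fun i => ⟨?_, hfC (hp i).2⟩
  · exact Metric.ball_subset_ball (by linarith) (hp i).1
  · have h1 := hf _ (hp i).2
    have h2 := Metric.mem_ball.1 (hp i).1
    have h3 := dist_triangle (f (p i)) (p i) x
    exact Metric.mem_ball.2 (by linarith)

/-! ### Acyclicity of compact convex sets -/

section Convex

variable {E : Type*} [NormedAddCommGroup E] [NormedSpace ℝ E]

/-- The coboundary of `φ` vanishes on tuples of some size ε. A homothety `f` with centre `c` in `C`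
and ratio slightly below 1 moves points by less than ε / 2, so pulling back by `f` changes the class
of `φ` by nothing. After enough iterations the image of `C` is within ε of `c`, and contraction by
`c` exhibits the pullback as a coboundary on `C`. For m = 0 the conclusion is that `φ` is locally a
constant independent of the point. -/
theorem exists_zeroNear_sub_coboundary {C : Set E} (hC : IsCompact C) (hconv : Convex ℝ C)
    (hne : C.Nonempty) {m : ℕ} {φ : (Fin (m + 1) → E) → ℚ}
    (hφ : ZeroNear C (tupleCoboundary (m + 1) φ)) :
    ∃ ψ : (Fin m → E) → ℚ, ZeroNear C (φ - tupleCoboundary m ψ) := by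
  obtain ⟨c, hc⟩ := hne
  obtain ⟨ε, hε, hsmall⟩ := hφ.exists_forall_ball hC
  obtain ⟨R, hR0, hR⟩ := hC.isBounded.subset_ball_lt 0 c
  -- `C` lies in the ball of radius `R` about `c`, so the homothety of ratio θ moves its points by
  -- less than (1 - θ) R. The minimum with 1 keeps θ nonnegative.
  obtain ⟨θ, hθ0, hθ1, hθR⟩ : ∃ θ : ℝ, 0 ≤ θ ∧ θ < 1 ∧ (1 - θ) * R < ε / 2 := by
    have hq : 0 < min 1 (ε / (4 * R)) := lt_min one_pos (by positivity)
    have hq1 : min 1 (ε / (4 * R)) ≤ 1 := min_le_left _ _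
    have hq2 : min 1 (ε / (4 * R)) * R ≤ ε / 4 := by
      calc min 1 (ε / (4 * R)) * R ≤ ε / (4 * R) * R :=
            mul_le_mul_of_nonneg_right (min_le_right _ _) hR0.le
        _ = ε / 4 := by field_simp
    exact ⟨1 - min 1 (ε / (4 * R)), by linarith, by linarith, by linarith⟩
  let f : E → E := fun x => c + θ • (x - c)
  have hfC : Set.MapsTo f C C := fun x hx => by
    have := hconv hx hc hθ0 (sub_nonneg.2 hθ1.le) (by ring)
    have e : f x = θ • x + (1 - θ) • c := by
      simp only [f, smul_sub, sub_smul, one_smul]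
      abel
    rwa [e]
  have hfd : ∀ x ∈ C, dist (f x) x < ε / 2 := fun x hx => by
    have e : f x - x = -((1 - θ) • (x - c)) := by
      simp only [f, smul_sub, sub_smul, one_smul]
      abel
    rw [dist_eq_norm, e, norm_neg, norm_smul, Real.norm_of_nonneg (sub_nonneg.2 hθ1.le)]
    refine lt_of_le_of_lt (mul_le_mul_of_nonneg_left ?_ (sub_nonneg.2 hθ1.le)) hθR
    have := Metric.mem_ball.1 (hR hx)
    rw [dist_eq_norm] at this
    exact this.le
  have hff : ∀ x y, dist (f x) (f y) ≤ dist x y := fun x y => by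
    have e : f x - f y = θ • (x - y) := by
      simp only [f, smul_sub]
      abel
    rw [dist_eq_norm, e, norm_smul, Real.norm_of_nonneg hθ0, dist_eq_norm]
    exact mul_le_of_le_one_left (norm_nonneg _) hθ1.le
  have hiter : ∀ k, Set.MapsTo f^[k] C C := fun k => hfC.iterate k
  have hiterd : ∀ k x y, dist (f^[k] x) (f^[k] y) ≤ dist x y := fun k => by
    induction k with
    | zero => exact fun x y => le_rfl
    | succ k ih => exact fun x y => (ih _ _).trans (hff x y)
  have hiterc : ∀ k x, dist (f^[k] x) c = θ ^ k * dist x c := fun k => by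
    induction k with
    | zero => simp
    | succ k ih =>
      intro x
      rw [Function.iterate_succ_apply, ih]
      have : dist (f x) c = θ * dist x c := by
        rw [dist_eq_norm, dist_eq_norm, show f x - c = θ • (x - c) from add_sub_cancel_left _ _,
          norm_smul, Real.norm_of_nonneg hθ0]
      rw [this]
      ring
  have hk : ∀ k, ∃ ψ : (Fin m → E) → ℚ,
      ZeroNear C (pullback f^[k] φ - φ - tupleCoboundary m ψ) := fun k => by
    induction k with
    | zero =>
      refine ⟨0, zeroNear_of_forall fun p _ => ?_⟩
      rw [map_zero]
      simp [pullback]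
    | succ k ih =>
      obtain ⟨ψ, hψ⟩ := ih
      obtain ⟨ψ', hψ'⟩ := exists_zeroNear_pullback_sub hε hfC hfd (φ := pullback f^[k] φ)
        fun x hx p hp => by
          rw [tupleCoboundary_pullback]
          refine hsmall (f^[k] x) (hiter k hx) _ fun i => ⟨?_, hiter k (hp i).2⟩
          exact Metric.mem_ball.2 ((hiterd k _ _).trans_lt (Metric.mem_ball.1 (hp i).1))
      refine ⟨ψ + ψ', ?_⟩
      have e : pullback f^[k + 1] φ - φ - tupleCoboundary m (ψ + ψ') =
          (pullback f^[k] φ - φ - tupleCoboundary m ψ) +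
            (pullback f (pullback f^[k] φ) - pullback f^[k] φ - tupleCoboundary m ψ') := by
        rw [map_add, show pullback f^[k + 1] φ = pullback f (pullback f^[k] φ) from rfl]
        abel
      rw [e]
      exact hψ.add hψ'
  obtain ⟨k, hkε⟩ : ∃ k : ℕ, θ ^ k * R < ε := by
    obtain ⟨k, hk⟩ := exists_pow_lt_of_lt_one (div_pos hε hR0) hθ1
    exact ⟨k, (lt_div_iff₀ hR0).1 hk⟩
  obtain ⟨ψ, hψ⟩ := hk k
  -- The term `ψ` undoes the passage from `φ` to its pullback by the iterate. What remains is the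
  -- coboundary of that pullback on tuples starting with `c`, and it vanishes because the iterate
  -- brings all of `C` within ε of its fixed point `c`.
  refine ⟨contract c (pullback f^[k] φ) - ψ, ?_⟩
  have e : φ - tupleCoboundary m (contract c (pullback f^[k] φ) - ψ) =
      (pullback f^[k] φ - tupleCoboundary m (contract c (pullback f^[k] φ))) -
        (pullback f^[k] φ - φ - tupleCoboundary m ψ) := by
    rw [map_sub]
    abel
  rw [e]
  refine (zeroNear_of_forall fun p hp => ?_).sub hψ
  rw [Pi.sub_apply, ← tupleCoboundary_cons, tupleCoboundary_pullback]
  have hmem : ∀ i, (Fin.cons c p : Fin (m + 2) → E) i ∈ C := fun i => by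
    refine Fin.cases ?_ (fun i => ?_) i
    · simpa using hc
    · simpa using hp i
  refine hsmall c hc _ fun i => ⟨Metric.mem_ball.2 ?_, hiter k (hmem i)⟩
  rw [hiterc]
  refine lt_of_le_of_lt ?_ hkε
  exact mul_le_mul_of_nonneg_left (Metric.mem_ball.1 (hR (hmem i))).le (pow_nonneg hθ0 k)

open Classical in
/-- The version of the acyclicity of compact convex sets for a subset of a subtype. -/
theorem exists_zeroNear_sub_coboundary_subtype {C : Set E} {Z : Set C}
    (hZ : IsCompact (Subtype.val '' Z)) (hconv : Convex ℝ (Subtype.val '' Z)) (hne : Z.Nonempty)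
    {m : ℕ} {φ : (Fin (m + 1) → C) → ℚ} (hφ : ZeroNear Z (tupleCoboundary (m + 1) φ)) :
    ∃ ψ : (Fin m → C) → ℚ, ZeroNear Z (φ - tupleCoboundary m ψ) := by
  obtain ⟨c, hc⟩ := hne
  -- This retraction need not be continuous: cochains are arbitrary functions and only their values
  -- on tuples in `Z` matter.
  let ρ : E → C := fun x => if hx : x ∈ C then ⟨x, hx⟩ else c
  have hρ : ∀ x : C, ρ x = x := fun x => dif_pos x.2
  have h1 : ZeroNear (Subtype.val '' Z) (tupleCoboundary (m + 1) (pullback ρ φ)) := by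
    rintro _ ⟨x, hx, rfl⟩
    obtain ⟨U, hU, h⟩ := hφ x hx
    rw [nhds_subtype_eq_comap, Filter.mem_comap] at hU
    obtain ⟨V, hV, hVU⟩ := hU
    refine ⟨V, hV, fun p hp => ?_⟩
    choose hpV q hq hqp using hp
    obtain rfl : (fun i => (q i : E)) = p := funext hqp
    rw [tupleCoboundary_pullback]
    refine h _ fun i => ?_
    rw [hρ]
    exact ⟨hVU (hpV i), hq i⟩
  obtain ⟨ψ, hψ⟩ := exists_zeroNear_sub_coboundary hZ hconv ⟨c, c, hc, rfl⟩ h1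
  refine ⟨pullback Subtype.val ψ, fun x hx => ?_⟩
  obtain ⟨U, hU, h⟩ := hψ x ⟨x, hx, rfl⟩
  refine ⟨Subtype.val ⁻¹' U, continuous_subtype_val.continuousAt hU, fun p hp => ?_⟩
  rw [← h (fun i => p i) fun i => ⟨(hp i).1, p i, (hp i).2, rfl⟩, tupleCoboundary_pullback,
    Pi.sub_apply, Pi.sub_apply, pullback, pullback]
  simp only [hρ]

theorem mem_locallyZero_iff_zeroNear {X : Type*} [TopologicalSpace X] {n : ℕ} {φ : Cochain X n} :
    φ ∈ locallyZero X n ↔ ZeroNear Set.univ φ :=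
  ⟨fun h => zeroNear_of_locallyZeroAt fun x _ => h x, fun h _ => h.locallyZeroAt Filter.univ_mem⟩

theorem exists_locallyZero_sub_coboundary {C : Set E} (hC : IsCompact C) (hconv : Convex ℝ C)
    (hne : C.Nonempty) {n : ℕ} {φ : Cochain C n} (hφ : coboundary n φ ∈ locallyZero C (n + 1)) :
    ∃ ψ : (Fin n → C) → ℚ, φ - tupleCoboundary n ψ ∈ locallyZero C n := by
  have himage : Subtype.val '' (Set.univ : Set C) = C := by simp
  have := hne.to_subtype
  obtain ⟨ψ, hψ⟩ := exists_zeroNear_sub_coboundary_subtype (Z := (Set.univ : Set C))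
    (by rwa [himage]) (by rwa [himage]) Set.univ_nonempty (mem_locallyZero_iff_zeroNear.1 hφ)
  exact ⟨ψ, mem_locallyZero_iff_zeroNear.2 hψ⟩

theorem tupleCoboundary_zero_eq {X : Type*} (ψ : (Fin 0 → X) → ℚ) :
    tupleCoboundary 0 ψ = ψ Fin.elim0 • (1 : Cochain X 0) :=
  funext fun p => by simp [tupleCoboundary_zero_apply]

/-- In positive degrees every cocycle is a coboundary; in degree 0 the same lemma, applied with the
augmentation, makes every cocycle a multiple of 1. Supports impose no condition on a compact space.
-/
theorem hasChi_of_convex {C : Set E} (hC : IsCompact C) (hconv : Convex ℝ C)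
    (hne : C.Nonempty) : HasChi C 1 := by
  have hcompact : CompactSpace C := isCompact_iff_compactSpace.1 hC
  have htop : ∀ n (φ : Cochain C n), φ ∈ compactlySupported C n :=
    fun n φ => ⟨Set.univ, isCompact_univ, fun x hx => (hx (Set.mem_univ x)).elim⟩
  have hpos : ∀ n, cohomologyDim C (n + 1) = 0 := fun n => by
    refine Module.length_eq_zero_iff.2 (subsingleton_subquotient fun φ hφ => ?_)
    obtain ⟨ψ, hψ⟩ := exists_locallyZero_sub_coboundary hC hconv hne hφ.2
    exact Submodule.mem_sup.2 ⟨coboundary n ψ, ⟨ψ, htop n ψ, rfl⟩, _, hψ, add_sub_cancel _ _⟩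
  have hzero : cohomologyDim C 0 = 1 := by
    have hone : (1 : Cochain C 0) ∈ cocycles C 0 := by
      refine ⟨htop 0 _, ?_⟩
      have : coboundary 0 (1 : Cochain C 0) = 0 := by
        have h := tupleCoboundary_comp 0 (1 : (Fin 0 → C) → ℚ)
        rw [tupleCoboundary_zero_eq, Pi.one_apply, one_smul] at h
        exact h
      change coboundary 0 (1 : Cochain C 0) ∈ locallyZero C 1
      rw [this]
      exact zero_mem _
    let F : ℚ →ₗ[ℚ] Cohomology C 0 :=
      LinearMap.toSpanSingleton ℚ _ (Submodule.Quotient.mk ⟨1, hone⟩)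
    have hF : ∀ q, F q = Submodule.Quotient.mk (q • ⟨1, hone⟩) := fun q => rfl
    have hbij : Function.Bijective F := by
      constructor
      · rw [injective_iff_map_eq_zero]
        intro q hq
        rw [hF, subquotient_mk_eq_zero] at hq
        obtain ⟨x, hx⟩ := hne
        have := (mem_locallyZero_iff_zeroNear.1 hq).apply_const (Set.mem_univ (⟨x, hx⟩ : C))
        simpa using this
      · intro z
        obtain ⟨⟨φ, hφ⟩, rfl⟩ := Submodule.Quotient.mk_surjective _ z
        obtain ⟨ψ, hψ⟩ := exists_locallyZero_sub_coboundary hC hconv hne hφ.2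
        refine ⟨ψ Fin.elim0, ?_⟩
        rw [hF, eq_comm, ← sub_eq_zero, ← Submodule.Quotient.mk_sub, subquotient_mk_eq_zero]
        rw [tupleCoboundary_zero_eq] at hψ
        exact hψ
    rw [cohomologyDim, ← (LinearEquiv.ofBijective F hbij).length_eq, Module.length_eq_finrank]
    simp
  refine ⟨fun n => if n = 0 then 1 else 0, 1, fun n => ?_, fun n hn => ?_, by simp⟩
  · cases n with
    | zero => simpa using hzero
    | succ n => simpa using hpos n
  · simp [Nat.one_le_iff_ne_zero.1 hn]

/-- This is the relative cohomology of `C` and a nonempty convex slice, both of them acyclic. A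
cocycle φ supported in ℓ < c, for some c < a, is dψ on `C`; on the slice ℓ ≥ c the cochain ψ is a
cocycle, hence dχ, and ψ - dχ is a primitive of φ supported in ℓ ≤ c. In degree 0, φ is constant and
vanishes at `z`. -/
theorem hasChi_convex_lt {C : Set E} (hC : IsCompact C) (hconv : Convex ℝ C) (ℓ : E →L[ℝ] ℝ)
    {a : ℝ} {z : E} (hz : z ∈ C) (haz : a ≤ ℓ z) : HasChi {x : C | ℓ x < a} 0 := by
  have hcompact : CompactSpace C := isCompact_iff_compactSpace.1 hC
  have hℓ : Continuous fun x : C => ℓ x := ℓ.continuous.comp continuous_subtype_val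
  have hopen : IsOpen {x : C | ℓ x < a} := isOpen_lt hℓ continuous_const
  have := hopen.isOpenEmbedding_subtypeVal.locallyCompactSpace
  suffices h : ∀ n, relCocycles (fun n => coboundary (X := C) n) (supportedIn {x : C | ℓ x < a})
      (locallyZero C) n ≤ relCoboundaries (fun n => coboundary (X := C) n)
        (supportedIn {x : C | ℓ x < a}) (locallyZero C) n by
    have hdim : ∀ n, cohomologyDim {x : C | ℓ x < a} n = 0 := fun n => by
      rw [cohomologyDim_eq_relDim hopen.isOpenEmbedding_subtypeVal, Subtype.range_val]
      exact Module.length_eq_zero_iff.2 (subsingleton_subquotient (h n))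
    exact ⟨fun _ => 0, 0, hdim, fun _ _ => rfl, rfl⟩
  rintro n φ ⟨⟨K, hK, hKU, hφK⟩, hφ⟩
  -- A level strictly between the maximum of ℓ on the support and `a`: the primitive vanishes near
  -- every point with ℓ > c, which leaves the compact support ℓ ≤ c inside ℓ < a.
  obtain ⟨c, hca, hcK⟩ : ∃ c < a, ∀ x ∈ K, ℓ x < c := by
    rcases K.eq_empty_or_nonempty with rfl | hKne
    · exact ⟨a - 1, by linarith, by simp⟩
    · obtain ⟨y, hy, hmax⟩ := hK.exists_isMaxOn hKne hℓ.continuousOn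
      have hya : ℓ y < a := hKU hy
      refine ⟨(ℓ y + a) / 2, by linarith, fun x hx => ?_⟩
      have : ℓ x ≤ ℓ y := hmax hx
      linarith
  let Z : Set C := {x | c ≤ ℓ x}
  have hZimage : Subtype.val '' Z = C ∩ {x | c ≤ ℓ x} := by
    ext x
    simp [Z, and_comm]
  have hZne : (⟨z, hz⟩ : C) ∈ Z := hca.le.trans haz
  have hZ : IsCompact (Subtype.val '' Z) := by
    rw [hZimage]
    exact hC.inter_right (isClosed_le continuous_const ℓ.continuous)
  have hZconv : Convex ℝ (Subtype.val '' Z) := by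
    rw [hZimage]
    exact hconv.inter (convex_halfSpace_ge ℓ.toLinearMap.isLinear c)
  have hφZ : ZeroNear Z φ := zeroNear_of_locallyZeroAt fun x hx =>
    hφK x fun hxK => (hcK x hxK).not_ge hx
  obtain ⟨ψ, hψ⟩ := exists_locallyZero_sub_coboundary hC hconv ⟨z, hz⟩ hφ
  cases n with
  | zero =>
    change φ ∈ locallyZero C 0
    have h1 := hφZ.apply_const hZne
    have h2 := (mem_locallyZero_iff_zeroNear.1 hψ).apply_const (Set.mem_univ (⟨z, hz⟩ : C))
    rw [tupleCoboundary_zero_eq] at hψ h2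
    rw [Pi.sub_apply, h1] at h2
    have h3 : ψ Fin.elim0 = 0 := by simpa using h2
    simpa [h3] using hψ
  | succ n =>
    have h1 : ZeroNear Z (tupleCoboundary (n + 1) ψ) := by
      have := hφZ.sub ((mem_locallyZero_iff_zeroNear.1 hψ).mono (Set.subset_univ Z))
      rwa [sub_sub_cancel] at this
    obtain ⟨χ, hχ⟩ := exists_zeroNear_sub_coboundary_subtype hZ hZconv ⟨_, hZne⟩ h1
    have h2 : coboundary n (ψ - tupleCoboundary n χ) = tupleCoboundary (n + 1) ψ := by
      rw [map_sub, ← tupleCoboundary_succ n (tupleCoboundary n χ), tupleCoboundary_comp, sub_zero]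
      rfl
    refine Submodule.mem_sup.2 ⟨coboundary n (ψ - tupleCoboundary n χ),
      ⟨ψ - tupleCoboundary n χ, ⟨{x | ℓ x ≤ c}, (isClosed_le hℓ continuous_const).isCompact,
        fun x hx => lt_of_le_of_lt hx hca, fun x hx => ?_⟩, rfl⟩, _, hψ, ?_⟩
    · have hx' : c < ℓ x := not_le.1 hx
      exact hχ.locallyZeroAt (Filter.mem_of_superset
        ((isOpen_lt continuous_const hℓ).mem_nhds hx') fun y (hy : c < ℓ y) => hy.le)
    · rw [h2, add_sub_cancel]

end Convex

/-! ### The plane -/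

/-- The closed standard triangle. -/
def stdTriangle : Set (ℝ × ℝ) := {p | 0 ≤ p.1 ∧ 0 ≤ p.2 ∧ p.1 + p.2 ≤ 1}

theorem isCompact_stdTriangle : IsCompact stdTriangle := by
  refine (isCompact_Icc (a := ((0 : ℝ), (0 : ℝ))) (b := (1, 1))).of_isClosed_subset ?_ ?_
  · exact (isClosed_le continuous_const continuous_fst).inter
      ((isClosed_le continuous_const continuous_snd).inter
        (isClosed_le (continuous_fst.add continuous_snd) continuous_const))
  · rintro ⟨x, y⟩ ⟨hx, hy, hxy⟩
    simp only at hx hy hxy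
    exact ⟨⟨hx, hy⟩, ⟨by simp only; linarith, by simp only; linarith⟩⟩

theorem convex_stdTriangle : Convex ℝ stdTriangle := by
  refine (convex_halfSpace_ge (LinearMap.fst ℝ ℝ ℝ).isLinear 0).inter
    ((convex_halfSpace_ge (LinearMap.snd ℝ ℝ ℝ).isLinear 0).inter
      (convex_halfSpace_le (LinearMap.fst ℝ ℝ ℝ + LinearMap.snd ℝ ℝ ℝ).isLinear 1))

theorem HasChi.congr_set {X : Type*} [TopologicalSpace X] {U V : Set X} {α β : ℤ}
    (h : HasChi U α) (hUV : U = V) (hαβ : α = β) : HasChi V β := by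
  subst hUV hαβ
  exact h

/-- Let T be the closed triangle, with χ_c = 1. Without one side or one vertex it has χ_c = 0 by
`hasChi_convex_lt`. The sets x > 0 and y > 0 have the union T without the origin, so their
intersection has 0 + 0 - 0 = 0. The sets x < 1 and y < 1 have the union T, so their intersection, T
without two vertices, has 0 + 0 - 1 = -1. Finally {x > 0, y > 0} and {x + y < 1} have the latter set
as union, and their intersection, the open triangle, has 0 + 0 + 1 = 1. -/
theorem hasChi_openTriangle :
    HasChi {x : stdTriangle | 0 < x.1.1 ∧ 0 < x.1.2 ∧ x.1.1 + x.1.2 < 1} 1 := by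
  have : CompactSpace stdTriangle := isCompact_iff_compactSpace.1 isCompact_stdTriangle
  have key : ∀ (u v a : ℝ) (z : ℝ × ℝ), z ∈ stdTriangle → a ≤ u * z.1 + v * z.2 →
      IsOpen {x : stdTriangle | u * x.1.1 + v * x.1.2 < a} ∧
      HasChi {x : stdTriangle | u * x.1.1 + v * x.1.2 < a} 0 := fun u v a z hz haz => by
    refine ⟨isOpen_lt (by fun_prop) continuous_const, ?_⟩
    exact hasChi_convex_lt isCompact_stdTriangle convex_stdTriangle
      (u • ContinuousLinearMap.fst ℝ ℝ ℝ + v • ContinuousLinearMap.snd ℝ ℝ ℝ) hz haz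
  have h00 : ((0 : ℝ), (0 : ℝ)) ∈ stdTriangle := by simp [stdTriangle]
  have h10 : ((1 : ℝ), (0 : ℝ)) ∈ stdTriangle := by simp [stdTriangle]
  have h01 : ((0 : ℝ), (1 : ℝ)) ∈ stdTriangle := by simp [stdTriangle]
  obtain ⟨o1, c1⟩ := key (-1) 0 0 _ h00 (by simp)
  obtain ⟨o2, c2⟩ := key 0 (-1) 0 _ h00 (by simp)
  obtain ⟨o3, c3⟩ := key 1 1 1 _ h10 (by simp)
  obtain ⟨o12, c12⟩ := key (-1) (-1) 0 _ h00 (by simp)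
  obtain ⟨o13, c13⟩ := key 0 1 1 _ h01 (by simp)
  obtain ⟨o23, c23⟩ := key 1 0 1 _ h10 (by simp)
  have hT : HasChi (Set.univ : Set stdTriangle) 1 :=
    (hasChi_of_convex isCompact_stdTriangle convex_stdTriangle ⟨_, h00⟩).homeomorph
      (Homeomorph.Set.univ _)
  have w := HasChi.inter o1 o2 c1 c2 (c12.congr_set (by
    ext ⟨⟨x, y⟩, hx, hy, hxy⟩
    simp only [Set.mem_ofPred_eq, Set.mem_union] at *
    constructor
    · intro h
      by_contra! h'
      linarith
    · rintro (h | h) <;> linarith) rfl)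
  have v := HasChi.inter o13 o23 c13 c23 (hT.congr_set (by
    ext ⟨⟨x, y⟩, hx, hy, hxy⟩
    simp only [Set.mem_ofPred_eq, Set.mem_union, Set.mem_univ, true_iff] at *
    by_contra! h'
    linarith) rfl)
  refine (HasChi.inter (o1.inter o2) o3 w c3 (v.congr_set ?_ rfl)).congr_set ?_ (by norm_num)
  · ext ⟨⟨x, y⟩, hx, hy, hxy⟩
    simp only [Set.mem_ofPred_eq, Set.mem_union, Set.mem_inter_iff] at *
    constructor
    · rintro ⟨h1, h2⟩
      by_contra! h'
      rcases lt_or_ge 0 x with h | h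
      · rcases lt_or_ge 0 y with h3 | h3
        · linarith [h'.1 (by linarith)]
        · linarith
      · linarith
    · rintro (⟨h1, h2⟩ | h)
      · constructor <;> linarith
      · constructor <;> linarith
  · ext ⟨⟨x, y⟩, hx, hy, hxy⟩
    simp only [Set.mem_ofPred_eq, Set.mem_inter_iff] at *
    constructor
    · rintro ⟨⟨h1, h2⟩, h3⟩
      exact ⟨by linarith, by linarith, by linarith⟩
    · rintro ⟨h1, h2, h3⟩
      exact ⟨⟨by linarith, by linarith⟩, by linarith⟩

/-- The open triangle is homeomorphic to the open quadrant. -/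
noncomputable def openTriangleHomeomorph :
    (Set.Ioi (0 : ℝ)) × (Set.Ioi (0 : ℝ)) ≃ₜ
      {x : stdTriangle | 0 < x.1.1 ∧ 0 < x.1.2 ∧ x.1.1 + x.1.2 < 1} where
  toFun p := ⟨⟨(p.1.1 / (1 + p.1.1 + p.2.1), p.2.1 / (1 + p.1.1 + p.2.1)), by
    obtain ⟨⟨u, hu⟩, ⟨v, hv⟩⟩ := p
    simp only [Set.mem_Ioi] at hu hv
    refine ⟨by positivity, by positivity, ?_⟩
    simp only
    rw [← add_div, div_le_one (by positivity)]
    linarith⟩, by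
    obtain ⟨⟨u, hu⟩, ⟨v, hv⟩⟩ := p
    simp only [Set.mem_Ioi] at hu hv
    refine ⟨by positivity, by positivity, ?_⟩
    simp only
    rw [← add_div, div_lt_one (by positivity)]
    linarith⟩
  invFun x := (⟨x.1.1.1 / (1 - x.1.1.1 - x.1.1.2), div_pos x.2.1 (by linarith [x.2.2.2])⟩,
    ⟨x.1.1.2 / (1 - x.1.1.1 - x.1.1.2), div_pos x.2.2.1 (by linarith [x.2.2.2])⟩)
  left_inv := by
    rintro ⟨⟨u, hu⟩, ⟨v, hv⟩⟩
    simp only [Set.mem_Ioi] at hu hv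
    have h : 1 + u + v ≠ 0 := by positivity
    have e : 1 - u / (1 + u + v) - v / (1 + u + v) = 1 / (1 + u + v) := by
      field_simp
      ring
    refine Prod.ext (Subtype.ext ?_) (Subtype.ext ?_)
    · simp only [e]
      field_simp
    · simp only [e]
      field_simp
  right_inv := by
    rintro ⟨⟨⟨x, y⟩, h⟩, hx, hy, hxy⟩
    simp only at hx hy hxy
    have h0 : 1 - x - y ≠ 0 := by
      have : 0 < 1 - x - y := by linarith
      exact this.ne'
    have e : 1 + x / (1 - x - y) + y / (1 - x - y) = 1 / (1 - x - y) := by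
      field_simp
      ring
    refine Subtype.ext (Subtype.ext (Prod.ext ?_ ?_))
    · simp only [e]
      field_simp
    · simp only [e]
      field_simp
  continuous_toFun := by
    refine Continuous.subtype_mk (Continuous.subtype_mk (Continuous.prodMk ?_ ?_) _) _
    · refine Continuous.div (by fun_prop) (by fun_prop) ?_
      rintro ⟨⟨u, hu⟩, ⟨v, hv⟩⟩
      simp only [Set.mem_Ioi] at hu hv
      positivity
    · refine Continuous.div (by fun_prop) (by fun_prop) ?_
      rintro ⟨⟨u, hu⟩, ⟨v, hv⟩⟩
      simp only [Set.mem_Ioi] at hu hv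
      positivity
  continuous_invFun := by
    refine Continuous.prodMk (Continuous.subtype_mk ?_ _) (Continuous.subtype_mk ?_ _)
    · refine Continuous.div (by fun_prop) (by fun_prop) fun x => ?_
      have : 0 < 1 - x.1.1.1 - x.1.1.2 := by linarith [x.2.2.2]
      exact this.ne'
    · refine Continuous.div (by fun_prop) (by fun_prop) fun x => ?_
      have : 0 < 1 - x.1.1.1 - x.1.1.2 := by linarith [x.2.2.2]
      exact this.ne'

theorem hasChi_plane : HasChi (ℝ × ℝ) 1 := by
  have : CompactSpace stdTriangle := isCompact_iff_compactSpace.1 isCompact_stdTriangle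
  have hopen : IsOpen {x : stdTriangle | 0 < x.1.1 ∧ 0 < x.1.2 ∧ x.1.1 + x.1.2 < 1} := by
    have h1 : IsOpen {x : stdTriangle | 0 < x.1.1} := isOpen_lt continuous_const (by fun_prop)
    have h2 : IsOpen {x : stdTriangle | 0 < x.1.2} := isOpen_lt continuous_const (by fun_prop)
    have h3 : IsOpen {x : stdTriangle | x.1.1 + x.1.2 < 1} :=
      isOpen_lt (by fun_prop) continuous_const
    exact h1.inter (h2.inter h3)
  have := hopen.isOpenEmbedding_subtypeVal.locallyCompactSpace
  have e : ℝ ≃ₜ Set.Ioi (0 : ℝ) := Real.expOrderIso.toHomeomorph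
  exact hasChi_openTriangle.homeomorph ((e.prodCongr e).trans openTriangleHomeomorph)

/-! ### Boxes -/

/-- An open interval with possibly infinite end points. -/
def interval (a b : EReal) : Set ℝ := {x | a < x ∧ x < b}

theorem isOpen_interval (a b : EReal) : IsOpen (interval a b) :=
  (isOpen_lt continuous_const continuous_coe_real_ereal).inter
    (isOpen_lt continuous_coe_real_ereal continuous_const)

theorem nonempty_homeomorph_interval {a b : EReal} (h : a < b) :
    Nonempty (interval a b ≃ₜ ℝ) := by
  have e0 : Set.Ioi (0 : ℝ) ≃ₜ ℝ := Real.expOrderIso.toHomeomorph.symm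
  induction a with
  | top => exact (not_top_lt h).elim
  | bot =>
    induction b with
    | bot => exact (lt_irrefl _ h).elim
    | top =>
      refine ⟨(Homeomorph.setCongr ?_).trans (Homeomorph.Set.univ ℝ)⟩
      ext x
      simp [interval]
    | coe b =>
      refine ⟨Homeomorph.trans ((Homeomorph.subLeft b).sets ?_) e0⟩
      ext x
      simp [interval]
  | coe a =>
    induction b with
    | bot => exact (not_lt_bot h).elim
    | top =>
      refine ⟨Homeomorph.trans ((Homeomorph.subRight a).sets ?_) e0⟩
      ext x
      simp [interval]
    | coe b =>
      have hab : a < b := by exact_mod_cast h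
      refine ⟨Homeomorph.trans ?_ e0⟩
      exact
        { toFun x := ⟨(x - a) / (b - x), div_pos
            (sub_pos.2 (EReal.coe_lt_coe_iff.1 x.2.1)) (sub_pos.2 (EReal.coe_lt_coe_iff.1 x.2.2))⟩
          invFun y := ⟨(a + b * y) / (1 + y), by
            obtain ⟨y, hy⟩ := y
            have hy' : (0 : ℝ) < y := hy
            refine ⟨EReal.coe_lt_coe_iff.2 ?_, EReal.coe_lt_coe_iff.2 ?_⟩
            · rw [lt_div_iff₀ (by positivity)]
              nlinarith
            · rw [div_lt_iff₀ (by positivity)]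
              nlinarith⟩
          left_inv := by
            rintro ⟨x, hx, hx'⟩
            have h1 : b - x ≠ 0 := (sub_pos.2 (EReal.coe_lt_coe_iff.1 hx')).ne'
            have h2 : b - a ≠ 0 := (sub_pos.2 hab).ne'
            have e : 1 + (x - a) / (b - x) = (b - a) / (b - x) := by
              field_simp
              ring
            refine Subtype.ext ?_
            simp only [e]
            field_simp
            ring
          right_inv := by
            rintro ⟨y, hy⟩
            have hy' : (0 : ℝ) < y := hy
            have h1 : 1 + y ≠ 0 := by positivity
            have h2 : b - a ≠ 0 := (sub_pos.2 hab).ne'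
            have e : b - (a + b * y) / (1 + y) = (b - a) / (1 + y) := by
              field_simp
              ring
            refine Subtype.ext ?_
            simp only [e]
            field_simp
            ring
          continuous_toFun := by
            refine Continuous.subtype_mk (Continuous.div (by fun_prop) (by fun_prop) fun x => ?_) _
            exact (sub_pos.2 (EReal.coe_lt_coe_iff.1 x.2.2)).ne'
          continuous_invFun := by
            refine Continuous.subtype_mk (Continuous.div (by fun_prop) (by fun_prop) fun y => ?_) _
            have : (0 : ℝ) < y := y.2
            positivity }

/-- An open rectangle in `ℂ`, with possibly infinite sides. -/
def box (a b c d : EReal) : Set ℂ := {z | z.re ∈ interval a b ∧ z.im ∈ interval c d}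

theorem isOpen_box (a b c d : EReal) : IsOpen (box a b c d) :=
  ((isOpen_interval a b).preimage Complex.continuous_re).inter
    ((isOpen_interval c d).preimage Complex.continuous_im)

theorem nonempty_homeomorph_box {a b c d : EReal} (h : a < b) (h' : c < d) :
    Nonempty (box a b c d ≃ₜ ℝ × ℝ) := by
  obtain ⟨e⟩ := nonempty_homeomorph_interval h
  obtain ⟨e'⟩ := nonempty_homeomorph_interval h'
  have e0 : box a b c d ≃ₜ interval a b ×ˢ interval c d :=
    Complex.equivRealProdCLM.toHomeomorph.sets (by ext; rfl)
  exact ⟨(e0.trans (Homeomorph.Set.prod _ _)).trans (e.prodCongr e')⟩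

/-! ### Finite coverings of punctured planes -/

theorem HasChi.of_univ {X : Type*} [TopologicalSpace X] [T2Space X] [LocallyCompactSpace X]
    {c : ℤ} (h : HasChi (Set.univ : Set X) c) : HasChi X c := by
  have := (Homeomorph.Set.univ X).isOpenEmbedding.locallyCompactSpace
  exact h.homeomorph (Homeomorph.Set.univ X).symm

theorem hasChi_prod_finite {A ι : Type*} [TopologicalSpace A] [T2Space A] [LocallyCompactSpace A]
    [TopologicalSpace ι] [DiscreteTopology ι] [Fintype ι] {c : ℤ} (h : HasChi A c) :
    HasChi (A × ι) (Fintype.card ι * c) := by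
  classical
  have hopen : ∀ s : Set ι, IsOpen {x : A × ι | x.2 ∈ s} := fun s =>
    (isOpen_discrete s).preimage continuous_snd
  have key : ∀ s : Finset ι, HasChi {x : A × ι | x.2 ∈ (s : Set ι)} (s.card * c) := fun s => by
    induction s using Finset.induction_on with
    | empty =>
      have : IsEmpty {x : A × ι | x.2 ∈ ((∅ : Finset ι) : Set ι)} := ⟨fun x => by simpa using x.2⟩
      simpa using hasChi_empty
    | insert i s hi ih =>
      have e : {x : A × ι | x.2 ∈ ({i} : Set ι)} ≃ₜ A :=
        { toFun x := x.1.1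
          invFun a := ⟨(a, i), rfl⟩
          left_inv := by
            rintro ⟨⟨a, k⟩, hk⟩
            obtain rfl : k = i := hk
            rfl
          right_inv _ := rfl
          continuous_toFun := by fun_prop
          continuous_invFun := by fun_prop }
      have hempty : IsEmpty ↥({x : A × ι | x.2 ∈ ({i} : Set ι)} ∩
          {x : A × ι | x.2 ∈ (s : Set ι)}) := ⟨by
        rintro ⟨x, h1, h2⟩
        obtain rfl : x.2 = i := h1
        exact hi h2⟩
      refine (HasChi.union (hopen {i}) (hopen s) (h.homeomorph e) ih hasChi_empty).congr_set ?_ ?_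
      · ext x
        simp
      · rw [Finset.card_insert_of_notMem hi]
        push_cast
        ring
  have hu : {x : A × ι | x.2 ∈ ((Finset.univ : Finset ι) : Set ι)} = Set.univ := by
    ext x
    simp
  exact ((key Finset.univ).congr_set hu rfl).of_univ

/-- `π : X → ℂ` avoids `P` and behaves, as far as Euler characteristics are concerned, like a
covering of degree `m` over the open cells of `ℂ \ P`. -/
structure CellCover {X : Type*} [TopologicalSpace X] (π : X → ℂ) (P : Finset ℂ) (m : ℤ) :
    Prop where
  continuous : Continuous π
  notMem : ∀ x, π x ∉ P
  hasChi : ∀ S : Set ℂ, IsOpen S → Nonempty (S ≃ₜ ℝ × ℝ) → (∀ z ∈ S, z ∉ P) → HasChi (π ⁻¹' S) m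

/-! ### Counting cells of a punctured plane -/

section CellCover

variable {X : Type*} [TopologicalSpace X] {π : X → ℂ} {P : Finset ℂ} {m : ℤ}

theorem CellCover.hasChi_box (h : CellCover π P m) {a b c d : EReal} (hab : a < b) (hcd : c < d)
    (hP : ∀ z ∈ box a b c d, z ∉ P) : HasChi (π ⁻¹' box a b c d) m :=
  h.hasChi _ (isOpen_box a b c d) (nonempty_homeomorph_box hab hcd) hP

theorem CellCover.isOpen_box (h : CellCover π P m) (a b c d : EReal) :
    IsOpen (π ⁻¹' box a b c d) := (CompactSupp.isOpen_box a b c d).preimage h.continuous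

theorem mem_box {a b c d : EReal} {z : ℂ} :
    z ∈ box a b c d ↔ (a < z.re ∧ z.re < b) ∧ c < z.im ∧ z.im < d := Iff.rfl

/-- A strip with one puncture p is covered by the four rectangles to the left of, to the right of,
above and below p. Each contributes m, as do the four quadrants in which adjacent ones meet; the
opposite ones are disjoint. The total is 4m - 4m = 0. -/
theorem CellCover.hasChi_punctured_strip [T2Space X] [LocallyCompactSpace X]
    (h : CellCover π P m) {a b : EReal} {p : ℂ} (hp : p ∈ P) (ha : a < p.re) (hb : p.re < b)
    (hP : ∀ q ∈ P, a < q.re → q.re < b → q = p) : HasChi (π ⁻¹' box a b ⊥ ⊤) 0 := by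
  have hbot : ∀ x : ℝ, (⊥ : EReal) < x := EReal.bot_lt_coe
  have htop : ∀ x : ℝ, (x : EReal) < ⊤ := EReal.coe_lt_top
  have havoid : ∀ a' b' c d : EReal, a ≤ a' → b' ≤ b →
      (∀ q ∈ box a' b' c d, q ≠ p) → ∀ z ∈ box a' b' c d, z ∉ P :=
    fun a' b' c d h1 h2 h3 z hz hzP =>
      h3 z hz (hP z hzP (h1.trans_lt hz.1.1) (hz.1.2.trans_le h2))
  have hL := h.hasChi_box ha (bot_lt_top (α := EReal))
    (havoid _ _ _ _ le_rfl hb.le fun q hq e => by simp [mem_box, e] at hq)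
  have hR := h.hasChi_box hb (bot_lt_top (α := EReal))
    (havoid _ _ _ _ ha.le le_rfl fun q hq e => by simp [mem_box, e] at hq)
  have hU := h.hasChi_box (ha.trans hb) (htop p.im)
    (havoid _ _ _ _ le_rfl le_rfl fun q hq e => by simp [mem_box, e] at hq)
  have hD := h.hasChi_box (ha.trans hb) (hbot p.im)
    (havoid _ _ _ _ le_rfl le_rfl fun q hq e => by simp [mem_box, e] at hq)
  have hLU := h.hasChi_box ha (htop p.im)
    (havoid _ _ _ _ le_rfl hb.le fun q hq e => by simp [mem_box, e] at hq)
  have hRU := h.hasChi_box hb (htop p.im)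
    (havoid _ _ _ _ ha.le le_rfl fun q hq e => by simp [mem_box, e] at hq)
  have hLD := h.hasChi_box ha (hbot p.im)
    (havoid _ _ _ _ le_rfl hb.le fun q hq e => by simp [mem_box, e] at hq)
  have hRD := h.hasChi_box hb (hbot p.im)
    (havoid _ _ _ _ ha.le le_rfl fun q hq e => by simp [mem_box, e] at hq)
  have h1 := HasChi.union (h.isOpen_box _ _ _ _) (h.isOpen_box _ _ _ _) hL hU
    (hLU.congr_set (by
      ext x
      simp only [Set.mem_preimage, Set.mem_inter_iff, mem_box, hbot, htop, and_true]
      constructor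
      · rintro ⟨⟨h1, h2⟩, h3⟩
        exact ⟨⟨h1, h2⟩, ⟨h1, h2.trans hb⟩, h3⟩
      · rintro ⟨h1, -, h3⟩
        exact ⟨h1, h3⟩) rfl)
  have h2 := HasChi.union ((h.isOpen_box _ _ _ _).union (h.isOpen_box _ _ _ _))
    (h.isOpen_box _ _ _ _) h1 hR (hRU.congr_set (by
      ext x
      simp only [Set.mem_preimage, Set.mem_inter_iff, Set.mem_union, mem_box, hbot, htop, and_true]
      constructor
      · rintro ⟨⟨h1, h2⟩, h3⟩
        exact ⟨Or.inr ⟨⟨ha.trans h1, h2⟩, h3⟩, h1, h2⟩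
      · rintro ⟨⟨-, h1⟩ | ⟨-, h3⟩, h4, h5⟩
        · exact (lt_asymm h1 h4).elim
        · exact ⟨⟨h4, h5⟩, h3⟩) rfl)
  have hempty : IsEmpty ↥(π ⁻¹' box a p.re ⊥ p.im ∩ π ⁻¹' box p.re b ⊥ p.im) :=
    ⟨fun x => lt_asymm x.2.1.1.2 x.2.2.1.1⟩
  have h3 := HasChi.union (h.isOpen_box _ _ _ _) (h.isOpen_box _ _ _ _) hLD hRD hasChi_empty
  refine (HasChi.union (((h.isOpen_box _ _ _ _).union (h.isOpen_box _ _ _ _)).union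
    (h.isOpen_box _ _ _ _)) (h.isOpen_box _ _ _ _) h2 hD (h3.congr_set ?_ rfl)).congr_set ?_
    (by ring)
  · ext x
    simp only [Set.mem_preimage, Set.mem_inter_iff, Set.mem_union, mem_box, hbot, htop, true_and,
      and_true]
    constructor
    · rintro (⟨⟨h1, h2⟩, h3⟩ | ⟨⟨h1, h2⟩, h3⟩)
      · exact ⟨Or.inl (Or.inl ⟨h1, h2⟩), ⟨h1, h2.trans hb⟩, h3⟩
      · exact ⟨Or.inr ⟨h1, h2⟩, ⟨ha.trans h1, h2⟩, h3⟩
    · rintro ⟨(h1 | ⟨-, h1⟩) | h1, h2, h3⟩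
      · exact Or.inl ⟨h1, h3⟩
      · exact (lt_asymm h1 h3).elim
      · exact Or.inr ⟨h1, h3⟩
  · ext x
    have hx : π x ≠ p := fun e => h.notMem x (e ▸ hp)
    simp only [Set.mem_preimage, Set.mem_union, mem_box, hbot, htop, true_and, and_true]
    constructor
    · rintro (((⟨h1, h2⟩ | ⟨h1, -⟩) | ⟨h1, h2⟩) | ⟨h1, -⟩)
      · exact ⟨h1, h2.trans hb⟩
      · exact h1
      · exact ⟨ha.trans h1, h2⟩
      · exact h1
    · rintro ⟨h1, h2⟩
      rcases lt_trichotomy (π x).re p.re with h3 | h3 | h3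
      · exact Or.inl (Or.inl (Or.inl ⟨h1, EReal.coe_lt_coe_iff.2 h3⟩))
      · rcases lt_trichotomy (π x).im p.im with h4 | h4 | h4
        · exact Or.inr ⟨⟨h1, h2⟩, EReal.coe_lt_coe_iff.2 h4⟩
        · exact (hx (Complex.ext h3 h4)).elim
        · exact Or.inl (Or.inl (Or.inr ⟨⟨h1, h2⟩, EReal.coe_lt_coe_iff.2 h4⟩))
      · exact Or.inl (Or.inr ⟨EReal.coe_lt_coe_iff.2 h3, h2⟩)

/-- Induction on the punctures in the order of their real parts. If p is the last one, the
half-plane is the union of the part to the left of p and a strip punctured at p only, which meet in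
an unpunctured strip. Adding p thus changes the value by 0 - m. -/
theorem CellCover.hasChi_left_half_plane [T2Space X] [LocallyCompactSpace X]
    (h : CellCover π P m) (hinj : Set.InjOn Complex.re P) (Q : Finset ℂ) :
    Q ⊆ P → ∀ b : EReal, ⊥ < b → (∀ p ∈ P, p ∈ Q ↔ (p.re : EReal) < b) →
      HasChi (π ⁻¹' box ⊥ b ⊥ ⊤) (m * (1 - Q.card)) := by
  classical
  induction Q using Finset.induction_on_max_value Complex.re with
  | empty =>
    intro _ b hb hQ
    have := h.hasChi_box hb bot_lt_top fun z hz hzP => by simpa using (hQ z hzP).2 hz.1.2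
    simpa using this
  | insert p Q hpQ hmax ih =>
    intro hQP b hb hQ
    have hp : p ∈ P := hQP (Finset.mem_insert_self p Q)
    have hpb : (p.re : EReal) < b := (hQ p hp).1 (Finset.mem_insert_self p Q)
    have hlt : ∀ x ∈ Q, x.re < p.re := fun x hx => (hmax x hx).lt_of_ne fun e =>
      hpQ (hinj (hQP (Finset.mem_insert_of_mem hx)) hp e ▸ hx)
    -- The largest real part of the earlier punctures, or -∞ if there are none.
    set c : EReal := Q.sup fun x => (x.re : EReal)
    have hc : c < p.re := (Finset.sup_lt_iff (EReal.bot_lt_coe _)).2 fun x hx =>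
      EReal.coe_lt_coe_iff.2 (hlt x hx)
    have hle : ∀ x ∈ Q, (x.re : EReal) ≤ c := fun x hx =>
      Finset.le_sup (f := fun x : ℂ => (x.re : EReal)) hx
    have hQ' : ∀ x ∈ P, x ∈ Q ↔ (x.re : EReal) < p.re := fun x hx => by
      refine ⟨fun hxQ => EReal.coe_lt_coe_iff.2 (hlt x hxQ), fun hxp => ?_⟩
      refine Finset.mem_of_mem_insert_of_ne ((hQ x hx).2 (hxp.trans hpb)) ?_
      rintro rfl
      exact lt_irrefl _ hxp
    have h1 := ih ((Finset.subset_insert _ _).trans hQP) p.re (EReal.bot_lt_coe _) hQ'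
    have h2 := h.hasChi_punctured_strip hp hc hpb fun q hq hcq hqb => by
      rcases Finset.mem_insert.1 ((hQ q hq).2 hqb) with e | hqQ
      · exact e
      · exact ((hle q hqQ).not_gt hcq).elim
    have h3 := h.hasChi_box hc (bot_lt_top (α := EReal)) fun z hz hzP =>
      (hle z ((hQ' z hzP).2 hz.1.2)).not_gt hz.1.1
    refine (HasChi.union (h.isOpen_box _ _ _ _) (h.isOpen_box _ _ _ _) h1 h2
      (h3.congr_set ?_ rfl)).congr_set ?_ ?_
    · ext x
      simp only [Set.mem_preimage, Set.mem_inter_iff, mem_box, EReal.bot_lt_coe, EReal.coe_lt_top,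
        true_and, and_true]
      constructor
      · rintro ⟨h4, h5⟩
        exact ⟨h5, h4, h5.trans hpb⟩
      · rintro ⟨h4, h5, h6⟩
        exact ⟨h5, h4⟩
    · ext x
      simp only [Set.mem_preimage, Set.mem_union, mem_box, EReal.bot_lt_coe, EReal.coe_lt_top,
        true_and, and_true]
      constructor
      · rintro (h4 | ⟨-, h4⟩)
        · exact h4.trans hpb
        · exact h4
      · intro h4
        rcases lt_or_ge ((π x).re : EReal) p.re with h5 | h5
        · exact Or.inl h5
        · exact Or.inr ⟨hc.trans_le h5, h4⟩
    · rw [Finset.card_insert_of_notMem hpQ]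
      push_cast
      ring

/-- For w = 1 + i x the real part of w z is re z - x im z, so two points of `P` with distinct
imaginary parts collide for a single x, and two with equal imaginary parts never do. Only finitely
many x must be avoided. -/
theorem exists_injOn_re_mul (P : Finset ℂ) :
    ∃ w : ℂ, w ≠ 0 ∧ Set.InjOn (fun z => (w * z).re) P := by
  obtain ⟨x, hx⟩ := Infinite.exists_notMem_finset
    ((P ×ˢ P).image fun z : ℂ × ℂ => (z.1 - z.2).re / (z.1 - z.2).im)
  refine ⟨⟨1, x⟩, fun e => by simpa using congrArg Complex.re e, fun p hp q hq e => ?_⟩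
  by_contra hpq
  simp only [Complex.mul_re, one_mul] at e
  by_cases him : (p - q).im = 0
  · rw [Complex.sub_im, sub_eq_zero] at him
    rw [him] at e
    exact hpq (Complex.ext (by linarith) him)
  · refine hx (Finset.mem_image.2 ⟨(p, q), Finset.mem_product.2 ⟨hp, hq⟩, ?_⟩)
    rw [div_eq_iff him, Complex.sub_re, Complex.sub_im]
    linarith

/-- Multiplication by a suitable w makes the real parts of the punctures distinct. The hypothesis on
cells refers to all open sets homeomorphic to ℝ², not only to rectangles, so it is preserved by this
change of coordinate. -/
theorem CellCover.hasChi_univ [T2Space X] [LocallyCompactSpace X] (h : CellCover π P m) :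
    HasChi X (m * (1 - P.card)) := by
  classical
  obtain ⟨w, hw, hinj⟩ := exists_injOn_re_mul P
  let e : ℂ ≃ₜ ℂ := Homeomorph.mulLeft₀ w hw
  have h' : CellCover (fun x => w * π x) (P.image e) m := by
    refine ⟨continuous_const.mul h.continuous, fun x hx => ?_, fun S hS ⟨f⟩ hP => ?_⟩
    · obtain ⟨p, hp, hpx⟩ := Finset.mem_image.1 hx
      have : p = π x := e.injective hpx
      exact h.notMem x (this ▸ hp)
    · refine h.hasChi (e ⁻¹' S) (hS.preimage e.continuous) ⟨(e.sets rfl).trans f⟩ fun z hz hzP => ?_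
      exact hP _ hz (Finset.mem_image_of_mem e hzP)
  have := h'.hasChi_left_half_plane (fun x hx y hy hxy => by
    obtain ⟨p, hp, rfl⟩ := Finset.mem_image.1 hx
    obtain ⟨q, hq, rfl⟩ := Finset.mem_image.1 hy
    rw [hinj hp hq hxy]) _ Finset.Subset.rfl ⊤ bot_lt_top fun p hp => by simp [hp]
  rw [Finset.card_image_of_injective _ e.injective] at this
  refine (this.congr_set ?_ rfl).of_univ
  ext x
  simp only [Set.mem_preimage, mem_box, EReal.bot_lt_coe, EReal.coe_lt_top, and_self, Set.mem_univ]

end CellCover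

/-- The curve `s ^ m = g t` over `ℂ \ P`. -/
def rootCover (P : Finset ℂ) (m : ℕ) (g : ℂ → ℂ) : Set (ℂ × ℂ) := {z | z.2 ∉ P ∧ z.1 ^ m = g z.2}

/-! ### The covers s ^ m = g t -/

section RootCover

variable {P : Finset ℂ} {m : ℕ} {g : ℂ → ℂ}

theorem locallyCompactSpace_rootCover (hg : ContinuousOn g (P : Set ℂ)ᶜ) :
    LocallyCompactSpace (rootCover P m g) := by
  have hopen : IsOpen {z : ℂ × ℂ | z.2 ∈ (P : Set ℂ)ᶜ} :=
    (P.finite_toSet.isClosed.isOpen_compl).preimage continuous_snd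
  have : LocallyCompactSpace {z : ℂ × ℂ | z.2 ∈ (P : Set ℂ)ᶜ} := hopen.locallyCompactSpace
  have hcont : Continuous fun z : {z : ℂ × ℂ | z.2 ∈ (P : Set ℂ)ᶜ} => g z.1.2 :=
    hg.comp_continuous (by fun_prop) fun z => z.2
  have hclosed : IsClosed {z : {z : ℂ × ℂ | z.2 ∈ (P : Set ℂ)ᶜ} | z.1.1 ^ m = g z.1.2} :=
    isClosed_eq (by fun_prop) hcont
  have h2 := hclosed.locallyCompactSpace
  let e : rootCover P m g ≃ₜ {z : {z : ℂ × ℂ | z.2 ∈ (P : Set ℂ)ᶜ} | z.1.1 ^ m = g z.1.2} :=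
    { toFun z := ⟨⟨z.1, z.2.1⟩, z.2.2⟩
      invFun z := ⟨z.1.1, z.1.2, z.2⟩
      left_inv _ := rfl
      right_inv _ := rfl
      continuous_toFun := by fun_prop
      continuous_invFun := by fun_prop }
  exact e.isOpenEmbedding.locallyCompactSpace

/-- The plane is simply connected, so `f` lifts through the covering exp to a continuous logarithm
F, and exp (F / m) is the root. -/
theorem exists_continuous_root {A : Type*} [TopologicalSpace A] (e : A ≃ₜ ℝ × ℝ) (hm : m ≠ 0)
    {f : A → ℂ} (hf : Continuous f) (h0 : ∀ a, f a ≠ 0) :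
    ∃ h : A → ℂ, Continuous h ∧ (∀ a, h a ≠ 0) ∧ ∀ a, h a ^ m = f a := by
  obtain ⟨F, ⟨-, hF⟩, -⟩ := Complex.isCoveringMapOn_exp.existsUnique_continuousMap_lifts
    (⟨fun x => f (e.symm x), hf.comp e.symm.continuous⟩ : C(ℝ × ℝ, ℂ)) (a₀ := 0)
    (Complex.exp_log (h0 _)) (fun a => h0 _)
  refine ⟨fun a => Complex.exp (F (e a) / m), by fun_prop, fun a => Complex.exp_ne_zero _,
    fun a => ?_⟩
  rw [← Complex.exp_nat_mul, mul_div_cancel₀ _ (Nat.cast_ne_zero.2 hm)]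
  simpa using congrFun hF (e a)

/-- Over a cell, `g` has a continuous m-th root `h`, and s / h(t) is an m-th root of unity. The
preimage of the cell is therefore its product with the m roots of unity. -/
theorem cellCover_rootCover (hm : m ≠ 0) (hg : ContinuousOn g (P : Set ℂ)ᶜ)
    (h0 : ∀ t ∉ P, g t ≠ 0) : CellCover (fun z : rootCover P m g => z.1.2) P m := by
  refine ⟨by fun_prop, fun z => z.2.1, fun S hS ⟨e⟩ hSP => ?_⟩
  obtain ⟨h, hc, hne, hroot⟩ := exists_continuous_root e hm
    (f := fun t : S => g t) (hg.comp_continuous continuous_subtype_val fun t => hSP t t.2)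
    fun t => h0 t (hSP t t.2)
  let R := Polynomial.nthRootsFinset m (1 : ℂ)
  have hR : ∀ x, x ∈ R ↔ x ^ m = 1 := fun x => Polynomial.mem_nthRootsFinset hm.bot_lt 1
  have hcard : Fintype.card R = m := by
    rw [Fintype.card_coe]
    exact (Complex.isPrimitiveRoot_exp m hm).card_nthRootsFinset
  let E : (fun z : rootCover P m g => z.1.2) ⁻¹' S ≃ₜ S × R :=
    { toFun z := (⟨z.1.1.2, z.2⟩, ⟨z.1.1.1 / h ⟨z.1.1.2, z.2⟩, by
        rw [hR, div_pow, hroot, z.1.2.2]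
        exact div_self (h0 _ (hSP _ z.2))⟩)
      invFun y := ⟨⟨(y.2.1 * h y.1, y.1.1), hSP _ y.1.2, by
        simp only
        rw [mul_pow, (hR _).1 y.2.2, hroot, one_mul]⟩, y.1.2⟩
      left_inv z := by
        refine Subtype.ext (Subtype.ext (Prod.ext ?_ rfl))
        exact div_mul_cancel₀ _ (hne _)
      right_inv y := by
        refine Prod.ext rfl (Subtype.ext ?_)
        exact mul_div_cancel_right₀ _ (hne _)
      continuous_toFun := by
        have hc' : Continuous fun z : (fun z : rootCover P m g => z.1.2) ⁻¹' S =>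
            (⟨z.1.1.2, z.2⟩ : S) := by fun_prop
        exact hc'.prodMk (Continuous.subtype_mk (Continuous.div (by fun_prop) (hc.comp hc')
          fun z => hne _) _)
      continuous_invFun := by
        refine Continuous.subtype_mk (Continuous.subtype_mk (Continuous.prodMk ?_ ?_) _) _
        · exact (continuous_subtype_val.comp continuous_snd).mul (hc.comp continuous_fst)
        · fun_prop }
  have := hasChi_prod_finite (ι := R) hasChi_plane
  rw [hcard, mul_one] at this
  exact this.homeomorph (E.trans (e.prodCongr (Homeomorph.refl R)))

theorem hasChi_rootCover (hm : m ≠ 0) (hg : ContinuousOn g (P : Set ℂ)ᶜ)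
    (h0 : ∀ t ∉ P, g t ≠ 0) : HasChi (rootCover P m g) (m * (1 - P.card)) := by
  have := locallyCompactSpace_rootCover (m := m) hg
  exact (cellCover_rootCover hm hg h0).hasChi_univ

theorem hasChi_compl_zero : HasChi ({0}ᶜ : Set ℂ) 0 := by
  have h : CellCover (fun z : ({0}ᶜ : Set ℂ) => (z : ℂ)) {0} 1 := by
    refine ⟨continuous_subtype_val, fun z hz => z.2 (by simpa using hz), fun S hS ⟨e⟩ hSP => ?_⟩
    refine hasChi_plane.homeomorph (Homeomorph.trans ?_ e)
    exact
      { toFun z := ⟨z.1, z.2⟩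
        invFun z := ⟨⟨z.1, by simpa using hSP z z.2⟩, z.2⟩
        left_inv _ := rfl
        right_inv _ := rfl
        continuous_toFun := by fun_prop
        continuous_invFun := by fun_prop }
  have := isClosed_singleton (x := (0 : ℂ)) |>.isOpen_compl.locallyCompactSpace
  simpa using h.hasChi_univ

end RootCover

/-! ### Curves in the torus -/

/-- A homeomorphism of subsets, from mutually inverse maps. -/
def homeomorphOfInvOn {A B : Type*} [TopologicalSpace A] [TopologicalSpace B] {S : Set A}
    {T : Set B} (F : A → B) (G : B → A) (hF : ContinuousOn F S) (hG : ContinuousOn G T)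
    (hFm : Set.MapsTo F S T) (hGm : Set.MapsTo G T S) (hGF : ∀ x ∈ S, G (F x) = x)
    (hFG : ∀ y ∈ T, F (G y) = y) : S ≃ₜ T where
  toFun := hFm.restrict
  invFun := hGm.restrict
  left_inv x := Subtype.ext (hGF x x.2)
  right_inv y := Subtype.ext (hFG y y.2)
  continuous_toFun := hF.mapsToRestrict hFm
  continuous_invFun := hG.mapsToRestrict hGm

/-- The monomial map of the torus with the exponents `(k, l)` and `(k', l')`. -/
noncomputable def monomialMap (k l k' l' : ℤ) (z : ℂ × ℂ) : ℂ × ℂ :=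
  (z.1 ^ k * z.2 ^ l, z.1 ^ k' * z.2 ^ l')

theorem continuousOn_monomialMap (k l k' l' : ℤ) {S : Set (ℂ × ℂ)}
    (hS : ∀ z ∈ S, z.1 ≠ 0 ∧ z.2 ≠ 0) : ContinuousOn (monomialMap k l k' l') S := by
  have h1 : ∀ n : ℤ, ContinuousOn (fun z : ℂ × ℂ => z.1 ^ n) S := fun n =>
    continuousOn_fst.zpow₀ n fun z hz => Or.inl (hS z hz).1
  have h2 : ∀ n : ℤ, ContinuousOn (fun z : ℂ × ℂ => z.2 ^ n) S := fun n =>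
    continuousOn_snd.zpow₀ n fun z hz => Or.inl (hS z hz).2
  exact ((h1 k).mul (h2 l)).prodMk ((h1 k').mul (h2 l'))

theorem zpow_mul_zpow_zpow {x y : ℂ} (hx : x ≠ 0) (hy : y ≠ 0) (k l k' l' a b : ℤ) :
    (x ^ k * y ^ l) ^ a * (x ^ k' * y ^ l') ^ b = x ^ (k * a + k' * b) * y ^ (l * a + l' * b) := by
  rw [mul_zpow, mul_zpow, ← zpow_mul, ← zpow_mul, ← zpow_mul, ← zpow_mul, zpow_add₀ hx,
    zpow_add₀ hy]
  ring

/-- The coordinate change of the torus which takes `x ^ e₁ y ^ e₂` to the second coordinate. -/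
theorem nonempty_homeomorph_monomial {e₁ e₂ u v : ℤ} (h : u * e₁ + v * e₂ = 1)
    {S T : Set (ℂ × ℂ)} (hS : ∀ z ∈ S, z.1 ≠ 0 ∧ z.2 ≠ 0) (hT : ∀ z ∈ T, z.1 ≠ 0 ∧ z.2 ≠ 0)
    (hST : ∀ s t : ℂ, s ≠ 0 → t ≠ 0 → ((s, t) ∈ T ↔
      (s ^ (-e₂) * t ^ u, s ^ e₁ * t ^ v) ∈ S)) : Nonempty (S ≃ₜ T) := by
  -- The exponent matrices with rows (-v, u), (e₁, e₂) and (-e₂, u), (e₁, v) are inverse to each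
  -- other; their determinant is -(u e₁ + v e₂) = -1.
  have hGF : ∀ z : ℂ × ℂ, z.1 ≠ 0 → z.2 ≠ 0 →
      monomialMap (-e₂) u e₁ v (monomialMap (-v) u e₁ e₂ z) = z := by
    rintro ⟨x, y⟩ hx hy
    simp only [monomialMap]
    rw [zpow_mul_zpow_zpow hx hy, zpow_mul_zpow_zpow hx hy,
      show -v * -e₂ + e₁ * u = 1 by linarith, show u * -e₂ + e₂ * u = 0 by ring,
      show -v * e₁ + e₁ * v = 0 by ring, show u * e₁ + e₂ * v = 1 by linarith]
    simp
  have hFG : ∀ z : ℂ × ℂ, z.1 ≠ 0 → z.2 ≠ 0 →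
      monomialMap (-v) u e₁ e₂ (monomialMap (-e₂) u e₁ v z) = z := by
    rintro ⟨x, y⟩ hx hy
    simp only [monomialMap]
    rw [zpow_mul_zpow_zpow hx hy, zpow_mul_zpow_zpow hx hy,
      show -e₂ * -v + e₁ * u = 1 by linarith, show u * -v + v * u = 0 by ring,
      show -e₂ * e₁ + e₁ * e₂ = 0 by ring, show u * e₁ + v * e₂ = 1 by linarith]
    simp
  have hne : ∀ (k l k' l' : ℤ) (z : ℂ × ℂ), z.1 ≠ 0 → z.2 ≠ 0 →
      (monomialMap k l k' l' z).1 ≠ 0 ∧ (monomialMap k l k' l' z).2 ≠ 0 :=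
    fun k l k' l' z h1 h2 => ⟨mul_ne_zero (zpow_ne_zero _ h1) (zpow_ne_zero _ h2),
      mul_ne_zero (zpow_ne_zero _ h1) (zpow_ne_zero _ h2)⟩
  refine ⟨homeomorphOfInvOn (monomialMap (-v) u e₁ e₂) (monomialMap (-e₂) u e₁ v)
    (continuousOn_monomialMap _ _ _ _ hS) (continuousOn_monomialMap _ _ _ _ hT)
    (fun z hz => ?_) (fun z hz => ?_) (fun z hz => hGF z (hS z hz).1 (hS z hz).2)
    fun z hz => hFG z (hT z hz).1 (hT z hz).2⟩
  · obtain ⟨h1, h2⟩ := hne (-v) u e₁ e₂ z (hS z hz).1 (hS z hz).2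
    refine (hST _ _ h1 h2).2 ?_
    have := hGF z (hS z hz).1 (hS z hz).2
    rw [monomialMap] at this
    rw [this]
    exact hz
  · exact (hST z.1 z.2 (hT z hz).1 (hT z hz).2).1 hz

/-- After clearing the negative power of t these are roots of a polynomial, which is nonzero because
at t = μ₀ only the term -t ^ (-k)⁺ survives, and it does not vanish there. -/
theorem finite_setOf_zpow_mul_prod_eq_one (k : ℤ) {r : ℕ} (hr : 0 < r) (μ : Fin r → ℂ)
    (ν : Fin r → ℕ) (hμ : ∀ i, μ i ≠ 0) (hν : ∀ i, 0 < ν i) :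
    {t : ℂ | t ≠ 0 ∧ t ^ k * ∏ i, (t - μ i) ^ ν i = 1}.Finite := by
  let Q : Polynomial ℂ := Polynomial.X ^ k.toNat *
    ∏ i, (Polynomial.X - Polynomial.C (μ i)) ^ ν i - Polynomial.X ^ (-k).toNat
  have heval : ∀ t, Q.eval t = t ^ k.toNat * ∏ i, (t - μ i) ^ ν i - t ^ (-k).toNat := fun t => by
    simp [Q, Polynomial.eval_prod]
  have hQ : Q ≠ 0 := fun h => by
    have h1 := heval (μ ⟨0, hr⟩)
    rw [Finset.prod_eq_zero (Finset.mem_univ ⟨0, hr⟩)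
      (by rw [sub_self, zero_pow (hν _).ne']), h] at h1
    simp at h1
    exact hμ _ h1.1
  refine (Q.roots.toFinset.finite_toSet).subset fun t ht => ?_
  obtain ⟨ht0, ht⟩ := ht
  rw [Finset.mem_coe, Multiset.mem_toFinset, Polynomial.mem_roots hQ, Polynomial.IsRoot, heval]
  have e : (t : ℂ) ^ k.toNat = t ^ k * t ^ (-k).toNat := by
    rw [← zpow_natCast, ← zpow_natCast, ← zpow_add₀ ht0]
    congr 1
    omega
  rw [e, mul_right_comm, ht, one_mul, sub_self]

/-- With t = x^{e₁} y^{e₂} and a complementary coordinate s, the equation reads s^M G(t) = 1, where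
M = e₁ b - e₂ a and G(t) = t^k ∏ (t - μᵢ)^{νᵢ}. If M ≠ 0, this is a root cover of degree |M| over
the complement of the r + 1 points 0, μᵢ. If M = 0, it is ℂ^* times the finite set G = 1. -/
theorem hasChi_torus_curve (a b : ℤ) {e₁ e₂ : ℤ} (he : IsCoprime e₁ e₂) {r : ℕ} (hr : 0 < r)
    {μ : Fin r → ℂ} {ν : Fin r → ℕ} (hinj : Function.Injective μ) (hμ : ∀ i, μ i ≠ 0)
    (hν : ∀ i, 0 < ν i) :
    HasChi {z : ℂ × ℂ | z.1 ≠ 0 ∧ z.2 ≠ 0 ∧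
      z.1 ^ a * z.2 ^ b * ∏ i, (z.1 ^ e₁ * z.2 ^ e₂ - μ i) ^ ν i = 1}
      (-(|e₁ * b - e₂ * a| * r)) := by
  classical
  obtain ⟨u, v, huv⟩ := he
  set M := e₁ * b - e₂ * a with hM
  set k := u * a + v * b with hk
  set G : ℂ → ℂ := fun t => t ^ k * ∏ i, (t - μ i) ^ ν i with hG
  set S : Set (ℂ × ℂ) := {z | z.1 ≠ 0 ∧ z.2 ≠ 0 ∧
    z.1 ^ a * z.2 ^ b * ∏ i, (z.1 ^ e₁ * z.2 ^ e₂ - μ i) ^ ν i = 1}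
  have hS : ∀ z ∈ S, z.1 ≠ 0 ∧ z.2 ≠ 0 := fun z hz => ⟨hz.1, hz.2.1⟩
  have hcoord : ∀ s t : ℂ, s ≠ 0 → t ≠ 0 →
      ((s ^ (-e₂) * t ^ u, s ^ e₁ * t ^ v) ∈ S ↔ s ^ M * G t = 1) := fun s t hs ht => by
    have h1 := mul_ne_zero (zpow_ne_zero (-e₂) hs) (zpow_ne_zero u ht)
    have h2 := mul_ne_zero (zpow_ne_zero e₁ hs) (zpow_ne_zero v ht)
    simp only [S, Set.mem_ofPred_eq]
    rw [zpow_mul_zpow_zpow hs ht, zpow_mul_zpow_zpow hs ht,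
      show -e₂ * e₁ + e₁ * e₂ = 0 by ring, huv, zpow_zero, one_mul, zpow_one,
      show -e₂ * a + e₁ * b = M by rw [hM]; ring, ← hk, mul_assoc]
    exact ⟨fun h => h.2.2, fun h => ⟨h1, h2, h⟩⟩
  have hGcont : ContinuousOn G {0}ᶜ := by
    refine ContinuousOn.mul (continuousOn_id.zpow₀ k fun t ht => Or.inl ht) ?_
    exact Continuous.continuousOn (by fun_prop)
  by_cases hM0 : M = 0
  · rw [hM0, abs_zero, zero_mul, neg_zero]
    have hfin := finite_setOf_zpow_mul_prod_eq_one k hr μ ν hμ hν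
    set T : Set ℂ := {t : ℂ | t ≠ 0 ∧ t ^ k * ∏ i, (t - μ i) ^ ν i = 1}
    have : Fintype T := hfin.fintype
    have : Finite T := hfin
    have hLC := isClosed_singleton (x := (0 : ℂ)) |>.isOpen_compl.locallyCompactSpace
    have hchi := hasChi_prod_finite (ι := T) hasChi_compl_zero
    rw [mul_zero] at hchi
    obtain ⟨e⟩ := nonempty_homeomorph_monomial huv (T := ({0}ᶜ : Set ℂ) ×ˢ T)
      hS (fun z hz => ⟨hz.1, hz.2.1⟩) fun s t hs ht => by
        rw [hcoord s t hs ht, hM0, zpow_zero, one_mul]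
        exact ⟨fun h => h.2.2, fun h => ⟨hs, ht, h⟩⟩
    exact hchi.homeomorph (e.trans (Homeomorph.Set.prod _ _))
  · set P : Finset ℂ := insert 0 (Finset.univ.image μ)
    have hP0 : ∀ t ∉ P, t ≠ 0 := fun t ht e => ht (by simp [P, e])
    have hPμ : ∀ t ∉ P, ∀ i, t - μ i ≠ 0 := fun t ht i e => ht (by
      rw [sub_eq_zero] at e
      simp [P, e])
    have hcard : P.card = r + 1 := by
      rw [Finset.card_insert_of_notMem, Finset.card_image_of_injective _ hinj, Finset.card_univ,
        Fintype.card_fin]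
      simpa using hμ
    have hG0 : ∀ t ∉ P, G t ≠ 0 := fun t ht => mul_ne_zero (zpow_ne_zero _ (hP0 t ht))
      (Finset.prod_ne_zero_iff.2 fun i _ => pow_ne_zero _ (hPμ t ht i))
    have hGP : ∀ t, t ≠ 0 → G t ≠ 0 → t ∉ P := fun t ht hGt htP => by
      rcases Finset.mem_insert.1 htP with h | h
      · exact ht h
      · obtain ⟨i, -, rfl⟩ := Finset.mem_image.1 h
        refine hGt (mul_eq_zero_of_right _ (Finset.prod_eq_zero (Finset.mem_univ i) ?_))
        rw [sub_self, zero_pow (hν i).ne']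
    have hN : M.natAbs ≠ 0 := Int.natAbs_ne_zero.2 hM0
    have hGc : ContinuousOn G (P : Set ℂ)ᶜ := hGcont.mono fun t ht => hP0 t ht
    -- For M < 0 the equation is s^{|M|} = G, for M > 0 it is s^{|M|} = 1 / G.
    obtain ⟨g, hgc, hg0, hgM⟩ : ∃ g : ℂ → ℂ, ContinuousOn g (P : Set ℂ)ᶜ ∧ (∀ t ∉ P, g t ≠ 0) ∧
        ∀ s t, s ≠ 0 → t ∉ P → (s ^ M.natAbs = g t ↔ s ^ M * G t = 1) := by
      rcases lt_or_gt_of_ne hM0 with h | h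
      · refine ⟨G, hGc, hG0, fun s t hs ht => ?_⟩
        have e : s ^ M = (s ^ M.natAbs)⁻¹ := by
          rw [← zpow_natCast, ← zpow_neg]
          congr 1
          omega
        rw [e, inv_mul_eq_one₀ (pow_ne_zero _ hs)]
      · refine ⟨fun t => (G t)⁻¹, hGc.inv₀ hG0, fun t ht => inv_ne_zero (hG0 t ht),
          fun s t hs ht => ?_⟩
        have e : s ^ M = s ^ M.natAbs := by
          rw [← zpow_natCast]
          congr 1
          omega
        rw [e]
        exact (mul_eq_one_iff_eq_inv₀ (hG0 t ht)).symm
    have hsne : ∀ z ∈ rootCover P M.natAbs g, z.1 ≠ 0 ∧ z.2 ≠ 0 := fun z hz =>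
      ⟨fun e => hg0 z.2 hz.1 (by rw [← hz.2, e, zero_pow hN]), hP0 _ hz.1⟩
    obtain ⟨e⟩ := nonempty_homeomorph_monomial huv (T := rootCover P M.natAbs g)
      hS hsne fun s t hs ht => by
        rw [hcoord s t hs ht]
        constructor
        · exact fun h => (hgM s t hs h.1).1 h.2
        · intro h
          have htP : t ∉ P := hGP t ht (right_ne_zero_of_mul (h ▸ one_ne_zero))
          exact ⟨htP, (hgM s t hs htP).2 h⟩
    have := locallyCompactSpace_rootCover (m := M.natAbs) hgc
    have hchi := hasChi_rootCover hN hgc hg0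
    rw [hcard] at hchi
    have hval : (M.natAbs : ℤ) * (1 - ((r + 1 : ℕ) : ℤ)) = -(|M| * r) := by
      rw [Int.natCast_natAbs]
      push_cast
      ring
    rw [hval] at hchi
    exact hchi.homeomorph e

/-- The curve y^b = x^{-a} is a root cover of degree b of the once punctured x-line, so χ_c = b (1 -
1). The exponents need not be coprime. -/
theorem hasChi_torus_monomial {a : ℤ} {b : ℕ} (hb : b ≠ 0) :
    HasChi {z : ℂ × ℂ | z.1 ≠ 0 ∧ z.2 ≠ 0 ∧ z.1 ^ a * z.2 ^ b = 1} 0 := by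
  have hg : ContinuousOn (fun t : ℂ => t ^ (-a)) (({0} : Finset ℂ) : Set ℂ)ᶜ :=
    continuousOn_id.zpow₀ _ fun t ht => Or.inl (by simpa using ht)
  have h0 : ∀ t ∉ ({0} : Finset ℂ), t ^ (-a) ≠ 0 := fun t ht =>
    zpow_ne_zero _ (by simpa using ht)
  have := locallyCompactSpace_rootCover (m := b) hg
  have hchi := hasChi_rootCover hb hg h0
  rw [Finset.card_singleton, Nat.cast_one, sub_self, mul_zero] at hchi
  refine hchi.homeomorph ((Homeomorph.prodComm ℂ ℂ).sets ?_)
  ext ⟨x, y⟩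
  simp only [rootCover, Set.mem_preimage, Homeomorph.coe_prodComm, Prod.swap_prod_mk,
    Finset.mem_singleton, Set.mem_ofPred_eq]
  constructor
  · rintro ⟨hx, hy, h⟩
    exact ⟨hx, by rw [zpow_neg]; exact eq_inv_of_mul_eq_one_right h⟩
  · rintro ⟨hx, h⟩
    refine ⟨hx, fun e => zpow_ne_zero (-a) hx ?_, ?_⟩
    · rw [← h, e, zero_pow hb]
    · rw [h, ← zpow_add₀ hx, add_neg_cancel, zpow_zero]

end CompactSupp

namespace NewtonPolygon

/-! ### Evaluation and coefficients -/

/-- Evaluation at a point with `x ≠ 0`, as a ring homomorphism. -/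
noncomputable def evalHom (x : ℂ) (hx : x ≠ 0) (y : ℂ) : LaurentPoly →ₐ[ℂ] ℂ :=
  AddMonoidAlgebra.lift ℂ ℂ (ℤ × ℕ)
    { toFun m := x ^ (Multiplicative.toAdd m).1 * y ^ (Multiplicative.toAdd m).2
      map_one' := by simp
      map_mul' m m' := by
        simp only [toAdd_mul, Prod.fst_add, Prod.snd_add, zpow_add₀ hx, pow_add]
        ring }

theorem eval_eq_evalHom (f : LaurentPoly) {x : ℂ} (hx : x ≠ 0) (y : ℂ) :
    eval f x y = evalHom x hx y f := by
  rw [evalHom, AddMonoidAlgebra.lift_apply, Finsupp.sum, eval]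
  refine Finset.sum_congr rfl fun m _ => ?_
  rw [smul_eq_mul, mul_assoc]
  rfl

theorem evalHom_term {x : ℂ} (hx : x ≠ 0) (y c : ℂ) (a : ℤ) (b : ℕ) :
    evalHom x hx y (term c a b) = c * (x ^ a * y ^ b) := by
  rw [term, evalHom, AddMonoidAlgebra.lift_single]
  rfl

/-- Computed from the definition and not through `evalHom`, because the affine fibre needs it at x =
0 as well. -/
theorem eval_term (a : ℤ) (b : ℕ) (x y : ℂ) : eval (term 1 a b) x y = x ^ a * y ^ b := by
  have h : eval (term 1 a b) x y =
      (Finsupp.single (a, b) (1 : ℂ)).sum fun m c => c * x ^ m.1 * y ^ m.2 := rfl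
  rw [h, Finsupp.sum_single_index (by simp), one_mul]

/-! ### Expansion and support of the two families -/

/-- The polynomial `∏ (X - μ_i) ^ ν_i`. -/
noncomputable def rootPoly {r : ℕ} (μ : Fin r → ℂ) (ν : Fin r → ℕ) : Polynomial ℂ :=
  ∏ i, (Polynomial.X - Polynomial.C (μ i)) ^ ν i

theorem rootPoly_monic {r : ℕ} (μ : Fin r → ℂ) (ν : Fin r → ℕ) : (rootPoly μ ν).Monic :=
  Polynomial.monic_prod_of_monic _ _ fun _ _ => (Polynomial.monic_X_sub_C _).pow _

theorem rootPoly_natDegree {r : ℕ} (μ : Fin r → ℂ) (ν : Fin r → ℕ) :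
    (rootPoly μ ν).natDegree = ∑ i, ν i := by
  rw [rootPoly, Polynomial.natDegree_prod_of_monic _ _ fun _ _ => (Polynomial.monic_X_sub_C _).pow _]
  simp

theorem rootPoly_coeff_zero {r : ℕ} {μ : Fin r → ℂ} {ν : Fin r → ℕ} (hμ : ∀ i, μ i ≠ 0) :
    (rootPoly μ ν).coeff 0 ≠ 0 := by
  rw [Polynomial.coeff_zero_eq_eval_zero, rootPoly, Polynomial.eval_prod,
    Finset.prod_ne_zero_iff]
  intro i _
  simp [hμ i]

/-- The binary form with the roots μᵢ. Substituting x^q y^k and y^l for its variables gives the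
product in both families, so their coefficients are those of the one polynomial `rootPoly`. -/
theorem homogenize_rootPoly {r : ℕ} (μ : Fin r → ℂ) (ν : Fin r → ℕ) :
    (rootPoly μ ν).homogenize (∑ i, ν i) =
      ∏ i, (MvPolynomial.X 0 - MvPolynomial.C (μ i) * MvPolynomial.X 1) ^ ν i := by
  refine Polynomial.homogenize_eq_of_isHomogeneous ?_ ?_
  · refine MvPolynomial.IsHomogeneous.prod _ _ _ fun i _ => ?_
    have h : (MvPolynomial.X 0 - MvPolynomial.C (μ i) * MvPolynomial.X 1 :
        MvPolynomial (Fin 2) ℂ).IsHomogeneous 1 :=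
      (MvPolynomial.isHomogeneous_X _ _).sub (by
        simpa using (MvPolynomial.isHomogeneous_C (Fin 2) (μ i)).mul
          (MvPolynomial.isHomogeneous_X ℂ 1))
    simpa using h.pow (ν i)
  · simp [rootPoly]

theorem term_mul_term (c c' : ℂ) (a a' : ℤ) (b b' : ℕ) :
    term c a b * term c' a' b' = term (c * c') (a + a') (b + b') := by
  rw [term, term, AddMonoidAlgebra.single_mul_single]
  rfl

theorem term_pow (a : ℤ) (b k : ℕ) : term 1 a b ^ k = term 1 (k * a) (k * b) := by
  rw [term, AddMonoidAlgebra.single_pow, one_pow, term]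
  simp

theorem smul_term (c c' : ℂ) (a : ℤ) (b : ℕ) : c • term c' a b = term (c * c') a b := by
  rw [term, AddMonoidAlgebra.smul_single]
  rfl

/-- The expansion of `x ^ a y ^ b ∏ (x ^ q y ^ k - μ_i y ^ l) ^ ν_i`. -/
theorem term_mul_prod_eq_sum (a : ℤ) (b q k l : ℕ) {r : ℕ} (μ : Fin r → ℂ) (ν : Fin r → ℕ) :
    term 1 a b * ∏ i, (term 1 (q : ℤ) k - term (μ i) 0 l) ^ ν i =
      ∑ j ∈ Finset.HasAntidiagonal.antidiagonal (∑ i, ν i),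
        term ((rootPoly μ ν).coeff j.1) (a + j.1 * q) (b + (j.1 * k + j.2 * l)) := by
  have h : ∏ i, (term 1 (q : ℤ) k - term (μ i) 0 l) ^ ν i =
      MvPolynomial.aeval ![term 1 (q : ℤ) k, term 1 0 l]
        ((rootPoly μ ν).homogenize (∑ i, ν i)) := by
    rw [homogenize_rootPoly, map_prod]
    refine Finset.prod_congr rfl fun i _ => ?_
    simp only [map_pow, map_sub, map_mul, MvPolynomial.aeval_X, MvPolynomial.aeval_C,
      Matrix.cons_val_zero, Matrix.cons_val_one]
    rw [← Algebra.smul_def, smul_term, mul_one]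
  rw [h, Polynomial.homogenize, map_sum, Finset.mul_sum]
  refine Finset.sum_congr rfl fun j _ => ?_
  rw [MvPolynomial.aeval_monomial, Finsupp.prod_fintype _ _ (by simp), Fin.prod_univ_two]
  simp only [Matrix.cons_val_zero, Matrix.cons_val_one, ← Algebra.smul_def, Finsupp.coe_update,
    mul_smul_comm]
  simp only [Function.update_self, Function.update_of_ne zero_ne_one, Finsupp.single_eq_same,
    term_pow, term_mul_term, smul_term]
  simp

/-- The polynomial `f` is supported on a segment from `v` in the primitive direction `e`, of
lattice length `∑ ν_i`, and has there the roots `μ_i` with multiplicities `ν_i`. -/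
structure IsEdgePoly (f : LaurentPoly) (v e : ℤ × ℤ) {r : ℕ} (μ : Fin r → ℂ) (ν : Fin r → ℕ) :
    Prop where
  coprime : IsCoprime e.1 e.2
  fst_pos : 0 < e.1
  length_pos : 0 < ∑ i, ν i
  eval_eq : ∀ x y : ℂ, x ≠ 0 → y ≠ 0 →
    eval f x y = x ^ v.1 * y ^ v.2 * ∏ i, (x ^ e.1 * y ^ e.2 - μ i) ^ ν i
  left_mem : v ∈ supp f
  right_mem : v + (∑ i, ν i) • e ∈ supp f
  exists_of_mem : ∀ u ∈ supp f, ∃ j ≤ ∑ i, ν i, u = v + j • e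

theorem coeff_term_mul_prod (a : ℤ) (b q k l : ℕ) (hq : 0 < q) {r : ℕ} (μ : Fin r → ℂ)
    (ν : Fin r → ℕ) (j j' : ℕ) (hj : j + j' = ∑ i, ν i) :
    (term 1 a b * ∏ i, (term 1 (q : ℤ) k - term (μ i) 0 l) ^ ν i).coeff
      (a + j * q, b + (j * k + j' * l)) = (rootPoly μ ν).coeff j := by
  rw [term_mul_prod_eq_sum, AddMonoidAlgebra.coeff_sum, Finsupp.finsetSum_apply,
    Finset.sum_eq_single (j, j')]
  · simp [term]
  · rintro ⟨i, i'⟩ hi hne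
    rw [Finset.HasAntidiagonal.mem_antidiagonal] at hi
    simp only [term, AddMonoidAlgebra.coeff_single]
    refine Finsupp.single_eq_of_ne fun e => hne ?_
    have h1 : (j : ℤ) * q = i * q := by simpa using congrArg Prod.fst e
    have h2 : j = i := by
      have := mul_right_cancel₀ (Nat.cast_ne_zero.2 hq.ne') h1
      exact_mod_cast this
    subst h2
    ext
    · rfl
    · simp only at hi ⊢
      omega
  · intro h
    exact (h (Finset.HasAntidiagonal.mem_antidiagonal.2 hj)).elim

theorem exists_of_mem_support (a : ℤ) (b q k l : ℕ) {r : ℕ} (μ : Fin r → ℂ) (ν : Fin r → ℕ)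
    {m : ℤ × ℕ}
    (hm : m ∈ (term 1 a b * ∏ i, (term 1 (q : ℤ) k - term (μ i) 0 l) ^ ν i).coeff.support) :
    ∃ j j' : ℕ, j + j' = ∑ i, ν i ∧ m = (a + j * q, b + (j * k + j' * l)) := by
  by_contra! hcon
  refine Finsupp.mem_support_iff.1 hm ?_
  rw [term_mul_prod_eq_sum, AddMonoidAlgebra.coeff_sum, Finsupp.finsetSum_apply]
  refine Finset.sum_eq_zero fun j hj => ?_
  simp only [term, AddMonoidAlgebra.coeff_single]
  exact Finsupp.single_eq_of_ne fun e => hcon j.1 j.2 (Finset.HasAntidiagonal.mem_antidiagonal.1 hj) e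

theorem mem_supp_iff {f : LaurentPoly} {u : ℤ × ℤ} :
    u ∈ supp f ↔ ∃ m ∈ f.coeff.support, (m.1, (m.2 : ℤ)) = u := Iff.rfl

/-- The difference form is the case k = 0, l = p and the product form the case k = p, l = 0. On the
torus x^q y^k - μ y^l = y^l (x^q y^{k-l} - μ), which gives the starting point (a, b + l n) and the
direction (q, k - l). Both end points belong to the support since `rootPoly` is monic with nonzero
constant term. -/
theorem isEdgePoly_of_eq {f : LaurentPoly} {a : ℤ} {b q k l r : ℕ} {μ : Fin r → ℂ}
    {ν : Fin r → ℕ} (hf : f = term 1 a b * ∏ i, (term 1 (q : ℤ) k - term (μ i) 0 l) ^ ν i)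
    (hq : 0 < q) (hco : IsCoprime (q : ℤ) ((k : ℤ) - l)) (hr : 0 < r) (hμ : ∀ i, μ i ≠ 0)
    (hν : ∀ i, 0 < ν i) :
    IsEdgePoly f (a, b + l * (∑ i, ν i : ℕ)) ((q : ℤ), (k : ℤ) - l) μ ν where
  coprime := hco
  fst_pos := Nat.cast_pos.2 hq
  length_pos := Finset.sum_pos (fun i _ => hν i) ⟨⟨0, hr⟩, Finset.mem_univ _⟩
  eval_eq x y hx hy := by
    rw [eval_eq_evalHom f hx, hf, map_mul, map_prod]
    simp only [map_pow, map_sub, evalHom_term]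
    have h : ∀ i, (1 * (x ^ (q : ℤ) * y ^ k) - μ i * (x ^ (0 : ℤ) * y ^ l)) ^ ν i =
        (y ^ l) ^ ν i * (x ^ (q : ℤ) * y ^ ((k : ℤ) - l) - μ i) ^ ν i := fun i => by
      rw [← mul_pow]
      congr 1
      rw [zpow_sub₀ hy, zpow_natCast y k, zpow_natCast y l, zpow_zero]
      have := pow_ne_zero l hy
      field_simp
    rw [Finset.prod_congr rfl fun i _ => h i, Finset.prod_mul_distrib, Finset.prod_pow_eq_pow_sum]
    have h2 : y ^ ((b : ℤ) + l * (∑ i, ν i : ℕ)) = y ^ b * (y ^ l) ^ (∑ i, ν i) := by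
      rw [zpow_add₀ hy, zpow_mul, zpow_natCast, zpow_natCast, zpow_natCast]
    simp only [h2]
    ring
  left_mem := by
    refine mem_supp_iff.2 ⟨(a + (0 : ℕ) * q, b + (0 * k + (∑ i, ν i) * l)),
      Finsupp.mem_support_iff.2 ?_, ?_⟩
    · rw [hf, coeff_term_mul_prod a b q k l hq μ ν 0 _ (zero_add _)]
      exact rootPoly_coeff_zero hμ
    · push_cast
      ext <;> simp [mul_comm]
  right_mem := by
    refine mem_supp_iff.2 ⟨(a + (∑ i, ν i : ℕ) * q, b + ((∑ i, ν i) * k + 0 * l)),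
      Finsupp.mem_support_iff.2 ?_, ?_⟩
    · rw [hf, coeff_term_mul_prod a b q k l hq μ ν _ 0 (add_zero _), ← rootPoly_natDegree μ ν,
        (rootPoly_monic μ ν).coeff_natDegree]
      exact one_ne_zero
    · ext
      · simp
      · simp
        ring
  exists_of_mem u hu := by
    obtain ⟨m, hm, rfl⟩ := mem_supp_iff.1 hu
    rw [hf] at hm
    obtain ⟨j, j', hj, rfl⟩ := exists_of_mem_support a b q k l μ ν hm
    refine ⟨j, by omega, ?_⟩
    rw [← hj]
    ext
    · simp
    · simp
      ring

/-! ### The area of a triangle -/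

open CompactSupp in
theorem convexHull_zero_basis :
    convexHull ℝ {0, ((1 : ℝ), (0 : ℝ)), ((0 : ℝ), (1 : ℝ))} = stdTriangle := by
  apply Set.Subset.antisymm
  · refine convexHull_min ?_ convex_stdTriangle
    rintro p (rfl | rfl | rfl) <;> norm_num [stdTriangle]
  · rintro ⟨x, y⟩ ⟨hx, hy, hxy⟩
    simp only at hx hy hxy
    have h := (convex_convexHull ℝ {0, ((1 : ℝ), (0 : ℝ)), ((0 : ℝ), (1 : ℝ))}).sum_mem
      (t := Finset.univ) (w := ![1 - x - y, x, y]) (z := ![0, (1, 0), (0, 1)])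
      (by intro i _; fin_cases i <;> simp <;> linarith)
      (by
        rw [Fin.sum_univ_three]
        simp
        ring)
      (by intro i _; fin_cases i <;> exact subset_convexHull ℝ _ (by simp))
    simpa [Fin.sum_univ_three] using h

open CompactSupp MeasureTheory in
theorem volume_stdTriangle : volume.real stdTriangle = 1 / 2 := by
  have hsec : ∀ x : ℝ, volume (Prod.mk x ⁻¹' stdTriangle) =
      (Set.Icc (0 : ℝ) 1).indicator (fun x => ENNReal.ofReal (1 - x)) x := fun x => by
    by_cases hx : x ∈ Set.Icc (0 : ℝ) 1
    · have : Prod.mk x ⁻¹' stdTriangle = Set.Icc 0 (1 - x) := by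
        ext y
        simp only [stdTriangle, Set.mem_preimage, Set.mem_ofPred_eq, Set.mem_Icc, hx.1, true_and]
        constructor <;> rintro ⟨h1, h2⟩ <;> exact ⟨h1, by linarith⟩
      rw [this, Set.indicator_of_mem hx, Real.volume_Icc, sub_zero]
    · have : Prod.mk x ⁻¹' stdTriangle = ∅ := by
        refine Set.eq_empty_of_forall_notMem fun y hy => hx ⟨hy.1, ?_⟩
        have h1 := hy.2.1
        have h2 := hy.2.2
        simp only at h1 h2
        linarith
      rw [this, Set.indicator_of_notMem hx, measure_empty]
  rw [measureReal_def, Measure.volume_eq_prod,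
    Measure.prod_apply isCompact_stdTriangle.measurableSet, lintegral_congr hsec,
    lintegral_indicator measurableSet_Icc, ← ofReal_integral_eq_lintegral_ofReal]
  · rw [integral_Icc_eq_integral_Ioc, ← intervalIntegral.integral_of_le zero_le_one]
    have h : ∫ x in (0 : ℝ)..1, (1 - x) = 1 / 2 := by
      rw [intervalIntegral.integral_sub (by simp) (by simp)]
      norm_num
    rw [h]
    norm_num
  · exact (by fun_prop : Continuous fun x : ℝ => 1 - x).continuousOn.integrableOn_Icc
  · filter_upwards [ae_restrict_mem measurableSet_Icc] with x hx
    simpa using hx.2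

/-- The triangle is the image of the standard one under the linear map with columns `v` and `w`. The
determinant formula for volumes also covers the degenerate case. -/
theorem triangleArea_eq (v w : ℤ × ℤ) :
    triangleArea v w = |((v.1 * w.2 - v.2 * w.1 : ℤ) : ℝ)| / 2 := by
  let A : ℝ × ℝ →ₗ[ℝ] ℝ × ℝ :=
    (LinearMap.fst ℝ ℝ ℝ).smulRight (toPlane v) + (LinearMap.snd ℝ ℝ ℝ).smulRight (toPlane w)
  have hA : convexHull ℝ {0, toPlane v, toPlane w} = A '' CompactSupp.stdTriangle := by
    rw [← convexHull_zero_basis, LinearMap.image_convexHull]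
    simp [Set.image_insert_eq, A]
  have hdet : A.det = v.1 * w.2 - v.2 * w.1 := by
    rw [← LinearMap.det_toMatrix (Module.Basis.finTwoProd ℝ), Matrix.det_fin_two]
    simp [LinearMap.toMatrix_apply, A, toPlane]
    ring
  rw [triangleArea, hA, MeasureTheory.Measure.real, MeasureTheory.Measure.addHaar_image_linearMap,
    ENNReal.toReal_mul, ENNReal.toReal_ofReal (abs_nonneg _), hdet]
  have := volume_stdTriangle
  rw [MeasureTheory.Measure.real] at this
  rw [this]
  push_cast
  ring
/-! ### The contribution of a face -/

theorem toPlane_injective : Function.Injective toPlane := fun u v h => by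
  have h1 := congrArg Prod.fst h
  have h2 := congrArg Prod.snd h
  simp only [toPlane, Int.cast_inj] at h1 h2
  exact Prod.ext h1 h2

theorem toPlane_add_nsmul (v e : ℤ × ℤ) (j : ℕ) :
    toPlane (v + j • e) = toPlane v + (j : ℝ) • toPlane e := by
  ext <;> simp [toPlane]

theorem toPlane_mem_segment {v e : ℤ × ℤ} {j n : ℕ} (hj : j ≤ n) :
    toPlane (v + j • e) ∈ segment ℝ (toPlane v) (toPlane (v + n • e)) := by
  rcases Nat.eq_zero_or_pos n with rfl | hn
  · obtain rfl : j = 0 := by omega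
    simp
  have hn' : (0 : ℝ) < n := Nat.cast_pos.2 hn
  rw [segment_eq_image']
  refine ⟨j / n, ⟨by positivity, (div_le_one hn').2 (Nat.cast_le.2 hj)⟩, ?_⟩
  simp only [toPlane_add_nsmul, add_sub_cancel_left, smul_smul]
  rw [div_mul_cancel₀ _ hn'.ne']

/-- The integer points in the interior of a segment. -/
theorem setOf_toPlane_mem_openSegment {v e : ℤ × ℤ} {n : ℕ} (he : IsCoprime e.1 e.2)
    (hn : 0 < n) :
    {u : ℤ × ℤ | toPlane u ∈ openSegment ℝ (toPlane v) (toPlane (v + n • e))} =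
      (fun j : ℕ => v + j • e) '' Set.Ioo 0 n := by
  have hn' : (0 : ℝ) < n := Nat.cast_pos.2 hn
  ext u
  rw [Set.mem_ofPred_eq, openSegment_eq_image']
  simp only [toPlane_add_nsmul, add_sub_cancel_left, smul_smul]
  constructor
  · rintro ⟨θ, ⟨h0, h1⟩, hu⟩
    obtain ⟨x, y, hxy⟩ := he
    have hu1 : (v.1 : ℝ) + θ * n * e.1 = u.1 := by simpa [toPlane] using congrArg Prod.fst hu
    have hu2 : (v.2 : ℝ) + θ * n * e.2 = u.2 := by simpa [toPlane] using congrArg Prod.snd hu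
    have hxy' : (x : ℝ) * e.1 + y * e.2 = 1 := by exact_mod_cast hxy
    -- A Bézout relation for `e` expresses the parameter θ n by integer coordinates, so it is an
    -- integer.
    obtain ⟨k, hk⟩ : ∃ k : ℤ, (k : ℝ) = θ * n := by
      refine ⟨x * (u.1 - v.1) + y * (u.2 - v.2), ?_⟩
      push_cast
      rw [← hu1, ← hu2]
      linear_combination (θ * n) * hxy'
    have hk0 : 0 < k := by
      have : (0 : ℝ) < k := hk ▸ mul_pos h0 hn'
      exact_mod_cast this
    have hkn : k < n := by
      have : (k : ℝ) < n := by
        rw [hk]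
        nlinarith
      exact_mod_cast this
    lift k to ℕ using hk0.le
    refine ⟨k, ⟨by exact_mod_cast hk0, by exact_mod_cast hkn⟩, toPlane_injective ?_⟩
    simp only [toPlane_add_nsmul, ← hu, ← hk, Int.cast_natCast]
  · rintro ⟨j, ⟨h0, h1⟩, rfl⟩
    refine ⟨j / n, ⟨by positivity, (div_lt_one hn').2 (Nat.cast_lt.2 h1)⟩, ?_⟩
    simp only [div_mul_cancel₀ _ hn'.ne', toPlane_add_nsmul]

theorem interiorPoints_add_one {v e : ℤ × ℤ} {n : ℕ} (he : IsCoprime e.1 e.2) (he0 : 0 < e.1)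
    (hn : 0 < n) : interiorPoints (v, v + n • e) + 1 = n := by
  have hinj : Function.Injective fun j : ℕ => v + j • e := fun i j h => by
    have h1 := congrArg Prod.fst h
    simpa [he0.ne'] using h1
  rw [interiorPoints, setOf_toPlane_mem_openSegment he hn, Set.ncard_image_of_injective _ hinj,
    ← Finset.coe_Ioo, Set.ncard_coe_finset, Nat.card_Ioo]
  omega

theorem direction_add_nsmul {v e : ℤ × ℤ} {n : ℕ} (he : IsCoprime e.1 e.2) (hn : 0 < n) :
    direction (v, v + n • e) = e := by
  have hg : Int.gcd (n * e.1) (n * e.2) = n := by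
    rw [Int.gcd_mul_left, Int.isCoprime_iff_gcd_eq_one.1 he]
    simp
  have hn' : (n : ℤ) ≠ 0 := Nat.cast_ne_zero.2 hn.ne'
  have h1 : (v + n • e).1 - v.1 = n * e.1 := by simp
  have h2 : (v + n • e).2 - v.2 = n * e.2 := by simp
  simp only [direction, h1, h2, hg, Int.mul_ediv_cancel_left _ hn']

theorem faceArea_add_nsmul (v e : ℤ × ℤ) (n : ℕ) :
    faceArea (v, v + n • e) = n * (|((e.1 * v.2 - e.2 * v.1 : ℤ) : ℝ)| / 2) := by
  have h : v.1 * (v + n • e).2 - v.2 * (v + n • e).1 = -(n * (e.1 * v.2 - e.2 * v.1)) := by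
    simp
    ring
  simp only [faceArea]
  rw [h, Int.cast_neg, abs_neg, Int.cast_mul, abs_mul, Int.cast_natCast, Nat.abs_cast, mul_div_assoc]

namespace IsEdgePoly

variable {f : LaurentPoly} {v e : ℤ × ℤ} {r : ℕ} {μ : Fin r → ℂ} {ν : Fin r → ℕ}

theorem facePoly_eq (h : IsEdgePoly f v e μ ν) : facePoly f (v, v + (∑ i, ν i) • e) = f := by
  classical
  rw [facePoly, (Finsupp.filter_eq_self_iff _ _).2 fun m hm => ?_]
  obtain ⟨j, hj, hu⟩ := h.exists_of_mem (m.1, m.2)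
    (mem_supp_iff.2 ⟨m, Finsupp.mem_support_iff.2 hm, rfl⟩)
  rw [hu]
  exact toPlane_mem_segment hj

theorem faceRoots_eq (h : IsEdgePoly f v e μ ν) (hμ : ∀ i, μ i ≠ 0) (hν : ∀ i, 0 < ν i) :
    faceRoots f (v, v + (∑ i, ν i) • e) = Set.range μ := by
  ext m
  rw [faceRoots, h.facePoly_eq, direction_add_nsmul h.coprime h.length_pos, Set.mem_ofPred_eq]
  constructor
  · rintro ⟨hm, H⟩
    obtain ⟨s, t, hst⟩ := h.coprime
    -- Bézout coefficients s, t of `e` give a point (m^s, m^t) on the curve x^{e₁} y^{e₂} = m, at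
    -- which the product must vanish.
    have hm' : (m ^ s) ^ e.1 * (m ^ t) ^ e.2 = m := by
      rw [← zpow_mul, ← zpow_mul, ← zpow_add₀ hm, hst, zpow_one]
    have h0 := H (m ^ s) (m ^ t) (zpow_ne_zero _ hm) (zpow_ne_zero _ hm) hm'
    rw [h.eval_eq _ _ (zpow_ne_zero _ hm) (zpow_ne_zero _ hm), hm', mul_eq_zero,
      or_iff_right (mul_ne_zero (zpow_ne_zero _ (zpow_ne_zero _ hm))
        (zpow_ne_zero _ (zpow_ne_zero _ hm))), Finset.prod_eq_zero_iff] at h0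
    obtain ⟨i, -, hi⟩ := h0
    exact ⟨i, (sub_eq_zero.1 (eq_zero_of_pow_eq_zero hi)).symm⟩
  · rintro ⟨i, rfl⟩
    refine ⟨hμ i, fun x y hx hy hxy => ?_⟩
    rw [h.eval_eq x y hx hy, hxy, Finset.prod_eq_zero (Finset.mem_univ i), mul_zero]
    rw [sub_self, zero_pow (hν i).ne']

/-- The lattice length n cancels: the area of the face is n |det(e, v)| / 2, and s_γ + 1 = n. -/
theorem contribution (h : IsEdgePoly f v e μ ν) (hinj : Function.Injective μ)
    (hμ : ∀ i, μ i ≠ 0) (hν : ∀ i, 0 < ν i) :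
    ((faceRoots f (v, v + (∑ i, ν i) • e)).ncard : ℝ) * faceArea (v, v + (∑ i, ν i) • e) /
      ((interiorPoints (v, v + (∑ i, ν i) • e) : ℝ) + 1) =
      r * |((e.1 * v.2 - e.2 * v.1 : ℤ) : ℝ)| / 2 := by
  have hn : ((∑ i, ν i : ℕ) : ℝ) ≠ 0 := Nat.cast_ne_zero.2 h.length_pos.ne'
  have hi : (interiorPoints (v, v + (∑ i, ν i) • e) : ℝ) + 1 = (∑ i, ν i : ℕ) := by
    exact_mod_cast interiorPoints_add_one h.coprime h.fst_pos h.length_pos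
  have hr : (faceRoots f (v, v + (∑ i, ν i) • e)).ncard = r := by
    rw [h.faceRoots_eq hμ hν, ← Set.image_univ, Set.ncard_image_of_injective _ hinj,
      Set.ncard_univ, Nat.card_eq_fintype_card, Fintype.card_fin]
  rw [hi, hr, faceArea_add_nsmul]
  field_simp

/-- The area with respect to `f` of a polygon which has, besides the segment carrying `f`, only
faces on lines through the origin. -/
theorem areaWrt_eq (h : IsEdgePoly f v e μ ν) (hinj : Function.Injective μ)
    (hμ : ∀ i, μ i ≠ 0) (hν : ∀ i, 0 < ν i) {F : Set ((ℤ × ℤ) × (ℤ × ℤ))}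
    (hF : ∀ γ ∈ F, γ = (v, v + (∑ i, ν i) • e) ∨ faceArea γ = 0)
    (hmem : e.1 * v.2 - e.2 * v.1 ≠ 0 → (v, v + (∑ i, ν i) • e) ∈ F) :
    areaWrt F f = r * |((e.1 * v.2 - e.2 * v.1 : ℤ) : ℝ)| / 2 := by
  rw [areaWrt, ← h.contribution hinj hμ hν]
  -- If the line of the segment passes through the origin, every face has area 0, and it does not
  -- matter whether the segment belongs to `F`.
  by_cases h0 : e.1 * v.2 - e.2 * v.1 = 0
  · have hz : faceArea (v, v + (∑ i, ν i) • e) = 0 := by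
      rw [faceArea_add_nsmul, h0]
      simp
    rw [hz, mul_zero, zero_div]
    refine finsum_mem_of_eqOn_zero fun γ hγ => ?_
    have h' : faceArea γ = 0 := by
      rcases hF γ hγ with rfl | h'
      exacts [hz, h']
    simp [h']
  · rw [← finsum_mem_singleton (a := (v, v + (∑ i, ν i) • e))
      (f := fun γ => ((faceRoots f γ).ncard : ℝ) * faceArea γ / ((interiorPoints γ : ℝ) + 1))]
    refine finsum_mem_inter_support_eq' _ _ _ fun γ hγ => ⟨fun hm => ?_, ?_⟩
    · rcases hF γ hm with h' | h'
      · exact h'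
      · exact (hγ (by simp [h'])).elim
    · rintro rfl
      exact hmem h0

end IsEdgePoly

/-! ### Vertices and faces -/

theorem toPlane_mem_diagram {E : Set (ℤ × ℤ)} {Q : Set (ℝ × ℝ)} {u : ℤ × ℤ} (hu : u ∈ E)
    {q : ℝ × ℝ} (hq : q ∈ Q) : toPlane u + q ∈ diagram E Q :=
  subset_convexHull ℝ _ (Set.add_mem_add ⟨u, hu, rfl⟩ hq)

/-- An extreme point of the hull lies in the generating set, so it is u' + q with u' in `E` and q in
`Q`. It is also the midpoint of u' and u' + 2q, which forces q = 0. -/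
theorem vertices_subset {E : Set (ℤ × ℤ)} {Q : Set (ℝ × ℝ)} (hQ0 : 0 ∈ Q)
    (hQ : ∀ q ∈ Q, q + q ∈ Q) : vertices E Q ⊆ E := by
  intro u hu
  obtain ⟨_, ⟨u', hu', rfl⟩, q, hq, huq⟩ := extremePoints_convexHull_subset hu
  have huq' : toPlane u' + q = toPlane u := huq
  have hseg : toPlane u ∈ segment ℝ (toPlane u' + 0) (toPlane u' + (q + q)) := by
    refine ⟨1 / 2, 1 / 2, by norm_num, by norm_num, by norm_num, ?_⟩
    rw [← huq']
    module
  have h := (mem_extremePoints_iff_forall_segment.1 hu).2 _ (toPlane_mem_diagram hu' hQ0) _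
    (toPlane_mem_diagram hu' (hQ q hq)) hseg
  have hq0 : q = 0 := by
    rcases h with h | h
    · rw [← huq'] at h
      exact (add_left_cancel h).symm
    · rw [← huq'] at h
      simpa using add_left_cancel h
  rw [hq0, add_zero] at huq'
  rwa [← toPlane_injective huq']

/-- The functional (s, t) has a strict minimum at `v` on the generating set. The set consisting of
`v` and of the points with a larger value is convex, so the minimum stays strict on the hull, and
`v` is extreme. -/
theorem mem_vertices {E : Set (ℤ × ℤ)} {Q : Set (ℝ × ℝ)} {v : ℤ × ℤ} (hv : v ∈ E) (hQ0 : 0 ∈ Q)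
    (s t : ℤ) (hE : ∀ u ∈ E, u = v ∨ s * v.1 + t * v.2 < s * u.1 + t * u.2)
    (hQ : ∀ q ∈ Q, q = 0 ∨ 0 < (s : ℝ) * q.1 + t * q.2) : v ∈ vertices E Q := by
  set g : ℝ × ℝ → ℝ := fun z => (s : ℝ) * z.1 + t * z.2 with hg
  have hlin : ∀ (α β : ℝ) (y z : ℝ × ℝ), g (α • y + β • z) = α * g y + β * g z := fun α β y z => by
    simp only [hg, Prod.fst_add, Prod.snd_add, Prod.smul_fst, Prod.smul_snd, smul_eq_mul]
    ring
  have hsub : diagram E Q ⊆ {z | z = toPlane v ∨ g (toPlane v) < g z} := by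
    refine convexHull_min ?_ ?_
    · rintro _ ⟨_, ⟨u, hu, rfl⟩, q, hq, rfl⟩
      have h1 : u = v ∨ g (toPlane v) < g (toPlane u) := by
        refine (hE u hu).imp id fun h => ?_
        simp only [hg, toPlane]
        exact_mod_cast h
      have h2 : g (toPlane u + q) = g (toPlane u) + g q := by
        simpa using hlin 1 1 (toPlane u) q
      change _ ∨ _
      rw [h2]
      rcases h1 with rfl | h1 <;> rcases hQ q hq with rfl | h3
      · simp
      · exact Or.inr (by linarith)
      · exact Or.inr (by simpa [hg] using h1)
      · exact Or.inr (by linarith)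
    · intro y hy z hz α β hα hβ hαβ
      by_cases hα0 : α = 0
      · obtain rfl : β = 1 := by linarith
        simpa [hα0] using hz
      by_cases hβ0 : β = 0
      · obtain rfl : α = 1 := by linarith
        simpa [hβ0] using hy
      have hα' := hα.lt_of_ne' hα0
      have hβ' := hβ.lt_of_ne' hβ0
      have hc : g (toPlane v) = α * g (toPlane v) + β * g (toPlane v) := by
        rw [← add_mul, hαβ, one_mul]
      change _ ∨ _
      rw [hlin]
      rcases hy with rfl | hy <;> rcases hz with rfl | hz
      · left
        rw [← add_smul, hαβ, one_smul]
      · right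
        nlinarith
      · right
        nlinarith
      · right
        nlinarith
  refine mem_extremePoints_iff_forall_segment.2
    ⟨by simpa using toPlane_mem_diagram hv hQ0, fun y hy z hz hseg => ?_⟩
  rcases hsub hy with h | hy'
  · exact Or.inl h
  rcases hsub hz with h | hz'
  · exact Or.inr h
  obtain ⟨α, β, hα, hβ, hαβ, h⟩ := hseg
  have h1 := hlin α β y z
  rw [h] at h1
  exfalso
  obtain rfl : β = 1 - α := by linarith
  rcases hα.eq_or_lt with rfl | hα'
  · nlinarith
  · nlinarith

theorem eq_zero_or_pos_of_nonneg {s t x y : ℝ} (hs : s ≠ 0) (ht : t ≠ 0) (h1 : 0 ≤ s * x)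
    (h2 : 0 ≤ t * y) : (x, y) = 0 ∨ 0 < s * x + t * y := by
  rcases h1.eq_or_lt with h1 | h1
  · rcases h2.eq_or_lt with h2 | h2
    · left
      have hx : x = 0 := by simpa [hs] using h1.symm
      have hy : y = 0 := by simpa [ht] using h2.symm
      rw [hx, hy]
      rfl
    · right
      linarith
  · right
    linarith

theorem add_self_mem_Ici {x : ℝ} (hx : x ∈ Set.Ici 0) : x + x ∈ Set.Ici 0 :=
  add_nonneg (Set.mem_Ici.1 hx) (Set.mem_Ici.1 hx)

theorem add_self_mem_Iic {x : ℝ} (hx : x ∈ Set.Iic 0) : x + x ∈ Set.Iic 0 :=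
  add_nonpos (Set.mem_Iic.1 hx) (Set.mem_Iic.1 hx)

theorem add_nsmul_fst (v e : ℤ × ℤ) (n : ℕ) : (v + n • e).1 = v.1 + n * e.1 := by simp

theorem add_nsmul_snd (v e : ℤ × ℤ) (n : ℕ) : (v + n • e).2 = v.2 + n * e.2 := by simp

namespace IsEdgePoly

variable {f : LaurentPoly} {v e : ℤ × ℤ} {r : ℕ} {μ : Fin r → ℂ} {ν : Fin r → ℕ}

/-- Any other point of the support lies between the two end points, both of which belong to the
diagram. -/
theorem eq_or_eq_of_mem_vertices (h : IsEdgePoly f v e μ ν) {E : Set (ℤ × ℤ)} {Q : Set (ℝ × ℝ)}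
    (hE : supp f ⊆ E) (hQ0 : 0 ∈ Q) {u : ℤ × ℤ} (hu : u ∈ supp f) (hv : u ∈ vertices E Q) :
    u = v ∨ u = v + (∑ i, ν i) • e := by
  obtain ⟨j, hj, rfl⟩ := h.exists_of_mem u hu
  have h1 := toPlane_mem_diagram (hE h.left_mem) hQ0
  have h2 := toPlane_mem_diagram (hE h.right_mem) hQ0
  rw [add_zero] at h1 h2
  rcases (mem_extremePoints_iff_forall_segment.1 hv).2 _ h1 _ h2 (toPlane_mem_segment hj) with h' | h'
  · exact Or.inl (toPlane_injective h').symm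
  · exact Or.inr (toPlane_injective h').symm

/-- A functional that increases along the edge has its minimum over the support at `v`. The
condition `hE'` is there for the origin, which is added to the support in the polygon at infinity.
-/
theorem left_mem_vertices (h : IsEdgePoly f v e μ ν) {E : Set (ℤ × ℤ)} {Q : Set (ℝ × ℝ)}
    (hE : supp f ⊆ E) (hQ0 : 0 ∈ Q) (s t : ℤ) (hpos : 0 < s * e.1 + t * e.2)
    (hE' : ∀ u ∈ E, u ∈ supp f ∨ s * v.1 + t * v.2 < s * u.1 + t * u.2)
    (hQ : ∀ q ∈ Q, q = 0 ∨ 0 < (s : ℝ) * q.1 + t * q.2) : v ∈ vertices E Q := by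
  refine mem_vertices (hE h.left_mem) hQ0 s t (fun u hu => ?_) hQ
  rcases hE' u hu with hu | hu
  · obtain ⟨j, -, rfl⟩ := h.exists_of_mem u hu
    rcases Nat.eq_zero_or_pos j with rfl | hj
    · simp
    · right
      have hj' : (0 : ℤ) < j := Nat.cast_pos.2 hj
      have := mul_pos hj' hpos
      simp only [add_nsmul_fst, add_nsmul_snd]
      linarith
  · exact Or.inr hu

theorem right_mem_vertices (h : IsEdgePoly f v e μ ν) {E : Set (ℤ × ℤ)} {Q : Set (ℝ × ℝ)}
    (hE : supp f ⊆ E) (hQ0 : 0 ∈ Q) (s t : ℤ) (hneg : s * e.1 + t * e.2 < 0)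
    (hE' : ∀ u ∈ E, u ∈ supp f ∨ s * (v + (∑ i, ν i) • e).1 + t * (v + (∑ i, ν i) • e).2 <
      s * u.1 + t * u.2)
    (hQ : ∀ q ∈ Q, q = 0 ∨ 0 < (s : ℝ) * q.1 + t * q.2) :
    v + (∑ i, ν i) • e ∈ vertices E Q := by
  refine mem_vertices (hE h.right_mem) hQ0 s t (fun u hu => ?_) hQ
  rcases hE' u hu with hu | hu
  · obtain ⟨j, hj, rfl⟩ := h.exists_of_mem u hu
    rcases hj.eq_or_lt with rfl | hj
    · simp
    · right
      have hj' : (0 : ℤ) < (∑ i, ν i : ℕ) - j := sub_pos.2 (Nat.cast_lt.2 hj)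
      have := mul_neg_of_pos_of_neg hj' hneg
      simp only [add_nsmul_fst, add_nsmul_snd]
      linarith
  · exact Or.inr hu

theorem fst_lt (h : IsEdgePoly f v e μ ν) : v.1 < (v + (∑ i, ν i) • e).1 := by
  have := mul_pos (Nat.cast_pos (α := ℤ).2 h.length_pos) h.fst_pos
  rw [add_nsmul_fst]
  linarith

/-- A segment with an end point at the origin has determinant 0, and the lexicographic order leaves
a single segment between the two remaining points. -/
theorem eq_or_faceArea_eq_zero (h : IsEdgePoly f v e μ ν) {γ : (ℤ × ℤ) × (ℤ × ℤ)}
    (h1 : γ.1 = 0 ∨ γ.1 = v ∨ γ.1 = v + (∑ i, ν i) • e)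
    (h2 : γ.2 = 0 ∨ γ.2 = v ∨ γ.2 = v + (∑ i, ν i) • e) (hlt : LexLt γ.1 γ.2) :
    γ = (v, v + (∑ i, ν i) • e) ∨ faceArea γ = 0 := by
  have hvw := h.fst_lt
  obtain ⟨γ₁, γ₂⟩ := γ
  simp only at h1 h2 hlt
  rcases h1 with rfl | rfl | rfl
  · right
    simp [faceArea]
  · rcases h2 with rfl | rfl | rfl
    · right
      simp [faceArea]
    · rcases hlt with h' | h' <;> omega
    · exact Or.inl rfl
  · rcases h2 with rfl | rfl | rfl
    · right
      simp [faceArea]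
    · rcases hlt with h' | h' <;> omega
    · rcases hlt with h' | h' <;> omega

theorem mem_of_mem_vertices_insert (h : IsEdgePoly f v e μ ν) {Q : Set (ℝ × ℝ)} (hQ0 : 0 ∈ Q)
    (hQ : ∀ q ∈ Q, q + q ∈ Q) {u : ℤ × ℤ} (hu : u ∈ vertices (insert 0 (supp f)) Q) :
    u = 0 ∨ u = v ∨ u = v + (∑ i, ν i) • e :=
  (vertices_subset hQ0 hQ hu).imp id fun hu' =>
    h.eq_or_eq_of_mem_vertices (Set.subset_insert _ _) hQ0 hu' hu

theorem originFaces_subset (h : IsEdgePoly f v e μ ν) :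
    originFaces f ⊆ {(v, v + (∑ i, ν i) • e)} := by
  have hV : ∀ u ∈ originVertices f, u = v ∨ u = v + (∑ i, ν i) • e := fun u hu => by
    have h0 : (0 : ℝ × ℝ) ∈ Set.Ici (0 : ℝ) ×ˢ Set.Ici (0 : ℝ) := ⟨le_refl (0 : ℝ), le_refl (0 : ℝ)⟩
    refine h.eq_or_eq_of_mem_vertices subset_rfl h0 (vertices_subset h0 (fun q hq => ?_) hu) hu
    exact ⟨add_self_mem_Ici hq.1, add_self_mem_Ici hq.2⟩
  have hvw := h.fst_lt
  rintro ⟨γ₁, γ₂⟩ ⟨h1, h2, h12, -⟩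
  simp only at h1 h2 h12
  rcases hV _ h1 with rfl | rfl <;> rcases hV _ h2 with rfl | rfl
  · omega
  · rfl
  · omega
  · omega

theorem eq_or_of_mem_zeroInf (h : IsEdgePoly f v e μ ν) {u : ℤ × ℤ}
    (hu : u ∈ verticesZeroInf f ∪ verticesInfInf f) :
    u = 0 ∨ u = v ∨ u = v + (∑ i, ν i) • e := by
  rcases hu with hu | hu
  · refine h.mem_of_mem_vertices_insert ?_ (fun q hq => ?_) hu
    · exact ⟨le_refl (0 : ℝ), le_refl (0 : ℝ)⟩
    · exact ⟨add_self_mem_Ici hq.1, add_self_mem_Iic hq.2⟩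
  · refine h.mem_of_mem_vertices_insert ?_ (fun q hq => ?_) hu
    · exact ⟨le_refl (0 : ℝ), le_refl (0 : ℝ)⟩
    · exact ⟨add_self_mem_Iic hq.1, add_self_mem_Iic hq.2⟩

theorem eq_or_of_mem_infZero (h : IsEdgePoly f v e μ ν) {u : ℤ × ℤ}
    (hu : u ∈ verticesInfInf f ∪ verticesInfZero f) :
    u = 0 ∨ u = v ∨ u = v + (∑ i, ν i) • e := by
  rcases hu with hu | hu
  · refine h.mem_of_mem_vertices_insert ?_ (fun q hq => ?_) hu
    · exact ⟨le_refl (0 : ℝ), le_refl (0 : ℝ)⟩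
    · exact ⟨add_self_mem_Iic hq.1, add_self_mem_Iic hq.2⟩
  · refine h.mem_of_mem_vertices_insert ?_ (fun q hq => ?_) hu
    · exact ⟨le_refl (0 : ℝ), le_refl (0 : ℝ)⟩
    · exact ⟨add_self_mem_Iic hq.1, add_self_mem_Ici hq.2⟩

theorem eq_or_of_mem_infinityFaces (h : IsEdgePoly f v e μ ν) {γ : (ℤ × ℤ) × (ℤ × ℤ)}
    (hγ : γ ∈ infinityFaces f) : γ = (v, v + (∑ i, ν i) • e) ∨ faceArea γ = 0 := by
  obtain ⟨hlt, hγ | hγ | hγ⟩ := hγ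
  · exact h.eq_or_faceArea_eq_zero (h.eq_or_of_mem_zeroInf hγ.1) (h.eq_or_of_mem_zeroInf hγ.2.1) hlt
  · exact h.eq_or_faceArea_eq_zero (h.eq_or_of_mem_infZero hγ.1) (h.eq_or_of_mem_infZero hγ.2.1) hlt
  · exact h.eq_or_faceArea_eq_zero (h.eq_or_of_mem_infZero hγ.2.1) (h.eq_or_of_mem_infZero hγ.1) hlt

/-- The only other candidate for a vertex between the two is the origin, and its first coordinate is
not larger than that of `v`. -/
theorem mem_infinityFaces_of_fst (h : IsEdgePoly f v e μ ν) (h0 : 0 ≤ v.1)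
    (hv : v ∈ verticesZeroInf f ∪ verticesInfInf f)
    (hw : v + (∑ i, ν i) • e ∈ verticesInfInf f) :
    (v, v + (∑ i, ν i) • e) ∈ infinityFaces f := by
  refine ⟨Or.inl h.fst_lt, Or.inl ⟨hv, Or.inr hw, h.fst_lt, fun u hu hlt => ?_⟩⟩
  simp only at hlt
  rcases h.eq_or_of_mem_zeroInf hu with rfl | rfl | rfl
  · simp only [Prod.fst_zero] at hlt
    omega
  · omega
  · omega

theorem mem_infinityFaces_of_snd (h : IsEdgePoly f v e μ ν) (h0 : 0 ≤ v.2) (he : 0 < e.2)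
    (hv : v ∈ verticesInfZero f) (hw : v + (∑ i, ν i) • e ∈ verticesInfInf f) :
    (v, v + (∑ i, ν i) • e) ∈ infinityFaces f := by
  have hlt : v.2 < (v + (∑ i, ν i) • e).2 := by
    have := mul_pos (Nat.cast_pos (α := ℤ).2 h.length_pos) he
    rw [add_nsmul_snd]
    linarith
  refine ⟨Or.inl h.fst_lt, Or.inr (Or.inl ⟨Or.inr hv, Or.inl hw, hlt, fun u hu hlt => ?_⟩)⟩
  simp only at hlt
  rcases h.eq_or_of_mem_infZero hu with rfl | rfl | rfl
  · simp only [Prod.snd_zero] at hlt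
    omega
  · omega
  · omega

theorem convexHull_supp (h : IsEdgePoly f v e μ ν) :
    convexHull ℝ (toPlane '' supp f) =
      segment ℝ (toPlane v) (toPlane (v + (∑ i, ν i) • e)) := by
  refine Set.Subset.antisymm (convexHull_min ?_ (convex_segment _ _))
    (segment_subset_convexHull ⟨_, h.left_mem, rfl⟩ ⟨_, h.right_mem, rfl⟩)
  rintro _ ⟨u, hu, rfl⟩
  obtain ⟨j, hj, rfl⟩ := h.exists_of_mem u hu
  exact toPlane_mem_segment hj

/-- The hull of the support is the segment [v, w]. A nondegenerate segment inside it contains a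
point of the open segment, namely its own midpoint; being extreme, it then contains `v` and `w`. -/
theorem globalFaces_eq (h : IsEdgePoly f v e μ ν) :
    globalFaces f = {(v, v + (∑ i, ν i) • e)} := by
  refine Set.Subset.antisymm ?_ ?_
  · rintro ⟨γ₁, γ₂⟩ ⟨hlt, hext⟩
    simp only at hlt hext
    rw [h.convexHull_supp] at hext
    set w := v + (∑ i, ν i) • e with hw
    have hvw : (v.1 : ℝ) < w.1 := Int.cast_lt.2 h.fst_lt
    have h1 := hext.subset (left_mem_segment ℝ (toPlane γ₁) (toPlane γ₂))
    have h2 := hext.subset (right_mem_segment ℝ (toPlane γ₁) (toPlane γ₂))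
    rw [segment_eq_image'] at h1 h2
    obtain ⟨θ₁, ⟨h10, h11⟩, hθ₁⟩ := h1
    obtain ⟨θ₂, ⟨h20, h21⟩, hθ₂⟩ := h2
    simp only at hθ₁ hθ₂
    have f1 : (v.1 : ℝ) + θ₁ * (w.1 - v.1) = γ₁.1 := by simpa [toPlane] using congrArg Prod.fst hθ₁
    have f2 : (v.1 : ℝ) + θ₂ * (w.1 - v.1) = γ₂.1 := by simpa [toPlane] using congrArg Prod.fst hθ₂
    have hle : (γ₁.1 : ℝ) ≤ γ₂.1 := by
      rcases hlt with h' | h'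
      · exact_mod_cast h'.le
      · exact_mod_cast h'.1.le
    have hθ : θ₁ < θ₂ := by
      refine lt_of_le_of_ne (by nlinarith) fun heq => ?_
      have : γ₁ = γ₂ := toPlane_injective (by rw [← hθ₁, ← hθ₂, heq])
      rw [this] at hlt
      rcases hlt with h' | h' <;> omega
    have hmid : toPlane v + ((θ₁ + θ₂) / 2) • (toPlane w - toPlane v) ∈
        segment ℝ (toPlane γ₁) (toPlane γ₂) := by
      refine ⟨1 / 2, 1 / 2, by norm_num, by norm_num, by norm_num, ?_⟩
      rw [← hθ₁, ← hθ₂]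
      module
    have hopen : toPlane v + ((θ₁ + θ₂) / 2) • (toPlane w - toPlane v) ∈
        openSegment ℝ (toPlane v) (toPlane w) := by
      rw [openSegment_eq_image']
      exact ⟨_, ⟨by linarith, by linarith⟩, rfl⟩
    have hv := hext.left_mem_of_mem_openSegment (left_mem_segment _ _ _) (right_mem_segment _ _ _)
      hmid hopen
    have hw' := hext.right_mem_of_mem_openSegment (left_mem_segment _ _ _)
      (right_mem_segment _ _ _) hmid hopen
    obtain ⟨α, β, hα, hβ, hαβ, hv⟩ := hv
    obtain ⟨α', β', hα', hβ', hαβ', hw'⟩ := hw'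
    have g1 : α * (γ₁.1 : ℝ) + β * γ₂.1 = v.1 := by simpa [toPlane] using congrArg Prod.fst hv
    have g2 : α' * (γ₁.1 : ℝ) + β' * γ₂.1 = w.1 := by simpa [toPlane] using congrArg Prod.fst hw'
    obtain rfl : β = 1 - α := by linarith
    obtain rfl : β' = 1 - α' := by linarith
    have z1 : θ₁ = 0 := by
      have : (γ₁.1 : ℝ) ≤ v.1 := by nlinarith
      nlinarith
    have z2 : θ₂ = 1 := by
      have : (w.1 : ℝ) ≤ γ₂.1 := by nlinarith
      nlinarith
    rw [z1, zero_smul, add_zero] at hθ₁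
    rw [z2, one_smul, add_sub_cancel] at hθ₂
    rw [Set.mem_singleton_iff, toPlane_injective hθ₁, toPlane_injective hθ₂]
  · rintro _ rfl
    exact ⟨Or.inl h.fst_lt, by rw [h.convexHull_supp]⟩

end IsEdgePoly

/-! ### The two families of quasi-homogeneous polynomials -/

theorem isEdgePoly_formDiff (a : ℤ) (b : ℕ) {p q r : ℕ} {μ : Fin r → ℂ} {ν : Fin r → ℕ}
    (hq : 0 < q) (hpq : Nat.Coprime p q) (hr : 0 < r) (hμ : ∀ i, μ i ≠ 0) (hν : ∀ i, 0 < ν i) :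
    IsEdgePoly (formDiff a b p q μ ν) (a, b + p * (∑ i, ν i : ℕ)) ((q : ℤ), -(p : ℤ)) μ ν := by
  have h := isEdgePoly_of_eq (f := formDiff a b p q μ ν) (k := 0) (l := p) rfl hq
    (by simpa only [Nat.cast_zero, zero_sub] using (Nat.isCoprime_iff_coprime.2 hpq).symm.neg_right) hr hμ hν
  rwa [Nat.cast_zero, zero_sub] at h

theorem isEdgePoly_formProd (a : ℤ) (b : ℕ) {p q r : ℕ} {μ : Fin r → ℂ} {ν : Fin r → ℕ}
    (hq : 0 < q) (hpq : Nat.Coprime p q) (hr : 0 < r) (hμ : ∀ i, μ i ≠ 0) (hν : ∀ i, 0 < ν i) :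
    IsEdgePoly (formProd a b p q μ ν) (a, (b : ℤ)) ((q : ℤ), (p : ℤ)) μ ν := by
  have h := isEdgePoly_of_eq (f := formProd a b p q μ ν) (k := p) (l := 0) rfl hq
    (by simpa using (Nat.isCoprime_iff_coprime.2 hpq).symm) hr hμ hν
  rwa [Nat.cast_zero, sub_zero, zero_mul, add_zero] at h

namespace IsEdgePoly

variable {f : LaurentPoly} {v e : ℤ × ℤ} {r : ℕ} {μ : Fin r → ℂ} {ν : Fin r → ℕ}

theorem hasEulerChar (h : IsEdgePoly f v e μ ν) (hr : 0 < r) (hinj : Function.Injective μ)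
    (hμ : ∀ i, μ i ≠ 0) (hν : ∀ i, 0 < ν i) :
    CompactSupp.HasEulerChar (torusFiber f) (-(r * |((e.1 * v.2 - e.2 * v.1 : ℤ) : ℝ)|)) := by
  have hset : torusFiber f = {z : ℂ × ℂ | z.1 ≠ 0 ∧ z.2 ≠ 0 ∧
      z.1 ^ v.1 * z.2 ^ v.2 * ∏ i, (z.1 ^ e.1 * z.2 ^ e.2 - μ i) ^ ν i = 1} := by
    ext z
    refine and_congr_right fun h1 => and_congr_right fun h2 => ?_
    rw [h.eval_eq _ _ h1 h2]
  rw [hset]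
  have := (CompactSupp.hasChi_torus_curve v.1 v.2 h.coprime hr hinj hμ hν).hasEulerChar
  convert this using 1
  push_cast
  ring

/-- The triangle with the vertices 0, u, u' has n times the area |det(e, v)| / 2, and dividing by n
leaves r |det(e, v)| after the factor 2r. -/
theorem hasEulerChar_triangleArea (h : IsEdgePoly f v e μ ν) (hr : 0 < r)
    (hinj : Function.Injective μ) (hμ : ∀ i, μ i ≠ 0) (hν : ∀ i, 0 < ν i) {u u' : ℤ × ℤ}
    (hu : |u.1 * u'.2 - u.2 * u'.1| = |(∑ i, ν i : ℕ) * (e.1 * v.2 - e.2 * v.1)|) :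
    CompactSupp.HasEulerChar (torusFiber f)
      (-(2 * r * triangleArea u u' / ∑ i, (ν i : ℝ))) := by
  convert h.hasEulerChar hr hinj hμ hν using 2
  have hn : ∑ i, (ν i : ℝ) ≠ 0 := by exact_mod_cast h.length_pos.ne'
  rw [triangleArea_eq, ← Int.cast_abs, hu, abs_mul, Nat.abs_cast]
  push_cast
  field_simp

theorem hasEulerChar_areaWrt (h : IsEdgePoly f v e μ ν) (hr : 0 < r)
    (hinj : Function.Injective μ) (hμ : ∀ i, μ i ≠ 0) (hν : ∀ i, 0 < ν i)
    {F : Set ((ℤ × ℤ) × (ℤ × ℤ))}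
    (hF : ∀ γ ∈ F, γ = (v, v + (∑ i, ν i) • e) ∨ faceArea γ = 0)
    (hmem : e.1 * v.2 - e.2 * v.1 ≠ 0 → (v, v + (∑ i, ν i) • e) ∈ F) :
    CompactSupp.HasEulerChar (torusFiber f) (-(2 * areaWrt F f)) := by
  convert h.hasEulerChar hr hinj hμ hν using 2
  rw [h.areaWrt_eq hinj hμ hν hF hmem]
  ring

theorem fst_nonneg (h : IsEdgePoly f v e μ ν) (hf : IsPoly f) : 0 ≤ v.1 := by
  obtain ⟨m, hm, rfl⟩ := mem_supp_iff.1 h.left_mem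
  exact hf m hm

end IsEdgePoly

theorem mem_insert_zero_supp {f : LaurentPoly} {u : ℤ × ℤ} (hu : u ∈ insert 0 (supp f)) {c s t : ℤ}
    (hc : c < 0) : u ∈ supp f ∨ c < s * u.1 + t * u.2 := by
  rcases hu with rfl | hu
  · right
    simpa using hc
  · exact Or.inl hu

/-! ### The segment as a face of the polygons -/

section

variable {a : ℤ} {b p q r : ℕ} {μ : Fin r → ℂ} {ν : Fin r → ℕ}

theorem mem_originFaces_formDiff (hp : 0 < p) (hq : 0 < q)
    (h : IsEdgePoly (formDiff a b p q μ ν) (a, b + p * (∑ i, ν i : ℕ)) ((q : ℤ), -(p : ℤ)) μ ν) :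
    ((a, (b : ℤ) + p * (∑ i, ν i : ℕ)),
      (a, (b : ℤ) + p * (∑ i, ν i : ℕ)) + (∑ i, ν i) • ((q : ℤ), -(p : ℤ))) ∈
      originFaces (formDiff a b p q μ ν) := by
  have hp' : (0 : ℤ) < p := Nat.cast_pos.2 hp
  have hq' : (0 : ℤ) < q := Nat.cast_pos.2 hq
  have hpq := mul_pos hp' hq'
  have hpr : (0 : ℝ) < p := Nat.cast_pos.2 hp
  have hqr : (0 : ℝ) < q := Nat.cast_pos.2 hq
  have h0 : (0 : ℝ × ℝ) ∈ Set.Ici (0 : ℝ) ×ˢ Set.Ici (0 : ℝ) := ⟨le_refl (0 : ℝ), le_refl (0 : ℝ)⟩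
  refine ⟨?_, ?_, h.fst_lt, fun u hu hlt => ?_⟩
  -- The normal (p, q) of the edge is tilted to (2p, q) and below to (p, 2q): both are positive on
  -- the quadrant, with values pq and -pq on the direction (q, -p).
  · refine h.left_mem_vertices subset_rfl h0 (2 * p) q (by dsimp only; linarith)
      (fun u hu => Or.inl hu) ?_
    rintro ⟨x, y⟩ ⟨hx, hy⟩
    refine eq_zero_or_pos_of_nonneg (by push_cast; positivity) (by push_cast; positivity)
      (mul_nonneg (by push_cast; positivity) hx) (mul_nonneg (by push_cast; positivity) hy)
  · refine h.right_mem_vertices subset_rfl h0 p (2 * q) (by dsimp only; linarith)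
      (fun u hu => Or.inl hu) ?_
    rintro ⟨x, y⟩ ⟨hx, hy⟩
    refine eq_zero_or_pos_of_nonneg (by push_cast; positivity) (by push_cast; positivity)
      (mul_nonneg (by push_cast; positivity) hx) (mul_nonneg (by push_cast; positivity) hy)
  · simp only at hlt
    rcases h.eq_or_eq_of_mem_vertices subset_rfl h0
      (vertices_subset h0 (fun q hq => ⟨add_self_mem_Ici hq.1, add_self_mem_Ici hq.2⟩) hu) hu
      with rfl | rfl
    · omega
    · omega

theorem mem_infinityFaces_formDiff (hp : 0 < p) (hq : 0 < q) (ha : 0 ≤ a)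
    (h : IsEdgePoly (formDiff a b p q μ ν) (a, b + p * (∑ i, ν i : ℕ)) ((q : ℤ), -(p : ℤ)) μ ν) :
    ((a, (b : ℤ) + p * (∑ i, ν i : ℕ)),
      (a, (b : ℤ) + p * (∑ i, ν i : ℕ)) + (∑ i, ν i) • ((q : ℤ), -(p : ℤ))) ∈
      infinityFaces (formDiff a b p q μ ν) := by
  have hn : (0 : ℤ) < (∑ i, ν i : ℕ) := Nat.cast_pos.2 h.length_pos
  have hp' : (0 : ℤ) < p := Nat.cast_pos.2 hp
  have hq' : (0 : ℤ) < q := Nat.cast_pos.2 hq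
  have hpq := mul_pos hp' hq'
  have hpr : (0 : ℝ) < p := Nat.cast_pos.2 hp
  have hqr : (0 : ℝ) < q := Nat.cast_pos.2 hq
  have hb : (0 : ℤ) ≤ b := Nat.cast_nonneg b
  have h0 : (0 : ℝ × ℝ) ∈ Set.Iic (0 : ℝ) ×ˢ Set.Iic (0 : ℝ) := ⟨le_refl (0 : ℝ), le_refl (0 : ℝ)⟩
  have hpqn := mul_pos hpq hn
  have hpa := mul_nonneg hp'.le ha
  have hqb := mul_nonneg hq'.le hb
  refine h.mem_infinityFaces_of_fst ha (Or.inr ?_) ?_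
  -- Again tilted normals, now with negative entries for the opposite quadrant. They are negative at
  -- the respective end point, where the functional is thus below its value 0 at the origin. Both
  -- end points are vertices of the (∞, ∞) diagram.
  · refine h.left_mem_vertices (Set.subset_insert _ _) h0 (-p) (-(2 * q))
      (by dsimp only; linarith) (fun u hu => mem_insert_zero_supp hu (by dsimp only; linarith)) ?_
    rintro ⟨x, y⟩ ⟨hx, hy⟩
    have hx' : x ≤ 0 := hx
    have hy' : y ≤ 0 := hy
    push_cast
    refine eq_zero_or_pos_of_nonneg (neg_ne_zero.2 hpr.ne') (neg_ne_zero.2 (by positivity)) ?_ ?_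
      <;> nlinarith
  · refine h.right_mem_vertices (Set.subset_insert _ _) h0 (-(2 * p)) (-q)
      (by dsimp only; linarith) (fun u hu => mem_insert_zero_supp hu
        (by rw [add_nsmul_fst, add_nsmul_snd]; dsimp only; linarith)) ?_
    rintro ⟨x, y⟩ ⟨hx, hy⟩
    have hx' : x ≤ 0 := hx
    have hy' : y ≤ 0 := hy
    push_cast
    refine eq_zero_or_pos_of_nonneg (neg_ne_zero.2 (by positivity)) (neg_ne_zero.2 hqr.ne') ?_ ?_
      <;> nlinarith

theorem mem_infinityFaces_formProd (hp : 0 < p) (hq : 0 < q) (ha : 0 ≤ a)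
    (h : IsEdgePoly (formProd a b p q μ ν) (a, (b : ℤ)) ((q : ℤ), (p : ℤ)) μ ν)
    (hne : (q : ℤ) * b - p * a ≠ 0) :
    ((a, (b : ℤ)), (a, (b : ℤ)) + (∑ i, ν i) • ((q : ℤ), (p : ℤ))) ∈
      infinityFaces (formProd a b p q μ ν) := by
  have hn : (0 : ℤ) < (∑ i, ν i : ℕ) := Nat.cast_pos.2 h.length_pos
  have hp' : (0 : ℤ) < p := Nat.cast_pos.2 hp
  have hq' : (0 : ℤ) < q := Nat.cast_pos.2 hq
  have hb : (0 : ℤ) ≤ b := Nat.cast_nonneg b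
  have hpb : (0 : ℝ) < p + b := by positivity
  have hqa : (0 : ℝ) < q + a := by
    have : (0 : ℤ) < q + a := by linarith
    exact_mod_cast this
  have hpn := mul_pos hn hp'
  have hqn := mul_pos hn hq'
  have hw : (a, (b : ℤ)) + (∑ i, ν i) • ((q : ℤ), (p : ℤ)) ∈
      verticesInfInf (formProd a b p q μ ν) := by
    have h0 : (0 : ℝ × ℝ) ∈ Set.Iic (0 : ℝ) ×ˢ Set.Iic (0 : ℝ) :=
      ⟨le_refl (0 : ℝ), le_refl (0 : ℝ)⟩
    refine h.right_mem_vertices (Set.subset_insert _ _) h0 (-1) (-1)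
      (by dsimp only; linarith) (fun u hu => mem_insert_zero_supp hu
        (by rw [add_nsmul_fst, add_nsmul_snd]; dsimp only; linarith)) ?_
    rintro ⟨x, y⟩ ⟨hx, hy⟩
    have hx' : x ≤ 0 := hx
    have hy' : y ≤ 0 := hy
    refine eq_zero_or_pos_of_nonneg (by simp) (by simp) ?_ ?_ <;> push_cast <;> linarith
  -- The sign of det(e, v) decides on which side of the diagonal through v + e the point `v` lies,
  -- hence whether it is a vertex of the (∞, 0) or of the (0, ∞) diagram. The functional used is
  -- det(v + e, ·) in the first case and its negative in the second: it takes opposite values on `v`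
  -- and on `e`, so it is negative at `v` and increasing along the edge.
  rcases hne.lt_or_gt with hlt | hlt
  · have h0 : (0 : ℝ × ℝ) ∈ Set.Iic (0 : ℝ) ×ˢ Set.Ici (0 : ℝ) :=
      ⟨le_refl (0 : ℝ), le_refl (0 : ℝ)⟩
    refine h.mem_infinityFaces_of_snd hb hp' ?_ hw
    refine h.left_mem_vertices (Set.subset_insert _ _) h0 (-(p + b)) (q + a)
      (by dsimp only; linarith) (fun u hu => mem_insert_zero_supp hu (by dsimp only; linarith)) ?_
    rintro ⟨x, y⟩ ⟨hx, hy⟩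
    have hx' : x ≤ 0 := hx
    have hy' : 0 ≤ y := hy
    push_cast
    refine eq_zero_or_pos_of_nonneg (neg_ne_zero.2 hpb.ne') hqa.ne' ?_ ?_ <;> nlinarith
  · have h0 : (0 : ℝ × ℝ) ∈ Set.Ici (0 : ℝ) ×ˢ Set.Iic (0 : ℝ) :=
      ⟨le_refl (0 : ℝ), le_refl (0 : ℝ)⟩
    refine h.mem_infinityFaces_of_fst ha (Or.inl ?_) hw
    refine h.left_mem_vertices (Set.subset_insert _ _) h0 (p + b) (-(q + a))
      (by dsimp only; linarith) (fun u hu => mem_insert_zero_supp hu (by dsimp only; linarith)) ?_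
    rintro ⟨x, y⟩ ⟨hx, hy⟩
    have hx' : 0 ≤ x := hx
    have hy' : y ≤ 0 := hy
    push_cast
    refine eq_zero_or_pos_of_nonneg hpb.ne' (neg_ne_zero.2 hqa.ne') ?_ ?_ <;> nlinarith

end

/-! ### Monomials -/

theorem fiber_term (a : ℤ) {b : ℕ} (hb : b ≠ 0) :
    fiber (term 1 a b) = torusFiber (term 1 a b) := by
  ext ⟨x, y⟩
  simp only [fiber, torusFiber, Set.mem_ofPred_eq, eval_term]
  refine and_congr_right fun _ => ⟨fun h => ⟨?_, h⟩, fun h => h.2⟩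
  rintro rfl
  simp [hb] at h

theorem affineFiber_term {a : ℤ} (ha : 0 < a) (b : ℕ) :
    affineFiber (term 1 a b) = fiber (term 1 a b) := by
  ext ⟨x, y⟩
  simp only [fiber, affineFiber, Set.mem_ofPred_eq, eval_term]
  refine ⟨fun h => ⟨?_, h⟩, fun h => h.2⟩
  rintro rfl
  simp [zero_zpow a ha.ne'] at h

theorem hasEulerChar_torusFiber_term (a : ℤ) {b : ℕ} (hb : b ≠ 0) :
    CompactSupp.HasEulerChar (torusFiber (term 1 a b)) 0 := by
  have h := (CompactSupp.hasChi_torus_monomial (a := a) hb).hasEulerChar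
  rw [Int.cast_zero] at h
  have hset : torusFiber (term 1 a b) =
      {z : ℂ × ℂ | z.1 ≠ 0 ∧ z.2 ≠ 0 ∧ z.1 ^ a * z.2 ^ b = 1} := by
    simp only [torusFiber, eval_term]
  rwa [hset]

end NewtonPolygon

/-! ### The proposition -/

open CompactSupp NewtonPolygon in
theorem mainTheorem11 :
    (∀ (a : ℤ) (b : ℕ), a ≠ 0 → b ≠ 0 →
      HasEulerChar (torusFiber (term 1 a b)) 0 ∧
      HasEulerChar (fiber (term 1 a b)) 0 ∧
      (IsPoly (term 1 a b) → HasEulerChar (affineFiber (term 1 a b)) 0)) ∧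
    (∀ (a : ℤ) (b p q r : ℕ) (μ : Fin r → ℂ) (ν : Fin r → ℕ),
      0 < p → 0 < q → Nat.Coprime p q → 0 < r →
      Function.Injective μ → (∀ i, μ i ≠ 0) → (∀ i, 0 < ν i) →
      (HasEulerChar (torusFiber (formDiff a b p q μ ν))
          (-(2 * r * triangleArea (a + q * ∑ i, (ν i : ℤ), b) (a, b + p * ∑ i, (ν i : ℤ)) /
            ∑ i, (ν i : ℝ))) ∧
        HasEulerChar (torusFiber (formDiff a b p q μ ν))
          (-(2 * areaWrt (originFaces (formDiff a b p q μ ν)) (formDiff a b p q μ ν))) ∧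
        (IsPoly (formDiff a b p q μ ν) →
          HasEulerChar (torusFiber (formDiff a b p q μ ν))
            (-(2 * areaWrt (infinityFaces (formDiff a b p q μ ν)) (formDiff a b p q μ ν))))) ∧
      (HasEulerChar (torusFiber (formProd a b p q μ ν))
          (-(2 * r * triangleArea (a, b)
              (a + q * ∑ i, (ν i : ℤ), b + p * ∑ i, (ν i : ℤ)) /
            ∑ i, (ν i : ℝ))) ∧
        HasEulerChar (torusFiber (formProd a b p q μ ν))
          (-(2 * areaWrt (globalFaces (formProd a b p q μ ν)) (formProd a b p q μ ν))) ∧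
        (IsPoly (formProd a b p q μ ν) →
          HasEulerChar (torusFiber (formProd a b p q μ ν))
            (-(2 * areaWrt (infinityFaces (formProd a b p q μ ν)) (formProd a b p q μ ν)))))) := by
  refine ⟨fun a b ha hb => ?_, fun a b p q r μ ν hp hq hpq hr hinj hμ hν => ⟨?_, ?_⟩⟩
  · have h := hasEulerChar_torusFiber_term a hb
    refine ⟨h, by rwa [fiber_term a hb], fun hpoly => ?_⟩
    -- Since a ≠ 0, membership in ℂ[x, y] means a > 0, so neither axis meets the affine fibre.
    have ha' : 0 ≤ a := hpoly (a, b) (by simp [term])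
    rwa [affineFiber_term (ha'.lt_of_ne' ha), fiber_term a hb]
  · have h := isEdgePoly_formDiff a b hq hpq hr hμ hν
    refine ⟨h.hasEulerChar_triangleArea hr hinj hμ hν ?_,
      h.hasEulerChar_areaWrt hr hinj hμ hν (fun γ hγ => Or.inl (h.originFaces_subset hγ))
        fun _ => mem_originFaces_formDiff hp hq h,
      fun hpoly => h.hasEulerChar_areaWrt hr hinj hμ hν (fun γ hγ => h.eq_or_of_mem_infinityFaces hγ)
        fun _ => mem_infinityFaces_formDiff hp hq (h.fst_nonneg hpoly) h⟩
    congr 1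
    push_cast
    ring
  · have h := isEdgePoly_formProd a b hq hpq hr hμ hν
    refine ⟨h.hasEulerChar_triangleArea hr hinj hμ hν ?_,
      h.hasEulerChar_areaWrt hr hinj hμ hν (fun γ hγ => Or.inl (h.globalFaces_eq.subset hγ))
        fun _ => h.globalFaces_eq.superset rfl,
      fun hpoly => h.hasEulerChar_areaWrt hr hinj hμ hν (fun γ hγ => h.eq_or_of_mem_infinityFaces hγ)
        fun hne => mem_infinityFaces_formProd hp hq (h.fst_nonneg hpoly) h hne⟩
    rw [← abs_neg]
    congr 1
    push_cast
    ring
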